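/- Let $\Omega=\mathbb R^d$ or $\Omega=\mathbb T^d=\mathbb R^d/\mathbb Z^d$, let $\varepsilon\ge 0$, $T>0$, $K\in L^\infty(\Omega;\mathbb R^d)$, and consider the Vlasov (McKean–Vlasov) equation $$\partial_t f+v\cdot\nabla_x f+(K\star\rho)\cdot\nabla_v f-\varepsilon\,\Delta_v f=0,\qquad \rho(t,x)=\int_{\mathbb R^d} f(t,x,v)\,dv, \tag{1}$$ on $[0,T]\times\Omega\times\mathbb R^d$, where $(K\star\rho)(t,x)=\int_\Omega K(x-y)\rho(t,y)\,dy$. For every $\lambda>0$ there is a constant $C>0$ depending only on $\lambda$ such that the following holds. Let $f>0$ be a strong solution of (1) with $\int f(t)\,dx\,dv=1$ for all $t$ and $f\in L^\infty([0,T],W^{1,p}(\Omega\times\mathbb R^d))$ for every $1\le p\le\infty$. That is, $\partial_tf$ and $\varepsilon\Delta_vf$, understood as distributions on $(0,T)\times\Omega\times\mathbb R^d$, are locally integrable functions, (1) holds almost everywhere, and $f$ denotes its continuous representative on $[0,T]\times\Omega\times\mathbb R^d$. Assume that $$\theta_f=\sup_{t\in[0,T]}\int_{\Omega\times\mathbb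 R^d}e^{\lambda|\nabla_v\log f|}\,f\,dx\,dv<\infty$$ (essential supremum in $t$). Let $\tilde f\ge 0$ with $\int\tilde f(t)\,dx\,dv=1$ for all $t\in[0,T]$ be a weak solution of (1) with initial value $\tilde f(0)=\tilde f^0$. That is, with $\tilde\rho=\int\tilde f\,dv$, for every smooth $\varphi(t,x,v)$ whose support in $(x,v)$ is compact in $\Omega\times\mathbb R^d$ uniformly in $t$, and every $t\in[0,T]$, $$\int\tilde f(t)\varphi(t)\,dx\,dv=\int\tilde f^0\varphi(0)\,dx\,dv+\int_0^t\!\!\int\tilde f\,\big(\partial_s\varphi+v\cdot\nabla_x\varphi+(K\star\tilde\rho)\cdot\nabla_v\varphi+\varepsilon\Delta_v\varphi\big)\,dx\,dv\,ds .$$ Assume that $\tilde f$ has bounded entropy, $\sup_{t\in[0,T]}\int|\tilde f\log\tilde f|\,dx\,dv<\infty$, and satisfies, for every $t\in[0,T]$, the entropy dissipation inequality $$\int\tilde f(t)\log\tilde f(t)\,dx\,dv+\varepsilon\int_0^t\!\!\int\frac{|\nabla_v\tilde f|^2}{\tilde f}\,dx\,dv\,ds\le\int\tilde f^0\log\tilde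 f^0\,dx\,dv ,$$ where, if $\varepsilon>0$, $\nabla_v\tilde f$ is a locally integrable function on $(0,T)\times\Omega\times\mathbb R^d$. Let $H(t)=H(\tilde f|f)(t)=\int\tilde f(t)\log\big(\tilde f(t)/f(t)\big)\,dx\,dv\in[0,+\infty]$. Then for every $t\in[0,T]$ such that $H(s)\le 1$ for all $s\in[0,t]$, $$H(t)\le\exp\!\big(C\,t\,\|K\|_{L^\infty}(1+\log\theta_f)\big)\,H(0).$$ In particular, if $\tilde f^0=f(0)$ almost everywhere, then $\tilde f(t)=f(t)$ almost everywhere for every $t\in[0,T]$. -/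

import Mathlib

open MeasureTheory Set
open scoped ENNReal ContDiff Laplacian

noncomputable section

namespace Vlasov

/-- The Euclidean space `ℝ^d`. -/
abbrev E (d : ℕ) : Type := EuclideanSpace ℝ (Fin d)

/-- The phase space of pairs `z = (x, v)`; `z.1` is the position and `z.2` is the velocity. -/
abbrev Phase (d : ℕ) : Type := E d × E d

/-- The spatial domain `Ω` is either `ℝ^d` or the flat torus `𝕋^d = ℝ^d / ℤ^d`. Functions on the
torus are handled as `ℤ^d`-periodic functions on `ℝ^d`, and integrals over the torus as integrals
over the unit cell `[0,1)^d`. -/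
inductive SpatialDomain : Type
  | wholeSpace
  | torus

/-- A fundamental domain of `Ω` in `ℝ^d`. -/
def cell (Ω : SpatialDomain) (d : ℕ) : Set (E d) :=
  match Ω with
  | .wholeSpace => univ
  | .torus => {x | ∀ i, x i ∈ Ico (0 : ℝ) 1}

/-- The function `u` on `ℝ^d` descends to `Ω` (no condition if `Ω = ℝ^d`). -/
def IsPeriodic {d : ℕ} {β : Type*} (Ω : SpatialDomain) (u : E d → β) : Prop :=
  Ω = .torus → ∀ (i : Fin d) (x : E d), u (x + EuclideanSpace.single i (1 : ℝ)) = u x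

/-- The measure `dx dv` on `Ω × ℝ^d`. -/
def phaseMeasure (Ω : SpatialDomain) (d : ℕ) : Measure (Phase d) :=
  ((volume : Measure (E d)).restrict (cell Ω d)).prod (volume : Measure (E d))

/-! ### Test functions and weak derivatives -/

/-- Smooth functions of `(t, x, v) ∈ ℝ × Ω × ℝ^d` whose support in `(x, v)` is compact in
`Ω × ℝ^d`, uniformly in `t`. -/
structure IsTestFunction {d : ℕ} (Ω : SpatialDomain) (φ : ℝ × Phase d → ℝ) : Prop where
  smooth : ContDiff ℝ ∞ φ
  periodic : ∀ (t : ℝ) (v : E d), IsPeriodic Ω (fun x => φ (t, (x, v)))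
  compact_support : ∃ R : ℝ, ∀ (t : ℝ) (x v : E d), x ∈ cell Ω d → (R < ‖x‖ ∨ R < ‖v‖) →
    φ (t, (x, v)) = 0

/-- The elements of `C_c^∞((0, T) × Ω × ℝ^d)`. -/
structure IsInteriorTestFunction {d : ℕ} (Ω : SpatialDomain) (T : ℝ) (φ : ℝ × Phase d → ℝ) :
    Prop extends IsTestFunction Ω φ where
  time_support : ∃ a b : ℝ, 0 < a ∧ b < T ∧ ∀ (t : ℝ) (z : Phase d), t ∉ Icc a b → φ (t, z) = 0

/-- The `v`-Laplacian `Δ_v φ (t, x, v)`. -/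
def laplacianV {d : ℕ} (φ : ℝ × Phase d → ℝ) (t : ℝ) (z : Phase d) : ℝ :=
  (Δ (fun w : E d => φ (t, (z.1, w)))) z.2

/-- The function `g` is in `L^1_loc((0, T) × Ω × ℝ^d)`. -/
def IsLocInt {d : ℕ} {F : Type*} [NormedAddCommGroup F] (Ω : SpatialDomain) (T : ℝ)
    (g : ℝ → Phase d → F) : Prop :=
  LocallyIntegrableOn (fun p : ℝ × Phase d => g p.1 p.2) (Ioo 0 T ×ˢ univ)
    ((volume : Measure ℝ).prod (phaseMeasure Ω d))

/-- `gx = ∇_x u` and `gv = ∇_v u` in the sense of distributions on `Ω × ℝ^d`. -/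
def IsWeakGradient {d : ℕ} (Ω : SpatialDomain) (u : Phase d → ℝ) (gx gv : Phase d → E d) : Prop :=
  ∀ ψ : Phase d → ℝ, IsTestFunction Ω (fun p : ℝ × Phase d => ψ p.2) → ∀ h k : E d,
    ∫ z, u z * fderiv ℝ ψ z (h, k) ∂(phaseMeasure Ω d) =
      -∫ z, ψ z * (inner ℝ (gx z) h + inner ℝ (gv z) k) ∂(phaseMeasure Ω d)

/-- `g ∈ L^1_loc` is `∇_v u` in the sense of distributions on `(0, T) × Ω × ℝ^d`. -/
def IsWeakGradientV {d : ℕ} (Ω : SpatialDomain) (T : ℝ) (u : ℝ → Phase d → ℝ)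
    (g : ℝ → Phase d → E d) : Prop :=
  IsLocInt Ω T g ∧ ∀ φ : ℝ × Phase d → ℝ, IsInteriorTestFunction Ω T φ → ∀ k : E d,
    ∫ t in (0 : ℝ)..T, ∫ z, u t z * fderiv ℝ φ (t, z) (0, (0, k)) ∂(phaseMeasure Ω d) =
      -∫ t in (0 : ℝ)..T, ∫ z, φ (t, z) * inner ℝ (g t z) k ∂(phaseMeasure Ω d)

/-- `g ∈ L^1_loc` is `∂_t u` in the sense of distributions on `(0, T) × Ω × ℝ^d`. -/
def IsWeakTimeDeriv {d : ℕ} (Ω : SpatialDomain) (T : ℝ) (u g : ℝ → Phase d → ℝ) : Prop :=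
  IsLocInt Ω T g ∧ ∀ φ : ℝ × Phase d → ℝ, IsInteriorTestFunction Ω T φ →
    ∫ t in (0 : ℝ)..T, ∫ z, u t z * fderiv ℝ φ (t, z) (1, 0) ∂(phaseMeasure Ω d) =
      -∫ t in (0 : ℝ)..T, ∫ z, φ (t, z) * g t z ∂(phaseMeasure Ω d)

/-- `g ∈ L^1_loc` is `ε Δ_v u` in the sense of distributions on `(0, T) × Ω × ℝ^d`
(so `g = 0` if `ε = 0`). -/
def IsWeakScaledLaplacianV {d : ℕ} (Ω : SpatialDomain) (T ε : ℝ) (u g : ℝ → Phase d → ℝ) : Prop :=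
  IsLocInt Ω T g ∧ ∀ φ : ℝ × Phase d → ℝ, IsInteriorTestFunction Ω T φ →
    ε * ∫ t in (0 : ℝ)..T, ∫ z, u t z * laplacianV φ t z ∂(phaseMeasure Ω d) =
      ∫ t in (0 : ℝ)..T, ∫ z, φ (t, z) * g t z ∂(phaseMeasure Ω d)

/-! ### The Vlasov equation `∂_t f + v · ∇_x f + (K ⋆ ρ) · ∇_v f - ε Δ_v f = 0` -/

/-- The macroscopic density `ρ(x) = ∫ u(x, v) dv`. -/
def density {d : ℕ} (u : Phase d → ℝ) (x : E d) : ℝ := ∫ v, u (x, v)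

/-- The force field `(K ⋆ ρ)(x) = ∫_Ω K(x - y) ρ(y) dy`, where `ρ` is the density of `u`. -/
def force {d : ℕ} (Ω : SpatialDomain) (K : E d → E d) (u : Phase d → ℝ) (x : E d) : E d :=
  ∫ y in cell Ω d, density u y • K (x - y)

/-- `u` is a probability density on `Ω × ℝ^d`. -/
structure IsProbDensity {d : ℕ} (Ω : SpatialDomain) (u : Phase d → ℝ) : Prop where
  nonneg : ∀ᵐ z ∂(phaseMeasure Ω d), 0 ≤ u z
  integrable : Integrable u (phaseMeasure Ω d)
  mass : ∫ z, u z ∂(phaseMeasure Ω d) = 1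

/-- A positive strong solution `f` of mass one on `[0, T]`, with spatial and velocity gradients
`gx = ∇_x f` and `gv = ∇_v f`: the function `f` is in `L^∞([0, T], W^{1,p}(Ω × ℝ^d))` for every
`1 ≤ p ≤ ∞`, the derivatives occurring in the equation are locally integrable functions, and the
equation holds almost everywhere. The (unique) continuous representative of `f` is used, so that
the values `f(t)`, in particular `f(0)`, and the function `log f` make sense. -/
structure IsStrongSolution {d : ℕ} (Ω : SpatialDomain) (ε T : ℝ) (K : E d → E d)
    (f : ℝ → Phase d → ℝ) (gx gv : ℝ → Phase d → E d) : Prop where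
  periodic : ∀ t ∈ Icc 0 T, ∀ v : E d, IsPeriodic Ω (fun x => f t (x, v))
  continuousOn : ContinuousOn (fun p : ℝ × Phase d => f p.1 p.2) (Icc 0 T ×ˢ univ)
  pos : ∀ t ∈ Icc 0 T, ∀ z, 0 < f t z
  probDensity : ∀ t ∈ Icc 0 T, IsProbDensity Ω (f t)
  measurable_gx : AEStronglyMeasurable (fun p : ℝ × Phase d => gx p.1 p.2)
    (((volume : Measure ℝ).restrict (Icc 0 T)).prod (phaseMeasure Ω d))
  measurable_gv : AEStronglyMeasurable (fun p : ℝ × Phase d => gv p.1 p.2)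
    (((volume : Measure ℝ).restrict (Icc 0 T)).prod (phaseMeasure Ω d))
  weakGradient : ∀ᵐ t ∂((volume : Measure ℝ).restrict (Icc 0 T)),
    IsWeakGradient Ω (f t) (gx t) (gv t)
  sobolev : ∀ p : ℝ≥0∞, 1 ≤ p → ∃ M : ℝ, ∀ᵐ t ∂((volume : Measure ℝ).restrict (Icc 0 T)),
    eLpNorm (f t) p (phaseMeasure Ω d) ≤ ENNReal.ofReal M ∧
    eLpNorm (gx t) p (phaseMeasure Ω d) ≤ ENNReal.ofReal M ∧
    eLpNorm (gv t) p (phaseMeasure Ω d) ≤ ENNReal.ofReal M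
  equation : ∃ ft lap : ℝ → Phase d → ℝ,
    IsWeakTimeDeriv Ω T f ft ∧ IsWeakScaledLaplacianV Ω T ε f lap ∧
    ∀ᵐ p ∂(((volume : Measure ℝ).restrict (Ioo 0 T)).prod (phaseMeasure Ω d)),
      ft p.1 p.2 + inner ℝ p.2.2 (gx p.1 p.2)
        + inner ℝ (force Ω K (f p.1) p.2.1) (gv p.1 p.2) - lap p.1 p.2 = 0

/-- A weak solution `u` of mass one on `[0, T]`, with initial value `u 0`: the equation is tested
against smooth compactly supported functions between time `0` and every time `t ∈ [0, T]`
(that is, `u` is taken as its weakly continuous representative in time). -/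
structure IsWeakSolution {d : ℕ} (Ω : SpatialDomain) (ε T : ℝ) (K : E d → E d)
    (u : ℝ → Phase d → ℝ) : Prop where
  measurable : AEStronglyMeasurable (fun p : ℝ × Phase d => u p.1 p.2)
    (((volume : Measure ℝ).restrict (Icc 0 T)).prod (phaseMeasure Ω d))
  probDensity : ∀ t ∈ Icc 0 T, IsProbDensity Ω (u t)
  equation : ∀ φ : ℝ × Phase d → ℝ, IsTestFunction Ω φ → ∀ t ∈ Icc 0 T,
    ∫ z, u t z * φ (t, z) ∂(phaseMeasure Ω d) = ∫ z, u 0 z * φ (0, z) ∂(phaseMeasure Ω d)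
      + ∫ s in (0 : ℝ)..t, ∫ z, u s z *
          (fderiv ℝ φ (s, z) (1, (z.2, force Ω K (u s) z.1)) + ε * laplacianV φ s z)
            ∂(phaseMeasure Ω d)

/-! ### Entropies -/

/-- The entropy `∫ u log u dx dv`. -/
def entropy {d : ℕ} (Ω : SpatialDomain) (u : Phase d → ℝ) : ℝ :=
  ∫ z, u z * Real.log (u z) ∂(phaseMeasure Ω d)

/-- `∫_0^t ∫ |∇_v u|² / u dx dv ds`, where `g = ∇_v u` (with `0 / 0 = 0`). -/
def fisherInfo {d : ℕ} (Ω : SpatialDomain) (u : ℝ → Phase d → ℝ) (g : ℝ → Phase d → E d)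
    (t : ℝ) : ℝ≥0∞ :=
  ∫⁻ s in Icc 0 t, ∫⁻ z, ‖g s z‖ₑ ^ 2 / ENNReal.ofReal (u s z) ∂(phaseMeasure Ω d)

/-- The entropy is bounded on `[0, T]`: `u log u ∈ L^∞([0, T], L^1(Ω × ℝ^d))`. -/
def HasBoundedEntropy {d : ℕ} (Ω : SpatialDomain) (T : ℝ) (u : ℝ → Phase d → ℝ) : Prop :=
  ∃ M : ℝ, ∀ t ∈ Icc 0 T,
    Integrable (fun z => u t z * Real.log (u t z)) (phaseMeasure Ω d) ∧
    ∫ z, |u t z * Real.log (u t z)| ∂(phaseMeasure Ω d) ≤ M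

/-- The dissipation of entropy, for all `t ∈ [0, T]`:
`∫ u(t) log u(t) + ε ∫_0^t ∫ |∇_v u|² / u ≤ ∫ u(0) log u(0)`.
If `ε = 0` the second term is `0` and no derivative of `u` is involved. -/
def EntropyDissipation {d : ℕ} (Ω : SpatialDomain) (ε T : ℝ) (u : ℝ → Phase d → ℝ) : Prop :=
  ∃ g : ℝ → Phase d → E d, (0 < ε → IsWeakGradientV Ω T u g) ∧ ∀ t ∈ Icc 0 T,
    ((entropy Ω (u t) : ℝ) : EReal) + ((ENNReal.ofReal ε * fisherInfo Ω u g t : ℝ≥0∞) : EReal)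
      ≤ ((entropy Ω (u 0) : ℝ) : EReal)

open Classical in
/-- The relative entropy `H(u | w) = ∫ u log (u / w) dx dv` of a probability density `u` with
respect to a positive probability density `w`. The negative part of the integrand is always
integrable (it is at most `w`), so the value is `+∞` if the integrand is not integrable. -/
def relEntropy {d : ℕ} (Ω : SpatialDomain) (u w : Phase d → ℝ) : ℝ≥0∞ :=
  if Integrable (fun z => u z * Real.log (u z / w z)) (phaseMeasure Ω d) then
    ENNReal.ofReal (∫ z, u z * Real.log (u z / w z) ∂(phaseMeasure Ω d))
  else ∞

/-- For probability densities, `relEntropy` is the Kullback-Leibler divergence of the two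
probability measures. -/
theorem relEntropy_eq_klDiv {d : ℕ} (Ω : SpatialDomain) (u w : Phase d → ℝ)
    (hu : IsProbDensity Ω u) (hw : IsProbDensity Ω w) (hpos : ∀ z, 0 < w z) :
    relEntropy Ω u w = InformationTheory.klDiv
      ((phaseMeasure Ω d).withDensity fun z => ENNReal.ofReal (u z))
      ((phaseMeasure Ω d).withDensity fun z => ENNReal.ofReal (w z)) := by
  set m := phaseMeasure Ω d with hm
  have hσ : SigmaFinite m := by rw [hm]; unfold phaseMeasure; infer_instance
  have hua : AEMeasurable (fun z => ENNReal.ofReal (u z)) m :=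
    hu.integrable.aestronglyMeasurable.aemeasurable.ennreal_ofReal
  have hwa : AEMeasurable (fun z => ENNReal.ofReal (w z)) m :=
    hw.integrable.aestronglyMeasurable.aemeasurable.ennreal_ofReal
  have hra : AEMeasurable (fun z => ENNReal.ofReal (u z / w z)) m :=
    (hu.integrable.aestronglyMeasurable.aemeasurable.div
      hw.integrable.aestronglyMeasurable.aemeasurable).ennreal_ofReal
  have hprod : m.withDensity (fun z => ENNReal.ofReal (u z)) =
      (m.withDensity fun z => ENNReal.ofReal (w z)).withDensity
        (fun z => ENNReal.ofReal (u z / w z)) := by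
    rw [← withDensity_mul₀ hwa hra]
    congr 1
    funext z
    simp only [Pi.mul_apply]
    rw [← ENNReal.ofReal_mul (hpos z).le, mul_div_cancel₀ _ (hpos z).ne']
  have hmass : ∀ q : Phase d → ℝ, IsProbDensity Ω q →
      m.withDensity (fun z => ENNReal.ofReal (q z)) univ = 1 := by
    intro q hq
    rw [withDensity_apply _ MeasurableSet.univ, Measure.restrict_univ,
      ← ofReal_integral_eq_lintegral_ofReal hq.integrable hq.nonneg, hq.mass, ENNReal.ofReal_one]
  set P := m.withDensity fun z => ENNReal.ofReal (u z) with hP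
  set Q := m.withDensity fun z => ENNReal.ofReal (w z) with hQ
  have hQm : Q ≪ m := withDensity_absolutelyContinuous _ _
  have hPm : P ≪ m := withDensity_absolutelyContinuous _ _
  have hPQ : P ≪ Q := by rw [hprod]; exact withDensity_absolutelyContinuous _ _
  have hQf : IsFiniteMeasure Q := ⟨by rw [hmass w hw]; exact ENNReal.one_lt_top⟩
  have hrn : P.rnDeriv Q =ᵐ[Q] fun z => ENNReal.ofReal (u z / w z) := by
    rw [hprod]; exact Measure.rnDeriv_withDensity₀ Q (hra.mono_ac hQm)
  have hllr : llr P Q =ᵐ[P] fun z => Real.log (u z / w z) := by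
    filter_upwards [hPQ.ae_le hrn, hPm.ae_le hu.nonneg] with z h1 h2
    rw [llr, h1, ENNReal.toReal_ofReal (div_nonneg h2 (hpos z).le)]
  have hsm : ∀ᵐ z ∂m, (ENNReal.ofReal (u z)).toReal • Real.log (u z / w z) =
      u z * Real.log (u z / w z) := by
    filter_upwards [hu.nonneg] with z h
    rw [ENNReal.toReal_ofReal h, smul_eq_mul]
  have hint : Integrable (llr P Q) P ↔ Integrable (fun z => u z * Real.log (u z / w z)) m := by
    rw [integrable_congr hllr, hP, integrable_withDensity_iff_integrable_smul₀' hua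
      (Filter.Eventually.of_forall fun _ => ENNReal.ofReal_lt_top), integrable_congr hsm]
  have hval : ∫ z, llr P Q z ∂P = ∫ z, u z * Real.log (u z / w z) ∂m := by
    rw [integral_congr_ae hllr, hP, integral_withDensity_eq_integral_toReal_smul₀ hua
      (Filter.Eventually.of_forall fun _ => ENNReal.ofReal_lt_top), integral_congr_ae hsm]
  rw [relEntropy]
  have hP1 : P univ = 1 := hmass u hu
  have hQ1 : Q univ = 1 := hmass w hw
  by_cases h : Integrable (fun z => u z * Real.log (u z / w z)) m
  · rw [if_pos h, InformationTheory.klDiv_of_ac_of_integrable hPQ (hint.2 h), hval]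
    simp [measureReal_def, hP1, hQ1, hm]
  · rw [if_neg h, InformationTheory.klDiv_of_not_integrable (fun h' => h (hint.1 h'))]

/-- `θ_f = sup_{t ∈ [0, T]} ∫ exp (lam * |∇_v log f|) f dx dv` where `gv = ∇_v f`, so that
`∇_v log f = gv / f`. As `∇_v f` is defined for almost every `t`, the supremum is the essential
one. -/
def expMoment {d : ℕ} (Ω : SpatialDomain) (lam T : ℝ) (f : ℝ → Phase d → ℝ)
    (gv : ℝ → Phase d → E d) : ℝ≥0∞ :=
  essSup (fun t => ∫⁻ z, ENNReal.ofReal (Real.exp (lam * ‖(f t z)⁻¹ • gv t z‖) * f t z)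
    ∂(phaseMeasure Ω d)) ((volume : Measure ℝ).restrict (Icc 0 T))

/-- `‖K‖_{L^∞}`. -/
def supNorm {d : ℕ} (K : E d → E d) : ℝ := (eLpNorm K ∞ (volume : Measure (E d))).toReal

end Vlasov

end

open MeasureTheory Set
open scoped ENNReal ContDiff Laplacian

namespace Vlasov


/-! ### Integral form of Grönwall's inequality -/

/-! Write u for the weak solution, ρ̃ for its density, and H = ∫ u log u − ∫ u log f. The entropy
dissipation inequality controls the first term. The second is found by testing the weak equation
with log f: the equation of f gives (∂_t + v·∇_x + (K⋆ρ̃)·∇_v + εΔ_v) log f = (K⋆(ρ̃−ρ))·∇_v log f +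
ε(2Δ_v log f + |∇_v log f|²). Integrated against u, the last bracket is at least −∫ |∇_v u|²/u, by
parts and by Young's inequality, and the dissipation of u pays for exactly this. What remains is
H(t) ≤ H(0) − ∫_0^t ∫ u (K⋆(ρ̃−ρ))·∇_v log f.

Since K⋆(ρ̃−ρ) depends on x only and ∫ ∇_v f dv = 0 (`IsWeakGradient.integral_inner_eq_zero`), u may
be replaced by u − f in this drift. It is then at most ‖K‖ ‖u−f‖₁ ∫ |u−f| |∇_v log f|. A weighted
Csiszár–Kullback–Pinsker inequality (`integral_abs_sub_mul_le`) bounds both factors by multiples of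
max(√H, H); the exponential moment enters only through 1 + log θ (`lintegral_exp_div_le`). The
product is at most a multiple of H: for H ≤ 1 as √H·√H, for H ≥ 1 because ‖u−f‖₁ ≤ 2
(`abs_integral_drift_le`). Grönwall's inequality concludes.

The function log f is not a legal test function: f has only one weak derivative in space, it may
tend to zero, and log f has no compact support. It is replaced by χ log(F + δ), with F a space-time
mollification of f and χ a cut-off (`IsWeakSolution.integral_mollDrift_le`). The mollification is
removed first, then the end points of the time interval and the cut-off, which yields the entropy
inequality relative to f + δ (`IsWeakSolution.entropy_sub_le`).

The limit δ → 0 needs bounds uniform in δ. A Fenchel–Young inequality (`mul_div_add_le`) bounds λ ∫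
u |∇_v f|/(f+δ) by the entropy relative to f + δ plus a constant, so a first Grönwall argument
bounds these entropies (`IsWeakSolution.exists_bound_shiftedEntropy`). Fatou's lemma then makes H(t)
finite, and dominated convergence gives the inequality for H itself
(`IsWeakSolution.relEntropy_stability`).

On the torus, mollification takes place on ℝ^d: a compactly supported function on ℝ^d is turned into
a test function by summing its lattice translates (`IsBumpLike.integral_fold_mul`). -/

theorem le_mul_exp_of_le_add_mul_integral {T A B : ℝ} (hB : 0 ≤ B) {h : ℝ → ℝ}
    (hint : IntegrableOn h (Icc 0 T))
    (hle : ∀ t ∈ Icc 0 T, h t ≤ A + B * ∫ s in (0 : ℝ)..t, h s) :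
    ∀ t ∈ Icc 0 T, h t ≤ A * Real.exp (B * t) := by
  intro t ht
  rcases hB.eq_or_lt with rfl | hB'
  · simpa using hle t ht
  set h' : ℝ → ℝ := indicator (Icc 0 T) h with hh'
  have hint' : Integrable h' := hint.integrable_indicator measurableSet_Icc
  set y : ℝ → ℝ := fun t => A + B * ∫ s in (0 : ℝ)..t, h' s with hy
  have hycont : Continuous y :=
    continuous_const.add (continuous_const.mul (intervalIntegral.continuous_primitive
      (fun a b => hint'.intervalIntegrable) 0))
  have heq : ∀ t ∈ Icc 0 T, ∫ s in (0 : ℝ)..t, h s = ∫ s in (0 : ℝ)..t, h' s := by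
    intro t ht
    refine intervalIntegral.integral_congr fun s hs => ?_
    rw [uIcc_of_le ht.1] at hs
    rw [hh', indicator_of_mem (show s ∈ Icc 0 T from ⟨hs.1, hs.2.trans ht.2⟩)]
  have hhy : ∀ t ∈ Icc 0 T, h t ≤ y t := fun t ht => by
    have := hle t ht
    rwa [heq t ht] at this
  -- Since `h` is merely integrable, the differential Grönwall inequality is applied to the
  -- primitive `Y` of its continuous majorant `y`, for which Y' ≤ B Y + A and Y(0) = 0.
  set Y : ℝ → ℝ := fun t => ∫ s in (0 : ℝ)..t, y s with hY
  have hYd : ∀ x, HasDerivAt Y (y x) x := fun x =>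
    intervalIntegral.integral_hasDerivAt_right (hycont.intervalIntegrable _ _)
      (hycont.stronglyMeasurableAtFilter _ _) hycont.continuousAt
  have hyY : ∀ t ∈ Icc 0 T, y t ≤ B * Y t + A := by
    intro t ht
    have : ∫ s in (0 : ℝ)..t, h' s ≤ Y t := by
      refine intervalIntegral.integral_mono_on ht.1 hint'.intervalIntegrable
        (hycont.intervalIntegrable _ _) fun s hs => ?_
      have hs' : s ∈ Icc 0 T := ⟨hs.1, hs.2.trans ht.2⟩
      rw [hh', indicator_of_mem hs']
      exact hhy s hs'
    have := mul_le_mul_of_nonneg_left this hB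
    simp only [hy]
    linarith
  have hgr := le_gronwallBound_of_liminf_deriv_right_le (f := Y) (f' := y) (δ := 0) (K := B)
    (ε := A) (a := 0) (b := T)
    (fun x _ => (hYd x).continuousAt.continuousWithinAt)
    (fun x _ r hr => (hYd x).hasDerivWithinAt.liminf_right_slope_le hr)
    (by simp [hY]) (fun x hx => hyY x ⟨hx.1, hx.2.le⟩) t ht
  rw [gronwallBound_of_K_ne_0 hB'.ne'] at hgr
  have h1 := hhy t ht
  have h2 := hyY t ht
  have h3 := mul_le_mul_of_nonneg_left hgr hB
  have h4 : B * (0 * Real.exp (B * (t - 0)) + A / B * (Real.exp (B * (t - 0)) - 1))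
      = A * Real.exp (B * t) - A := by
    rw [sub_zero]
    field_simp
    ring
  linarith

/-! ### Pointwise convexity inequalities -/

/-- Fenchel–Young for the conjugate pair r log r − r and exp; it is exp s ≥ 1 + s at s = y − log r.
-/
theorem mul_le_mul_log_sub_add_exp {r : ℝ} (hr : 0 ≤ r) (y : ℝ) :
    r * y ≤ r * Real.log r - r + Real.exp y := by
  rcases hr.eq_or_lt with rfl | hr
  · simpa using (Real.exp_pos y).le
  · have h := Real.add_one_le_exp (y - Real.log r)
    rw [Real.exp_sub, Real.exp_log hr, le_div_iff₀ hr] at h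
    nlinarith

/-- With s = −log r ≥ 0 this is s ≤ sinh s multiplied by r. -/
theorem sq_sub_one_div_two_le_mul_log {r : ℝ} (hr : 0 ≤ r) (hr1 : r ≤ 1) :
    (r ^ 2 - 1) / 2 ≤ r * Real.log r := by
  rcases hr.eq_or_lt with rfl | hr
  · norm_num
  · have h := Real.self_le_sinh_iff.2 (neg_nonneg.2 (Real.log_nonpos hr.le hr1))
    rw [Real.sinh_eq, neg_neg, Real.exp_neg, Real.exp_log hr] at h
    have := mul_le_mul_of_nonneg_left h hr.le
    have h2 : r * ((r⁻¹ - r) / 2) = (1 - r ^ 2) / 2 := by field_simp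
    rw [h2] at this
    linarith

theorem mul_log_sub_add_one_nonneg {r : ℝ} (hr : 0 ≤ r) : 0 ≤ r * Real.log r - r + 1 := by
  simpa using mul_le_mul_log_sub_add_exp hr 0

/-- For r ≥ 1 this is Fenchel–Young. For r ≤ 1 the two brackets are at least (1−r)²/2 and y²/2, and
the arithmetic-geometric mean inequality applies. Both brackets vanish to second order, at r = 1 and
at y = 0, which is what produces a square root of the entropy later. -/
theorem abs_sub_one_mul_le {r y : ℝ} (hr : 0 ≤ r) (hy : 0 ≤ y) :
    |r - 1| * y ≤ (r * Real.log r - r + 1) + (Real.exp y - 1 - y) := by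
  rcases le_total 1 r with h | h
  · rw [abs_of_nonneg (by linarith)]
    have := mul_le_mul_log_sub_add_exp hr y
    linarith
  · rw [abs_of_nonpos (by linarith)]
    have h1 := sq_sub_one_div_two_le_mul_log hr h
    have h2 := Real.quadratic_le_exp_of_nonneg hy
    nlinarith [sq_nonneg (1 - r - y)]

/-- The factor τ² is the point: it makes the later optimization in τ worthwhile. With y = τb one has
exp y − 1 − y ≤ y² exp y, and b² ≤ 2 exp b absorbs the polynomial. -/
theorem exp_sub_one_sub_le {τ b : ℝ} (hτ : 0 ≤ τ) (hτ1 : τ ≤ 1) (hb : 0 ≤ b) :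
    Real.exp (τ * b) - 1 - τ * b ≤ 2 * τ ^ 2 * Real.exp (2 * b) := by
  set y := τ * b with hy
  have hy0 : 0 ≤ y := mul_nonneg hτ hb
  have h1 : Real.exp y - 1 ≤ y * Real.exp y := by
    have h := Real.add_one_le_exp (-y)
    have h' := mul_le_mul_of_nonneg_right h (Real.exp_pos y).le
    rw [← Real.exp_add, neg_add_cancel, Real.exp_zero] at h'
    nlinarith
  have h2 : Real.exp y ≤ Real.exp b := Real.exp_le_exp.2 (by nlinarith)
  have h3 := Real.quadratic_le_exp_of_nonneg hb
  have h4 : Real.exp (2 * b) = Real.exp b * Real.exp b := by rw [← Real.exp_add]; ring_nf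
  have h5 : b ^ 2 ≤ 2 * Real.exp b := by nlinarith
  have e0 := Real.exp_pos y
  have eb := Real.exp_pos b
  calc Real.exp y - 1 - y ≤ y * Real.exp y - y := by linarith
    _ = y * (Real.exp y - 1) := by ring
    _ ≤ y * (y * Real.exp y) := mul_le_mul_of_nonneg_left h1 hy0
    _ = τ ^ 2 * (b ^ 2 * Real.exp y) := by rw [hy]; ring
    _ ≤ τ ^ 2 * (2 * Real.exp b * Real.exp b) := by gcongr
    _ = 2 * τ ^ 2 * Real.exp (2 * b) := by rw [h4]; ring

theorem exp_mul_sub_one_le {t b : ℝ} (ht : 0 ≤ t) (ht1 : t ≤ 1) :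
    Real.exp (t * b) - 1 ≤ t * (Real.exp b - 1) := by
  have := convexOn_exp.2 (mem_univ b) (mem_univ (0 : ℝ)) ht (sub_nonneg.2 ht1) (by ring)
  simp only [smul_eq_mul, mul_zero, add_zero, Real.exp_zero, mul_one] at this
  linarith

theorem mul_log_div_nonneg_aux {u f : ℝ} (hu : 0 ≤ u) (hf : 0 < f) :
    0 ≤ u * Real.log (u / f) - u + f := by
  have := mul_nonneg hf.le (mul_log_sub_add_one_nonneg (div_nonneg hu hf.le))
  have h2 : f * (u / f * Real.log (u / f) - u / f + 1) = u * Real.log (u / f) - u + f := by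
    field_simp
  rwa [h2] at this

/-- The preceding inequality `abs_sub_one_mul_le` at r = u/f, multiplied by f. -/
theorem abs_sub_mul_le {u f y : ℝ} (hu : 0 ≤ u) (hf : 0 < f) (hy : 0 ≤ y) :
    |u - f| * y ≤ (u * Real.log (u / f) - u + f) + (Real.exp y - 1 - y) * f := by
  have h := mul_le_mul_of_nonneg_left (abs_sub_one_mul_le (div_nonneg hu hf.le) hy) hf.le
  have h1 : f * (|u / f - 1| * y) = |u - f| * y := by
    rw [← mul_assoc]
    congr 1
    rw [← abs_of_pos hf, ← abs_mul, abs_of_pos hf]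
    congr 1
    field_simp
  have h2 : f * (u / f * Real.log (u / f) - u / f + 1 + (Real.exp y - 1 - y)) =
      (u * Real.log (u / f) - u + f) + (Real.exp y - 1 - y) * f := by
    field_simp
  rwa [h1, h2] at h

/-- Fenchel–Young bound for the velocity gradient of the shifted reference density. -/
theorem mul_div_add_le {u f δ M lam c : ℝ} (hu : 0 ≤ u) (hf : 0 < f) (hfM : f ≤ M)
    (hδ : 0 < δ) (hδ1 : δ ≤ 1) (hlam : 0 < lam) (hc : 0 ≤ c) :
    lam * (u * (c / (f + δ))) ≤ u * Real.log (u / (f + δ)) +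
      (|u * Real.log u| + u * Real.log (1 + M) + 2 * (Real.exp (lam * (c / f)) * f)) := by
  set w := f + δ with hw
  have hw0 : 0 < w := by positivity
  have hM : 0 ≤ Real.log (1 + M) := Real.log_nonneg (by linarith)
  have hE : lam * c ≤ Real.exp (lam * (c / f)) * f := by
    have := Real.add_one_le_exp (lam * (c / f))
    have h2 := mul_le_mul_of_nonneg_right this hf.le
    have h3 : (lam * (c / f) + 1) * f = lam * c + f := by field_simp
    linarith
  have hE0 : 0 ≤ Real.exp (lam * (c / f)) * f := by positivity
  -- If u ≥ w, Fenchel–Young at r = u/w produces w exp(λc/w). Convexity of exp with weight f/w gives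
  -- w exp(λc/w) ≤ w + f exp(λc/f) − f, and −u absorbs the w; nothing depends on δ.
  rcases le_total w u with h | h
  · have h1 := mul_le_mul_of_nonneg_left
      (mul_le_mul_log_sub_add_exp (div_nonneg hu hw0.le) (lam * (c / w))) hw0.le
    have h2 : w * (u / w * (lam * (c / w))) = lam * (u * (c / w)) := by field_simp
    have h3 : w * (u / w * Real.log (u / w) - u / w + Real.exp (lam * (c / w))) =
        u * Real.log (u / w) - u + w * Real.exp (lam * (c / w)) := by field_simp
    rw [h2, h3] at h1
    have h4 := exp_mul_sub_one_le (t := f / w) (b := lam * (c / f)) (by positivity)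
      ((div_le_one hw0).2 (by linarith))
    have h5 : f / w * (lam * (c / f)) = lam * (c / w) := by field_simp
    rw [h5] at h4
    have h6 := mul_le_mul_of_nonneg_left h4 hw0.le
    have h7 : w * (f / w * (Real.exp (lam * (c / f)) - 1)) =
        Real.exp (lam * (c / f)) * f - f := by field_simp
    rw [h7] at h6
    have := abs_nonneg (u * Real.log u)
    have := mul_nonneg hu hM
    nlinarith
  -- If u ≤ w, the left side is at most λc, which one exponential already dominates. The entropy
  -- term may be negative but is bounded below through log w ≤ log(1 + M).
  · have h1 : lam * (u * (c / w)) ≤ lam * c := by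
      refine mul_le_mul_of_nonneg_left ?_ hlam.le
      rw [← mul_div_assoc, div_le_iff₀ hw0, mul_comm c]
      exact mul_le_mul_of_nonneg_right h hc
    have h2 : 0 ≤ u * Real.log (u / w) + (|u * Real.log u| + u * Real.log (1 + M)) := by
      rcases hu.eq_or_lt with rfl | hu
      · simp
      rw [Real.log_div hu.ne' hw0.ne']
      have h3 : Real.log w ≤ Real.log (1 + M) := Real.log_le_log hw0 (by linarith)
      have h4 := neg_abs_le (u * Real.log u)
      nlinarith
    linarith

/-! ### A weighted Csiszár–Kullback–Pinsker inequality -/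

section Pinsker

variable {Z : Type*} [MeasurableSpace Z] {μ : Measure Z} {u f b : Z → ℝ}

theorem integral_sub_add {a b c : Z → ℝ} (ha : Integrable a μ) (hb : Integrable b μ)
    (hc : Integrable c μ) :
    ∫ z, (a z - b z + c z) ∂μ = ∫ z, a z ∂μ - ∫ z, b z ∂μ + ∫ z, c z ∂μ := by
  have hab : Integrable (fun z => a z - b z) μ := ha.sub hb
  rw [integral_add hab hc, integral_sub ha hb]

theorem integral_mul_log_div_nonneg (hu : Integrable u μ) (hf : Integrable f μ)
    (hu0 : ∀ᵐ z ∂μ, 0 ≤ u z) (hf0 : ∀ z, 0 < f z) (hmass : ∫ z, u z ∂μ = ∫ z, f z ∂μ)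
    (hH : Integrable (fun z => u z * Real.log (u z / f z)) μ) :
    0 ≤ ∫ z, u z * Real.log (u z / f z) ∂μ := by
  have h : 0 ≤ ∫ z, (u z * Real.log (u z / f z) - u z + f z) ∂μ :=
    integral_nonneg_of_ae (by
      filter_upwards [hu0] with z hz using mul_log_div_nonneg_aux hz (hf0 z))
  have h2 : ∫ z, (u z * Real.log (u z / f z) - u z + f z) ∂μ =
      (∫ z, u z * Real.log (u z / f z) ∂μ - ∫ z, u z ∂μ) + ∫ z, f z ∂μ := by
    rw [integral_sub_add hH hu hf]
  linarith

theorem integrable_of_lintegral_ofReal_le {g : Z → ℝ} (hg : AEStronglyMeasurable g μ)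
    (hg0 : ∀ᵐ z ∂μ, 0 ≤ g z) {c : ℝ≥0∞} (hc : c ≠ ⊤)
    (h : ∫⁻ z, ENNReal.ofReal (g z) ∂μ ≤ c) : Integrable g μ := by
  refine ⟨hg, ?_⟩
  rw [hasFiniteIntegral_iff_ofReal hg0]
  exact h.trans_lt hc.lt_top

theorem integral_le_of_lintegral_ofReal_le {g : Z → ℝ} (hg : AEStronglyMeasurable g μ)
    (hg0 : ∀ᵐ z ∂μ, 0 ≤ g z) {c : ℝ} (hc : 0 ≤ c)
    (h : ∫⁻ z, ENNReal.ofReal (g z) ∂μ ≤ ENNReal.ofReal c) : ∫ z, g z ∂μ ≤ c := by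
  rw [integral_eq_lintegral_of_nonneg_ae hg0 hg]
  exact ENNReal.toReal_le_of_le_ofReal hc h

/-- Take y = τb in the pointwise inequality and integrate. The masses agree, so −u + f integrates to
zero, and τI ≤ H + 2eτ² for every τ in [0, 1], where I is the weighted distance and H the relative
entropy. The choice τ = √H, or τ = 1 when H ≥ 1, gives the two entries of the maximum. -/
theorem integral_abs_sub_mul_le (hu : Integrable u μ) (hf : Integrable f μ)
    (hu0 : ∀ᵐ z ∂μ, 0 ≤ u z) (hf0 : ∀ z, 0 < f z) (hmass : ∫ z, u z ∂μ = ∫ z, f z ∂μ)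
    (hH : Integrable (fun z => u z * Real.log (u z / f z)) μ)
    (hb : AEStronglyMeasurable b μ) (hb0 : ∀ z, 0 ≤ b z)
    (hexp : ∫⁻ z, ENNReal.ofReal (Real.exp (2 * b z) * f z) ∂μ ≤ ENNReal.ofReal (Real.exp 1)) :
    Integrable (fun z => |u z - f z| * b z) μ ∧
    ∫ z, |u z - f z| * b z ∂μ ≤ (1 + 2 * Real.exp 1) *
      max (Real.sqrt (∫ z, u z * Real.log (u z / f z) ∂μ))
        (∫ z, u z * Real.log (u z / f z) ∂μ) := by
  set H := ∫ z, u z * Real.log (u z / f z) ∂μ with hHdef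
  have hH0 : 0 ≤ H := integral_mul_log_div_nonneg hu hf hu0 hf0 hmass hH
  have hem : AEStronglyMeasurable (fun z => Real.exp (2 * b z) * f z) μ :=
    (Real.continuous_exp.comp_aestronglyMeasurable (hb.const_mul 2)).mul hf.aestronglyMeasurable
  have he0 : ∀ᵐ z ∂μ, 0 ≤ Real.exp (2 * b z) * f z :=
    Filter.Eventually.of_forall fun z => mul_nonneg (Real.exp_pos _).le (hf0 z).le
  have hei : Integrable (fun z => Real.exp (2 * b z) * f z) μ :=
    integrable_of_lintegral_ofReal_le hem he0 ENNReal.ofReal_ne_top hexp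
  have hele : ∫ z, Real.exp (2 * b z) * f z ∂μ ≤ Real.exp 1 :=
    integral_le_of_lintegral_ofReal_le hem he0 (Real.exp_pos 1).le hexp
  have key : ∀ τ : ℝ, 0 ≤ τ → τ ≤ 1 → ∀ᵐ z ∂μ, τ * (|u z - f z| * b z) ≤
      (u z * Real.log (u z / f z) - u z + f z) + 2 * τ ^ 2 * (Real.exp (2 * b z) * f z) := by
    intro τ h0 h1
    filter_upwards [hu0] with z hz
    have h2 := abs_sub_mul_le hz (hf0 z) (mul_nonneg h0 (hb0 z))
    have h3 := mul_le_mul_of_nonneg_right (exp_sub_one_sub_le h0 h1 (hb0 z)) (hf0 z).le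
    calc τ * (|u z - f z| * b z) = |u z - f z| * (τ * b z) := by ring
      _ ≤ _ := by linarith
  have hri : ∀ τ : ℝ, Integrable (fun z => (u z * Real.log (u z / f z) - u z + f z) +
      2 * τ ^ 2 * (Real.exp (2 * b z) * f z)) μ := fun τ =>
    ((hH.sub hu).add hf).add (hei.const_mul _)
  have hli : Integrable (fun z => |u z - f z| * b z) μ := by
    refine Integrable.mono' (hri 1) ((hu.sub hf).abs.aestronglyMeasurable.mul hb) ?_
    filter_upwards [key 1 zero_le_one le_rfl] with z hz
    rw [Real.norm_of_nonneg (mul_nonneg (abs_nonneg _) (hb0 z))]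
    linarith
  refine ⟨hli, ?_⟩
  set I := ∫ z, |u z - f z| * b z ∂μ with hI
  have hτ : ∀ τ : ℝ, 0 ≤ τ → τ ≤ 1 → τ * I ≤ H + 2 * τ ^ 2 * Real.exp 1 := by
    intro τ h0 h1
    have h2 := integral_mono_ae (hli.const_mul τ) (hri τ) (key τ h0 h1)
    have h4 : ∫ z, ((u z * Real.log (u z / f z) - u z + f z) +
        2 * τ ^ 2 * (Real.exp (2 * b z) * f z)) ∂μ = ((H - ∫ z, u z ∂μ) + ∫ z, f z ∂μ) +
          2 * τ ^ 2 * ∫ z, Real.exp (2 * b z) * f z ∂μ := by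
      have h5 : Integrable (fun z => u z * Real.log (u z / f z) - u z + f z) μ :=
        (hH.sub hu).add hf
      rw [integral_add h5 (hei.const_mul _), integral_sub_add hH hu hf, integral_const_mul]
    rw [integral_const_mul, h4] at h2
    have h3 : 2 * τ ^ 2 * ∫ z, Real.exp (2 * b z) * f z ∂μ ≤ 2 * τ ^ 2 * Real.exp 1 :=
      mul_le_mul_of_nonneg_left hele (by positivity)
    linarith
  have hee := Real.exp_pos 1
  rcases le_total H 1 with h | h
  · have hs1 : Real.sqrt H ≤ 1 := Real.sqrt_le_one.2 h
    refine le_trans ?_ (mul_le_mul_of_nonneg_left (le_max_left _ _) (by positivity))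
    rcases hH0.eq_or_lt with h0 | h0
    -- For H = 0 the choice τ = √H says nothing. If I were positive, a positive τ small compared
    -- with I would contradict τI ≤ 2eτ².
    · have hle0 : I ≤ 0 := by
        by_contra! hpos
        have hE : 0 < I + 2 * Real.exp 1 := by positivity
        have h2 := hτ (I / (2 * (I + 2 * Real.exp 1))) (by positivity)
          ((div_le_one (by positivity)).2 (by linarith))
        rw [← h0] at h2
        set τ := I / (2 * (I + 2 * Real.exp 1)) with hτd
        have hτ0 : 0 < τ := by positivity
        have h3 : τ * I ≤ τ * (τ * (2 * Real.exp 1)) := by nlinarith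
        have h4 := le_of_mul_le_mul_left h3 hτ0
        have h5 : τ * (2 * (I + 2 * Real.exp 1)) = I := by rw [hτd]; field_simp
        nlinarith
      rw [← h0]; simpa using hle0
    · have h2 := hτ (Real.sqrt H) (Real.sqrt_nonneg _) hs1
      have h3 := Real.sq_sqrt hH0
      have hs0 := Real.sqrt_pos.2 h0
      refine le_of_mul_le_mul_left ?_ hs0
      calc Real.sqrt H * I ≤ H + 2 * Real.sqrt H ^ 2 * Real.exp 1 := h2
        _ = Real.sqrt H ^ 2 + 2 * Real.sqrt H ^ 2 * Real.exp 1 := by rw [h3]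
        _ = _ := by ring
  · refine le_trans ?_ (mul_le_mul_of_nonneg_left (le_max_right _ _) (by positivity))
    have h2 := hτ 1 zero_le_one le_rfl
    nlinarith

/-- A Jensen-type estimate: with p = 1/(1 + log Θ), the p-th power of a quantity of mean at most Θ
has mean at most about Θ^p ≤ e. Dividing the exponent by 1 + log Θ thus normalizes the exponential
moment, and this is the source of the logarithm in the final rate. -/
theorem lintegral_exp_div_le {a : Z → ℝ} {lam Θ : ℝ} (hΘ : 1 ≤ Θ) (hf0 : ∀ z, 0 < f z)
    (ha : AEMeasurable a μ) (hf : Integrable f μ) (hmass : ∫ z, f z ∂μ = 1)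
    (hexp : ∫⁻ z, ENNReal.ofReal (Real.exp (lam * a z) * f z) ∂μ ≤ ENNReal.ofReal Θ) :
    ∫⁻ z, ENNReal.ofReal (Real.exp (lam * a z / (1 + Real.log Θ)) * f z) ∂μ ≤
      ENNReal.ofReal (Real.exp 1) := by
  set ℓ := 1 + Real.log Θ with hℓ
  have hlog : 0 ≤ Real.log Θ := Real.log_nonneg hΘ
  have hℓ1 : 1 ≤ ℓ := by linarith
  have hℓ0 : 0 < ℓ := by linarith
  have hΘ0 : 0 < Θ := by linarith
  set p := 1 / ℓ with hp
  have hp0 : 0 ≤ p := by positivity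
  have hp1 : p ≤ 1 := (div_le_one hℓ0).2 hℓ1
  have hE := Real.exp_pos 1
  -- Convexity of exp after centring the exponent at log Θ; the two coefficients are chosen so that
  -- the bound integrates to e(1−p) + ep = e.
  have hpt : ∀ z, Real.exp (lam * a z / ℓ) * f z ≤
      Real.exp 1 * (1 - p) * f z + Real.exp 1 * p / Θ * (Real.exp (lam * a z) * f z) := by
    intro z
    have h1 : lam * a z / ℓ = Real.log Θ / ℓ + p * (lam * a z - Real.log Θ) := by
      rw [hp]; ring
    have h2 := exp_mul_sub_one_le (b := lam * a z - Real.log Θ) hp0 hp1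
    rw [Real.exp_sub, Real.exp_log hΘ0] at h2
    have h3 : Real.exp (Real.log Θ / ℓ) ≤ Real.exp 1 :=
      Real.exp_le_exp.2 ((div_le_one hℓ0).2 (by linarith))
    rw [h1, Real.exp_add]
    have h4 : Real.exp (p * (lam * a z - Real.log Θ)) ≤ 1 - p + p * (Real.exp (lam * a z) / Θ) := by
      linarith
    calc _ ≤ Real.exp 1 * (1 - p + p * (Real.exp (lam * a z) / Θ)) * f z :=
          mul_le_mul_of_nonneg_right (mul_le_mul h3 h4 (Real.exp_pos _).le hE.le) (hf0 z).le
      _ = _ := by ring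
  calc _ ≤ ∫⁻ z, (ENNReal.ofReal (Real.exp 1 * (1 - p)) * ENNReal.ofReal (f z) +
        ENNReal.ofReal (Real.exp 1 * p / Θ) * ENNReal.ofReal (Real.exp (lam * a z) * f z)) ∂μ := by
        refine lintegral_mono fun z => ?_
        refine (ENNReal.ofReal_le_ofReal (hpt z)).trans ?_
        refine ENNReal.ofReal_add_le.trans ?_
        rw [ENNReal.ofReal_mul (p := Real.exp 1 * (1 - p))
            (by have := sub_nonneg.2 hp1; positivity),
          ENNReal.ofReal_mul (p := Real.exp 1 * p / Θ) (by positivity)]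
    _ = ENNReal.ofReal (Real.exp 1 * (1 - p)) * ∫⁻ z, ENNReal.ofReal (f z) ∂μ +
        ENNReal.ofReal (Real.exp 1 * p / Θ) *
          ∫⁻ z, ENNReal.ofReal (Real.exp (lam * a z) * f z) ∂μ := by
        rw [lintegral_add_left' (hf.aestronglyMeasurable.aemeasurable.ennreal_ofReal.const_mul _),
          lintegral_const_mul'' _ hf.aestronglyMeasurable.aemeasurable.ennreal_ofReal,
          lintegral_const_mul'']
        exact ((Real.measurable_exp.comp_aemeasurable (ha.const_mul lam)).mul
          hf.aestronglyMeasurable.aemeasurable).ennreal_ofReal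
    _ ≤ ENNReal.ofReal (Real.exp 1 * (1 - p)) * 1 +
        ENNReal.ofReal (Real.exp 1 * p / Θ) * ENNReal.ofReal Θ := by
        gcongr
        rw [← ofReal_integral_eq_lintegral_ofReal hf
          (Filter.Eventually.of_forall fun z => (hf0 z).le), hmass, ENNReal.ofReal_one]
    _ = ENNReal.ofReal (Real.exp 1) := by
        rw [mul_one, ← ENNReal.ofReal_mul (by positivity), ← ENNReal.ofReal_add
          (by have := sub_nonneg.2 hp1; positivity) (by positivity)]
        congr 1
        field_simp
        ring

end Pinsker


/-! ### The phase measure and the force field -/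

section Force

variable {d : ℕ} {Ω : SpatialDomain} {K : E d → E d} {T : ℝ}

theorem measurableSet_cell : MeasurableSet (cell Ω d) := by
  cases Ω with
  | wholeSpace => exact MeasurableSet.univ
  | torus =>
    have : cell .torus d = ⋂ i : Fin d, {x : E d | x i ∈ Ico (0 : ℝ) 1} := by
      ext x; simp [cell]
    rw [this]
    refine MeasurableSet.iInter fun i => ?_
    exact measurableSet_Ico.preimage (by fun_prop)

instance instSFinitePhaseMeasure : SFinite (phaseMeasure Ω d) := by
  unfold phaseMeasure; infer_instance

theorem phaseMeasure_eq_restrict :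
    phaseMeasure Ω d = (volume : Measure (Phase d)).restrict (cell Ω d ×ˢ univ) := by
  rw [phaseMeasure, Measure.volume_eq_prod, ← Measure.prod_restrict, Measure.restrict_univ]

theorem phaseMeasure_le : phaseMeasure Ω d ≤ (volume : Measure (Phase d)) := by
  rw [phaseMeasure_eq_restrict]; exact Measure.restrict_le_self

theorem ae_mem_cell : ∀ᵐ z ∂(phaseMeasure Ω d), z.1 ∈ cell Ω d := by
  rw [phaseMeasure_eq_restrict]
  filter_upwards [ae_restrict_mem (measurableSet_cell.prod MeasurableSet.univ)] with z hz
  exact hz.1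

theorem ae_norm_le_supNorm (hK : MemLp K ∞ (volume : Measure (E d))) :
    ∀ᵐ x ∂(volume : Measure (E d)), ‖K x‖ ≤ supNorm K := by
  have h := ae_le_eLpNormEssSup (f := K) (μ := (volume : Measure (E d)))
  filter_upwards [h] with x hx
  rw [supNorm, eLpNorm_exponent_top, ← ENNReal.ofReal_le_iff_le_toReal, ofReal_norm]
  · exact hx
  · simpa using hK.2.ne

theorem supNorm_nonneg : 0 ≤ supNorm K := ENNReal.toReal_nonneg

/-- `K` is bounded only almost everywhere; this pulls the exceptional null set back to phase space
for every fixed x, so that bounds on the force hold at every point. -/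
theorem quasiMeasurePreserving_sub_fst (x : E d) :
    Measure.QuasiMeasurePreserving (fun z : Phase d => x - z.1) (phaseMeasure Ω d) volume := by
  have h1 : Measure.QuasiMeasurePreserving (Prod.fst : Phase d → E d) (phaseMeasure Ω d)
      ((volume : Measure (E d)).restrict (cell Ω d)) := Measure.quasiMeasurePreserving_fst
  have h2 : Measure.QuasiMeasurePreserving (Prod.fst : Phase d → E d) (phaseMeasure Ω d) volume :=
    h1.mono_right Measure.restrict_le_self.absolutelyContinuous
  exact (Measure.measurePreserving_sub_left volume x).quasiMeasurePreserving.comp h2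

theorem integrable_smul_kernel (hK : MemLp K ∞ (volume : Measure (E d))) {u : Phase d → ℝ}
    (hu : Integrable u (phaseMeasure Ω d)) (x : E d) :
    Integrable (fun z => u z • K (x - z.1)) (phaseMeasure Ω d) := by
  refine Integrable.mono' (hu.norm.mul_const (supNorm K)) (hu.aestronglyMeasurable.smul
    (hK.1.comp_quasiMeasurePreserving (quasiMeasurePreserving_sub_fst x))) ?_
  filter_upwards [(quasiMeasurePreserving_sub_fst x).ae (ae_norm_le_supNorm hK)] with z hz
  rw [norm_smul]
  exact mul_le_mul_of_nonneg_left hz (norm_nonneg _)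

/-- By Fubini the force is one integral over phase space, hence linear in the density and bounded by
its L¹ norm. -/
theorem force_eq_integral (hK : MemLp K ∞ (volume : Measure (E d))) {u : Phase d → ℝ}
    (hu : Integrable u (phaseMeasure Ω d)) (x : E d) :
    force Ω K u x = ∫ z, u z • K (x - z.1) ∂(phaseMeasure Ω d) := by
  have h := integrable_smul_kernel hK hu x
  rw [phaseMeasure] at h ⊢
  rw [integral_prod _ h, force]
  congr 1
  funext y
  simp only [density]
  rw [integral_smul_const]

theorem norm_force_le (hK : MemLp K ∞ (volume : Measure (E d))) {u : Phase d → ℝ}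
    (hu : Integrable u (phaseMeasure Ω d)) (x : E d) :
    ‖force Ω K u x‖ ≤ supNorm K * ∫ z, |u z| ∂(phaseMeasure Ω d) := by
  rw [force_eq_integral hK hu, ← integral_const_mul]
  refine norm_integral_le_of_norm_le (hu.abs.const_mul _) ?_
  filter_upwards [(quasiMeasurePreserving_sub_fst x).ae (ae_norm_le_supNorm hK)] with z hz
  rw [norm_smul, mul_comm, Real.norm_eq_abs]
  exact mul_le_mul_of_nonneg_right hz (abs_nonneg _)

theorem force_sub (hK : MemLp K ∞ (volume : Measure (E d))) {u w : Phase d → ℝ}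
    (hu : Integrable u (phaseMeasure Ω d)) (hw : Integrable w (phaseMeasure Ω d)) (x : E d) :
    force Ω K u x - force Ω K w x = force Ω K (fun z => u z - w z) x := by
  rw [force_eq_integral hK hu, force_eq_integral hK hw,
    force_eq_integral hK (u := fun z => u z - w z) (hu.sub hw),
    ← integral_sub (integrable_smul_kernel hK hu x) (integrable_smul_kernel hK hw x)]
  simp only [sub_smul]

theorem norm_force_sub_le (hK : MemLp K ∞ (volume : Measure (E d))) {u w : Phase d → ℝ}
    (hu : Integrable u (phaseMeasure Ω d)) (hw : Integrable w (phaseMeasure Ω d)) (x : E d) :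
    ‖force Ω K u x - force Ω K w x‖ ≤
      supNorm K * ∫ z, |u z - w z| ∂(phaseMeasure Ω d) := by
  rw [force_sub hK hu hw]
  exact norm_force_le hK (hu.sub hw) x

theorem IsProbDensity.integral_abs {u : Phase d → ℝ} (hu : IsProbDensity Ω u) :
    ∫ z, |u z| ∂(phaseMeasure Ω d) = 1 := by
  rw [← hu.mass]
  refine integral_congr_ae ?_
  filter_upwards [hu.nonneg] with z hz using abs_of_nonneg hz

theorem IsProbDensity.norm_force_le {u : Phase d → ℝ} (hu : IsProbDensity Ω u)
    (hK : MemLp K ∞ (volume : Measure (E d))) (x : E d) : ‖force Ω K u x‖ ≤ supNorm K := by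
  have := Vlasov.norm_force_le hK hu.integrable x
  rwa [hu.integral_abs, mul_one] at this

/-- The measure `dt dx dv` on `[0, T] × Ω × ℝ^d`. -/
noncomputable abbrev timePhaseMeasure (Ω : SpatialDomain) (d : ℕ) (T : ℝ) :
    Measure (ℝ × Phase d) :=
  ((volume : Measure ℝ).restrict (Icc 0 T)).prod (phaseMeasure Ω d)

theorem ae_ae_eq_mk {F : Type*} [TopologicalSpace F] {u : ℝ → Phase d → F}
    (hu : AEStronglyMeasurable (fun p : ℝ × Phase d => u p.1 p.2) (timePhaseMeasure Ω d T)) :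
    ∀ᵐ s ∂((volume : Measure ℝ).restrict (Icc 0 T)),
      u s =ᵐ[phaseMeasure Ω d] fun z => hu.mk _ (s, z) :=
  Measure.ae_ae_of_ae_prod hu.ae_eq_mk

/-- With measurable representatives of `u` and `K` the force becomes a jointly measurable parameter
integral. At almost every time it agrees with the original force at every position. -/
theorem aestronglyMeasurable_force (hK : MemLp K ∞ (volume : Measure (E d)))
    {u : ℝ → Phase d → ℝ}
    (hu : AEStronglyMeasurable (fun p : ℝ × Phase d => u p.1 p.2) (timePhaseMeasure Ω d T))
    (hui : ∀ t ∈ Icc 0 T, Integrable (u t) (phaseMeasure Ω d)) :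
    AEStronglyMeasurable (fun p : ℝ × Phase d => force Ω K (u p.1) p.2.1)
      (timePhaseMeasure Ω d T) := by
  set u' := hu.mk _ with hu'
  set K' := hK.1.mk _ with hK'
  have hm : StronglyMeasurable (fun q : (ℝ × Phase d) × Phase d =>
      u' (q.1.1, q.2) • K' (q.1.2.1 - q.2.1)) := by
    have h1 : StronglyMeasurable (fun q : (ℝ × Phase d) × Phase d => u' (q.1.1, q.2)) :=
      hu.stronglyMeasurable_mk.comp_measurable (by fun_prop)
    have h2 : StronglyMeasurable (fun q : (ℝ × Phase d) × Phase d => K' (q.1.2.1 - q.2.1)) :=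
      hK.1.stronglyMeasurable_mk.comp_measurable (by fun_prop)
    exact h1.smul h2
  have hm2 : StronglyMeasurable (fun p : ℝ × Phase d =>
      ∫ z, u' (p.1, z) • K' (p.2.1 - z.1) ∂(phaseMeasure Ω d)) :=
    StronglyMeasurable.integral_prod_right (f := fun (p : ℝ × Phase d) (z : Phase d) =>
      u' (p.1, z) • K' (p.2.1 - z.1)) hm
  refine ⟨_, hm2, ?_⟩
  refine Measure.quasiMeasurePreserving_fst.ae (p := fun s => ∀ z : Phase d,
    force Ω K (u s) z.1 = ∫ z', u' (s, z') • K' (z.1 - z'.1) ∂(phaseMeasure Ω d)) ?_ |>.mono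
    fun p hp => hp p.2
  filter_upwards [ae_ae_eq_mk hu, ae_restrict_mem measurableSet_Icc] with s hs hsT z
  rw [force_eq_integral hK (hui s hsT)]
  refine integral_congr_ae ?_
  filter_upwards [hs, (quasiMeasurePreserving_sub_fst z.1).ae hK.1.ae_eq_mk] with z' h1 h2
  rw [h1, h2]

end Force


/-! ### Directional derivatives and the Laplacian in the velocity -/

section Calculus

variable {d : ℕ} {Ω : SpatialDomain}

/-- The derivative of `φ` in the fixed direction `e`. -/
noncomputable def dirD (e : ℝ × Phase d) (φ : ℝ × Phase d → ℝ) : ℝ × Phase d → ℝ :=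
  fun p => fderiv ℝ φ p e

/-- The `i`-th coordinate direction in velocity. -/
noncomputable def vUnit (i : Fin d) : ℝ × Phase d := (0, (0, EuclideanSpace.single i (1 : ℝ)))

/-- The `i`-th coordinate direction in position. -/
noncomputable def xUnit (i : Fin d) : ℝ × Phase d := (0, (EuclideanSpace.single i (1 : ℝ), 0))

theorem contDiff_dirD {φ : ℝ × Phase d → ℝ} (hφ : ContDiff ℝ ∞ φ) (e : ℝ × Phase d) :
    ContDiff ℝ ∞ (dirD e φ) :=
  (hφ.fderiv_right (by simp)).clm_apply contDiff_const

theorem _root_.ContDiff.differentiable_infty {F G : Type*} [NormedAddCommGroup F] [NormedSpace ℝ F]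
    [NormedAddCommGroup G] [NormedSpace ℝ G] {φ : F → G} (hφ : ContDiff ℝ ∞ φ) :
    Differentiable ℝ φ := hφ.differentiable (by simp)

theorem fderiv_slice {φ : ℝ × Phase d → ℝ} (hφ : Differentiable ℝ φ) (t : ℝ) (x v k : E d) :
    fderiv ℝ (fun w : E d => φ (t, (x, w))) v k = fderiv ℝ φ (t, (x, v)) (0, (0, k)) := by
  have h1 : HasFDerivAt (fun w : E d => ((t, (x, w)) : ℝ × Phase d))
      ((0 : E d →L[ℝ] ℝ).prod ((0 : E d →L[ℝ] E d).prod (ContinuousLinearMap.id ℝ (E d)))) v :=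
    (hasFDerivAt_const t v).prodMk ((hasFDerivAt_const x v).prodMk (hasFDerivAt_id v))
  have h2 := (hφ (t, (x, v))).hasFDerivAt.comp v h1
  have h3 : fderiv ℝ (fun w : E d => φ (t, (x, w))) v = _ := h2.fderiv
  rw [h3]
  rfl

theorem fderiv_phase_slice {φ : ℝ × Phase d → ℝ} (hφ : Differentiable ℝ φ) (t : ℝ)
    (z e : Phase d) :
    fderiv ℝ (fun w : Phase d => φ (t, w)) z e = fderiv ℝ φ (t, z) (0, e) := by
  have h1 : HasFDerivAt (fun w : Phase d => ((t, w) : ℝ × Phase d))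
      ((0 : Phase d →L[ℝ] ℝ).prod (ContinuousLinearMap.id ℝ (Phase d))) z :=
    (hasFDerivAt_const t z).prodMk (hasFDerivAt_id z)
  have h2 := (hφ (t, z)).hasFDerivAt.comp z h1
  have h3 : fderiv ℝ (fun w : Phase d => φ (t, w)) z = _ := h2.fderiv
  rw [h3]
  rfl

theorem laplacianV_eq_sum {φ : ℝ × Phase d → ℝ} (hφ : ContDiff ℝ ∞ φ) (t : ℝ) (z : Phase d) :
    laplacianV φ t z = ∑ i, dirD (vUnit i) (dirD (vUnit i) φ) (t, z) := by
  obtain ⟨x, v⟩ := z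
  rw [laplacianV, InnerProductSpace.laplacian_eq_iteratedFDeriv_orthonormalBasis _
    (EuclideanSpace.basisFun (Fin d) ℝ)]
  refine Finset.sum_congr rfl fun i _ => ?_
  have hg : ContDiff ℝ ∞ (fun w : E d => φ (t, (x, w))) :=
    hφ.comp (contDiff_const.prodMk (contDiff_const.prodMk contDiff_id))
  have hg' : DifferentiableAt ℝ (fderiv ℝ (fun w : E d => φ (t, (x, w)))) v :=
    ((hg.fderiv_right (m := ∞) (by simp)).differentiable_infty) v
  rw [iteratedFDeriv_two_apply]
  simp only [Matrix.cons_val_zero, Matrix.cons_val_one, EuclideanSpace.basisFun_apply]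
  set e := EuclideanSpace.single i (1 : ℝ) with he
  have h1 : fderiv ℝ (fun w => fderiv ℝ (fun w : E d => φ (t, (x, w))) w e) v e =
      fderiv ℝ (fderiv ℝ (fun w : E d => φ (t, (x, w)))) v e e := by
    rw [fderiv_clm_apply hg' (differentiableAt_const e)]
    simp
  rw [← h1]
  have h2 : (fun w => fderiv ℝ (fun w : E d => φ (t, (x, w))) w e) =
      fun w => dirD (vUnit i) φ (t, (x, w)) := by
    funext w
    rw [fderiv_slice hφ.differentiable_infty]
    rfl
  rw [h2, fderiv_slice (contDiff_dirD hφ _).differentiable_infty]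
  rfl

/-- Functions of `(t, x, v)` that descend to `ℝ × Ω × ℝ^d`. -/
def PeriodicIn (Ω : SpatialDomain) (φ : ℝ × Phase d → ℝ) : Prop :=
  Ω = .torus → ∀ (i : Fin d) (p : ℝ × Phase d), φ (p + xUnit i) = φ p

theorem PeriodicIn.isPeriodic {φ : ℝ × Phase d → ℝ} (h : PeriodicIn Ω φ) (t : ℝ) (v : E d) :
    IsPeriodic Ω (fun x => φ (t, (x, v))) := by
  intro hΩ i x
  have := h hΩ i (t, (x, v))
  simpa [xUnit] using this

theorem PeriodicIn.dirD {φ : ℝ × Phase d → ℝ} (h : PeriodicIn Ω φ) (e : ℝ × Phase d) :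
    PeriodicIn Ω (dirD e φ) := by
  intro hΩ i p
  have h1 : (fun q => φ (q + xUnit i)) = φ := funext (h hΩ i)
  simp only [Vlasov.dirD]
  conv_rhs => rw [← h1]
  rw [fderiv_comp_add_right]

/-- Test functions with an explicit support bound which is stable under differentiation. -/
structure IsTest (Ω : SpatialDomain) (φ : ℝ × Phase d → ℝ) : Prop where
  smooth : ContDiff ℝ ∞ φ
  periodic : PeriodicIn Ω φ
  support : ∃ R : ℝ, ∀ (t : ℝ) (x v : E d), (R < ‖v‖ ∨ (Ω = .wholeSpace ∧ R < ‖x‖)) →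
    φ (t, (x, v)) = 0

theorem norm_le_sqrt_of_mem_cell {x : E d} (hx : x ∈ cell .torus d) : ‖x‖ ≤ Real.sqrt d := by
  rw [EuclideanSpace.norm_eq]
  refine Real.sqrt_le_sqrt ?_
  calc ∑ i, ‖x i‖ ^ 2 ≤ ∑ _i : Fin d, (1 : ℝ) := by
        refine Finset.sum_le_sum fun i _ => ?_
        have h := hx i
        rw [Real.norm_of_nonneg h.1]
        nlinarith [h.1, h.2]
    _ = d := by simp

theorem IsTest.isTestFunction {φ : ℝ × Phase d → ℝ} (h : IsTest Ω φ) : IsTestFunction Ω φ := by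
  refine ⟨h.smooth, h.periodic.isPeriodic, ?_⟩
  obtain ⟨R, hR⟩ := h.support
  refine ⟨max R (Real.sqrt d), fun t x v hx hxv => hR t x v ?_⟩
  rcases hxv with hx' | hv
  · cases Ω with
    | wholeSpace => exact Or.inr ⟨rfl, (le_max_left _ _).trans_lt hx'⟩
    | torus =>
      exact absurd (norm_le_sqrt_of_mem_cell hx) (not_le.2 ((le_max_right _ _).trans_lt hx'))
  · exact Or.inl ((le_max_left _ _).trans_lt hv)

theorem IsTest.dirD {φ : ℝ × Phase d → ℝ} (h : IsTest Ω φ) (e : ℝ × Phase d) :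
    IsTest Ω (dirD e φ) := by
  refine ⟨contDiff_dirD h.smooth e, h.periodic.dirD e, ?_⟩
  obtain ⟨R, hR⟩ := h.support
  refine ⟨R, fun t x v hxv => ?_⟩
  have : φ =ᶠ[nhds (t, (x, v))] fun _ => 0 := by
    rcases hxv with hv | ⟨hΩ, hx⟩
    · have ho : IsOpen {p : ℝ × Phase d | R < ‖p.2.2‖} :=
        isOpen_lt continuous_const (by fun_prop)
      filter_upwards [ho.mem_nhds hv] with p hp using hR p.1 p.2.1 p.2.2 (Or.inl hp)
    · have ho : IsOpen {p : ℝ × Phase d | R < ‖p.2.1‖} :=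
        isOpen_lt continuous_const (by fun_prop)
      filter_upwards [ho.mem_nhds hx] with p hp using hR p.1 p.2.1 p.2.2 (Or.inr ⟨hΩ, hp⟩)
  rw [Vlasov.dirD, this.fderiv_eq]
  simp

theorem IsTest.mul_right {φ g : ℝ × Phase d → ℝ} (h : IsTest Ω φ) (hg : ContDiff ℝ ∞ g)
    (hgp : PeriodicIn Ω g) : IsTest Ω (fun p => φ p * g p) := by
  refine ⟨h.smooth.mul hg, fun hΩ i p => ?_, ?_⟩
  · simp only [h.periodic hΩ i p, hgp hΩ i p]
  · obtain ⟨R, hR⟩ := h.support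
    exact ⟨R, fun t x v hxv => by simp only [hR t x v hxv, zero_mul]⟩

/-- The part of the spatial domain where a test function does not vanish is relatively compact. -/
theorem exists_compact_of_support {F : Type*} [Zero F] {φ : ℝ × Phase d → F}
    (h : ∃ R : ℝ, ∀ (t : ℝ) (x v : E d), (R < ‖v‖ ∨ (Ω = .wholeSpace ∧ R < ‖x‖)) →
      φ (t, (x, v)) = 0) :
    ∃ R : ℝ, 0 ≤ R ∧ ∀ (t : ℝ) (z : Phase d), z.1 ∈ cell Ω d → (R < ‖z.1‖ ∨ R < ‖z.2‖) →
      φ (t, z) = 0 := by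
  obtain ⟨R, hR⟩ := h
  refine ⟨max (max R (Real.sqrt d)) 0, le_max_right _ _, fun t z hz hxv => hR t z.1 z.2 ?_⟩
  have hle : R ≤ max (max R (Real.sqrt d)) 0 := (le_max_left _ _).trans (le_max_left _ _)
  have hle2 : Real.sqrt d ≤ max (max R (Real.sqrt d)) 0 :=
    (le_max_right _ _).trans (le_max_left _ _)
  rcases hxv with hx' | hv
  · cases Ω with
    | wholeSpace => exact Or.inr ⟨rfl, hle.trans_lt hx'⟩
    | torus => exact absurd (norm_le_sqrt_of_mem_cell hz) (not_le.2 (hle2.trans_lt hx'))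
  · exact Or.inl (hle.trans_lt hv)

theorem exists_bound_of_support {F : Type*} [NormedAddCommGroup F] {φ : ℝ × Phase d → F}
    (hc : Continuous φ)
    (h : ∃ R : ℝ, ∀ (t : ℝ) (x v : E d), (R < ‖v‖ ∨ (Ω = .wholeSpace ∧ R < ‖x‖)) →
      φ (t, (x, v)) = 0) (T : ℝ) :
    ∃ C : ℝ, 0 ≤ C ∧ ∀ t ∈ Icc 0 T, ∀ z : Phase d, z.1 ∈ cell Ω d → ‖φ (t, z)‖ ≤ C := by
  obtain ⟨R, hR0, hR⟩ := exists_compact_of_support h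
  have hcomp : IsCompact (Icc 0 T ×ˢ
      (Metric.closedBall (0 : E d) R ×ˢ Metric.closedBall (0 : E d) R)) :=
    isCompact_Icc.prod ((isCompact_closedBall _ _).prod (isCompact_closedBall _ _))
  obtain ⟨C, hC⟩ := hcomp.exists_bound_of_continuousOn hc.continuousOn
  refine ⟨max C 0, le_max_right _ _, fun t ht z hz => ?_⟩
  by_cases h : R < ‖z.1‖ ∨ R < ‖z.2‖
  · rw [hR t z hz h, norm_zero]; exact le_max_right _ _
  · push Not at h
    refine (hC (t, z) ⟨ht, ?_, ?_⟩).trans (le_max_left _ _)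
    · simpa using h.1
    · simpa using h.2

theorem IsTest.exists_bound {φ : ℝ × Phase d → ℝ} (h : IsTest Ω φ) (T : ℝ) :
    ∃ C : ℝ, 0 ≤ C ∧ ∀ t ∈ Icc 0 T, ∀ z : Phase d, z.1 ∈ cell Ω d → ‖φ (t, z)‖ ≤ C :=
  exists_bound_of_support h.smooth.continuous h.support T

end Calculus

/-! ### Periodization -/

section Periodization

variable {d : ℕ} {Ω : SpatialDomain}

/-- The lattice point `n ∈ ℤ^d` as an element of `ℝ^d`. -/
noncomputable def lattice (n : Fin d → ℤ) : E d := WithLp.toLp 2 (fun i => (n i : ℝ))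

@[simp] theorem lattice_apply (n : Fin d → ℤ) (i : Fin d) : lattice n i = n i := rfl

/-- The representative of a point of `Ω × ℝ^d` with position in the fundamental cell. -/
noncomputable def fold (Ω : SpatialDomain) (z : Phase d) : Phase d :=
  match Ω with
  | .wholeSpace => z
  | .torus => (WithLp.toLp 2 (fun i => Int.fract (z.1 i)), z.2)

theorem fold_of_mem_cell {z : Phase d} (hz : z.1 ∈ cell Ω d) : fold Ω z = z := by
  cases Ω with
  | wholeSpace => rfl
  | torus =>
    refine Prod.ext ?_ rfl
    ext i
    exact Int.fract_eq_self.2 (hz i)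

theorem fold_snd (z : Phase d) : (fold Ω z).2 = z.2 := by cases Ω <;> rfl

theorem fold_add_lattice (z : Phase d) (n : Fin d → ℤ) :
    fold .torus (z + (lattice n, 0)) = fold .torus z := by
  refine Prod.ext ?_ (by simp [fold])
  ext i
  simp [fold]

theorem measurable_fold : Measurable (fold Ω : Phase d → Phase d) := by
  cases Ω with
  | wholeSpace => exact measurable_id
  | torus =>
    refine Measurable.prodMk ?_ measurable_snd
    refine (WithLp.measurable_toLp 2 _).comp (measurable_pi_iff.2 fun i => ?_)
    exact measurable_fract.comp (by fun_prop)

/-- The translate of the fundamental cell of the torus by `n ∈ ℤ^d`, times `ℝ^d`. -/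
def cellTranslate (d : ℕ) (n : Fin d → ℤ) : Set (Phase d) := {z | ∀ i, ⌊z.1 i⌋ = n i}

instance instIsAddHaarPhase : (volume : Measure (Phase d)).IsAddHaarMeasure :=
  Measure.prod.instIsAddHaarMeasure _ _

theorem measurableSet_cellTranslate (n : Fin d → ℤ) : MeasurableSet (cellTranslate d n) := by
  have : cellTranslate d n = ⋂ i : Fin d, {z : Phase d | ⌊z.1 i⌋ = n i} := by
    ext z; simp [cellTranslate]
  rw [this]
  refine MeasurableSet.iInter fun i => ?_
  exact (Int.measurable_floor.comp (f := fun z : Phase d => z.1 i) (by fun_prop))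
    (measurableSet_singleton (n i))

theorem iUnion_cellTranslate : ⋃ n, cellTranslate d n = univ :=
  eq_univ_of_forall fun z => mem_iUnion.2 ⟨fun i => ⌊z.1 i⌋, fun _ => rfl⟩

theorem pairwise_disjoint_cellTranslate : Pairwise (Function.onFun Disjoint (cellTranslate d)) := by
  intro n m hnm
  refine Set.disjoint_left.2 fun z h1 h2 => hnm (funext fun i => ?_)
  rw [← h1 i, h2 i]

theorem add_lattice_mem_cellTranslate {z : Phase d} {n : Fin d → ℤ} :
    z + (lattice n, 0) ∈ cellTranslate d n ↔ z ∈ cell .torus d ×ˢ (univ : Set (E d)) := by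
  simp only [cellTranslate, mem_ofPred_eq, Prod.fst_add, PiLp.add_apply, lattice_apply,
    Int.floor_add_intCast, add_eq_right, mem_prod, mem_univ, and_true, cell, mem_Ico,
    Int.floor_eq_zero_iff]

/-- The preimage of a null set is a countable union of lattice translates of its part inside the
cell. -/
theorem quasiMeasurePreserving_fold :
    Measure.QuasiMeasurePreserving (fold Ω : Phase d → Phase d) volume (phaseMeasure Ω d) := by
  refine ⟨measurable_fold, Measure.AbsolutelyContinuous.mk fun s hs h0 => ?_⟩
  rw [Measure.map_apply measurable_fold hs]
  cases Ω with
  | wholeSpace =>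
    rw [phaseMeasure_eq_restrict] at h0
    have h1 : fold .wholeSpace ⁻¹' s = s := rfl
    rw [h1]
    simpa [cell] using h0
  | torus =>
    rw [phaseMeasure_eq_restrict, Measure.restrict_apply hs] at h0
    rw [← inter_univ (fold .torus ⁻¹' s), ← iUnion_cellTranslate, inter_iUnion,
      measure_iUnion_null_iff]
    intro n
    rw [← measure_preimage_add_right volume ((lattice n, 0) : Phase d)]
    refine measure_mono_null (fun z hz => ?_) h0
    obtain ⟨h1, h2⟩ := hz
    have h3 := add_lattice_mem_cellTranslate.1 h2
    rw [mem_preimage, fold_add_lattice, fold_of_mem_cell h3.1] at h1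
    exact ⟨h1, h3⟩

/-- The sum of the `ℤ^d`-translates in position (the function itself if `Ω = ℝ^d`). -/
noncomputable def periodize (Ω : SpatialDomain) (ψ : ℝ × Phase d → ℝ) : ℝ × Phase d → ℝ :=
  match Ω with
  | .wholeSpace => ψ
  | .torus => fun p => ∑' n : Fin d → ℤ, ψ (p + (0, (lattice n, 0)))

/-- A ball of lattice points. -/
noncomputable def latticeBox (d : ℕ) (M : ℝ) : Finset (Fin d → ℤ) :=
  Fintype.piFinset fun _ => Finset.Icc (-⌈M⌉) ⌈M⌉

/-- Smooth functions supported in `‖x‖ ≤ R`, `‖v‖ ≤ R`. -/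
structure IsBumpLike (R : ℝ) (ψ : ℝ × Phase d → ℝ) : Prop where
  smooth : ContDiff ℝ ∞ ψ
  support : ∀ (t : ℝ) (x v : E d), (R < ‖x‖ ∨ R < ‖v‖) → ψ (t, (x, v)) = 0

theorem IsBumpLike.dirD {R : ℝ} {ψ : ℝ × Phase d → ℝ} (h : IsBumpLike R ψ) (e : ℝ × Phase d) :
    IsBumpLike R (dirD e ψ) := by
  refine ⟨contDiff_dirD h.smooth e, fun t x v hxv => ?_⟩
  have ho : IsOpen {p : ℝ × Phase d | R < ‖p.2.1‖ ∨ R < ‖p.2.2‖} :=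
    by
    have h1 : IsOpen {p : ℝ × Phase d | R < ‖p.2.1‖} := isOpen_lt continuous_const (by fun_prop)
    have h2 : IsOpen {p : ℝ × Phase d | R < ‖p.2.2‖} := isOpen_lt continuous_const (by fun_prop)
    exact h1.union h2
  have : ψ =ᶠ[nhds (t, (x, v))] fun _ => 0 := by
    filter_upwards [ho.mem_nhds hxv] with p hp using h.support p.1 p.2.1 p.2.2 hp
  rw [Vlasov.dirD, this.fderiv_eq]
  simp

/-- Local finiteness of the periodization: over a bounded set of positions only the translates in a
fixed finite box contribute, so the sum may be differentiated term by term. -/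
theorem IsBumpLike.eq_zero_of_notMem_latticeBox {R M : ℝ} {ψ : ℝ × Phase d → ℝ}
    (h : IsBumpLike R ψ) {p : ℝ × Phase d} (hp : ‖p.2.1‖ ≤ M) {n : Fin d → ℤ}
    (hn : n ∉ latticeBox d (R + M)) : ψ (p + (0, (lattice n, 0))) = 0 := by
  refine h.support _ _ _ (Or.inl ?_)
  by_contra! hle
  refine hn (Fintype.mem_piFinset.2 fun i => ?_)
  have h1 : ‖lattice n‖ ≤ R + M := by
    have : lattice n = (p.2.1 + lattice n) - p.2.1 := by abel
    rw [this]
    exact (norm_sub_le _ _).trans (add_le_add hle hp)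
  have h2 : |(n i : ℝ)| ≤ R + M := by
    have := PiLp.norm_apply_le (lattice n) i
    rw [lattice_apply, Real.norm_eq_abs] at this
    exact this.trans h1
  have h3 := abs_le.1 h2
  have h4 := Int.le_ceil (R + M)
  rw [Finset.mem_Icc]
  constructor
  · have : ((-⌈R + M⌉ : ℤ) : ℝ) ≤ n i := by push_cast; linarith
    exact_mod_cast this
  · have : (n i : ℝ) ≤ (⌈R + M⌉ : ℤ) := by linarith
    exact_mod_cast this

theorem IsBumpLike.periodize_eq_sum {R M : ℝ} {ψ : ℝ × Phase d → ℝ}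
    (h : IsBumpLike R ψ) {p : ℝ × Phase d} (hp : ‖p.2.1‖ ≤ M) :
    periodize .torus ψ p = ∑ n ∈ latticeBox d (R + M), ψ (p + (0, (lattice n, 0))) :=
  tsum_eq_sum fun _ hn => h.eq_zero_of_notMem_latticeBox hp hn

theorem IsBumpLike.periodize_eventuallyEq {R : ℝ} {ψ : ℝ × Phase d → ℝ}
    (h : IsBumpLike R ψ) (p : ℝ × Phase d) :
    periodize .torus ψ =ᶠ[nhds p] fun q => ∑ n ∈ latticeBox d (R + (‖p.2.1‖ + 1)),
      ψ (q + (0, (lattice n, 0))) := by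
  have ho : IsOpen {q : ℝ × Phase d | ‖q.2.1‖ < ‖p.2.1‖ + 1} :=
    isOpen_lt (by fun_prop) continuous_const
  have hp : p ∈ {q : ℝ × Phase d | ‖q.2.1‖ < ‖p.2.1‖ + 1} := by simp
  filter_upwards [ho.mem_nhds hp] with q hq using h.periodize_eq_sum hq.le

theorem IsBumpLike.dirD_periodize {R : ℝ} {ψ : ℝ × Phase d → ℝ} (h : IsBumpLike R ψ)
    (e : ℝ × Phase d) : Vlasov.dirD e (periodize Ω ψ) = periodize Ω (Vlasov.dirD e ψ) := by
  cases Ω with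
  | wholeSpace => rfl
  | torus =>
    funext p
    rw [(h.dirD e).periodize_eq_sum (M := ‖p.2.1‖ + 1) (by linarith), Vlasov.dirD,
      (h.periodize_eventuallyEq p).fderiv_eq, fderiv_fun_sum]
    · rw [_root_.sum_apply]
      refine Finset.sum_congr rfl fun n _ => ?_
      rw [fderiv_comp_add_right]
      rfl
    · intro n _
      exact (h.smooth.comp (contDiff_id.add contDiff_const)).differentiable_infty p

theorem IsBumpLike.isTest_periodize {R : ℝ} {ψ : ℝ × Phase d → ℝ} (h : IsBumpLike R ψ) :
    IsTest Ω (periodize Ω ψ) := by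
  cases Ω with
  | wholeSpace =>
    exact ⟨h.smooth, fun h => by simp at h,
      R, fun t x v hxv => h.support t x v (hxv.elim Or.inr fun h => Or.inl h.2)⟩
  | torus =>
    refine ⟨contDiff_iff_contDiffAt.2 fun p => ?_, fun _ i p => ?_, R, fun t x v hxv => ?_⟩
    · refine ContDiffAt.congr_of_eventuallyEq ?_ (h.periodize_eventuallyEq p)
      refine ContDiff.contDiffAt ?_
      exact ContDiff.sum fun n _ => h.smooth.comp (contDiff_id.add contDiff_const)
    · simp only [periodize]
      symm
      rw [← (Equiv.addRight (Pi.single i (1 : ℤ))).tsum_eq]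
      refine tsum_congr fun n => ?_
      congr 1
      rw [add_assoc]
      congr 1
      refine Prod.ext (by simp [xUnit]) (Prod.ext ?_ (by simp [xUnit]))
      ext j
      by_cases hj : j = i
      · subst hj; simp [xUnit, add_comm]
      · simp [xUnit, hj]
    · refine (tsum_congr fun n => ?_).trans tsum_zero
      refine h.support _ _ _ (Or.inr ?_)
      simpa using hxv

/-- Unfolding: integrating a function of the torus against a periodization over the cell. -/
theorem IsBumpLike.integral_fold_mul {R : ℝ} {ψ : ℝ × Phase d → ℝ} (hψ : IsBumpLike R ψ)
    (h : Phase d → ℝ) (t : ℝ) (hint : Integrable (fun z => h (fold Ω z) * ψ (t, z)) volume) :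
    ∫ z, h (fold Ω z) * ψ (t, z) = ∫ z, h z * periodize Ω ψ (t, z) ∂(phaseMeasure Ω d) := by
  cases Ω with
  | wholeSpace => rw [phaseMeasure_eq_restrict]; simp [cell, fold, periodize]
  | torus =>
    -- Split ℝ^d into translates of the cell and shift each piece back; `h ∘ fold` does not change,
    -- while `ψ` becomes its translate.
    have hS := hasSum_integral_iUnion (μ := (volume : Measure (Phase d)))
      (f := fun z => h (fold .torus z) * ψ (t, z)) (s := cellTranslate d)
      measurableSet_cellTranslate pairwise_disjoint_cellTranslate hint.integrableOn
    rw [iUnion_cellTranslate, Measure.restrict_univ] at hS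
    have hpre : ∀ n : Fin d → ℤ, (fun z : Phase d => z + (lattice n, 0)) ⁻¹' cellTranslate d n =
        cell .torus d ×ˢ (univ : Set (E d)) := fun n =>
      Set.ext fun z => add_lattice_mem_cellTranslate
    have hmp : ∀ n : Fin d → ℤ, MeasurePreserving (fun z : Phase d => z + (lattice n, 0))
        volume volume := fun n => measurePreserving_add_right volume _
    have hemb : ∀ n : Fin d → ℤ, MeasurableEmbedding (fun z : Phase d => z + (lattice n, 0)) :=
      fun n => measurableEmbedding_addRight _
    have hcongr : ∀ n : Fin d → ℤ, (fun z : Phase d => h (fold .torus (z + (lattice n, 0))) *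
        ψ (t, z + (lattice n, 0))) =ᵐ[phaseMeasure .torus d]
        fun z => h z * ψ ((t, z) + (0, (lattice n, 0))) := by
      intro n
      filter_upwards [ae_mem_cell] with z hz
      rw [fold_add_lattice, fold_of_mem_cell hz]
      simp
    have hterm : ∀ n : Fin d → ℤ, ∫ z in cellTranslate d n, h (fold .torus z) * ψ (t, z) =
        ∫ z, h z * ψ ((t, z) + (0, (lattice n, 0))) ∂(phaseMeasure .torus d) := by
      intro n
      rw [← (hmp n).setIntegral_preimage_emb (hemb n), hpre, ← phaseMeasure_eq_restrict]
      exact integral_congr_ae (hcongr n)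
    have hti : ∀ n : Fin d → ℤ,
        Integrable (fun z => h z * ψ ((t, z) + (0, (lattice n, 0)))) (phaseMeasure .torus d) := by
      intro n
      refine Integrable.congr ?_ (hcongr n)
      have := ((hmp n).integrableOn_comp_preimage (hemb n) (s := cellTranslate d n)
        (f := fun z => h (fold .torus z) * ψ (t, z))).2 hint.integrableOn
      rw [hpre, IntegrableOn, ← phaseMeasure_eq_restrict] at this
      exact this
    rw [← hS.tsum_eq]
    simp only [hterm]
    -- Points of the cell have norm at most √d, so this box holds all nonzero terms and sum and
    -- integral may be exchanged.
    rw [tsum_eq_sum (s := latticeBox d (R + Real.sqrt d)), ← integral_finsetSum _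
      fun n _ => hti n]
    · refine integral_congr_ae ?_
      filter_upwards [ae_mem_cell] with z hz
      rw [hψ.periodize_eq_sum (p := (t, z)) (norm_le_sqrt_of_mem_cell hz), Finset.mul_sum]
    · intro n hn
      refine integral_eq_zero_of_ae ?_
      filter_upwards [ae_mem_cell] with z hz
      rw [hψ.eq_zero_of_notMem_latticeBox (p := (t, z)) (norm_le_sqrt_of_mem_cell hz) hn, mul_zero, Pi.zero_apply]

end Periodization


/-! ### The equation on the whole space -/

section Unfold

variable {d : ℕ} {Ω : SpatialDomain} {T : ℝ}

instance instIsAddHaarTimePhase : (volume : Measure (ℝ × Phase d)).IsAddHaarMeasure :=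
  Measure.prod.instIsAddHaarMeasure _ _

theorem apply_fold_of_isPeriodic {β : Type*} {u : Phase d → β}
    (hu : ∀ v : E d, IsPeriodic Ω (fun x => u (x, v))) (z : Phase d) : u (fold Ω z) = u z := by
  cases Ω with
  | wholeSpace => rfl
  | torus =>
    -- The periods of `u` form a subgroup; it contains the unit vectors, hence the whole lattice, in
    -- particular the integer part of the position.
    let G : AddSubgroup (E d) :=
      { carrier := {a | ∀ x v : E d, u (x + a, v) = u (x, v)}
        zero_mem' := fun x v => by simp
        add_mem' := fun {a b} ha hb x v => by rw [← add_assoc, hb, ha]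
        neg_mem' := fun {a} ha x v => by
          have := ha (x + -a) v
          rw [← this]; simp }
    have h1 : ∀ i : Fin d, EuclideanSpace.single i (1 : ℝ) ∈ G := fun i x v => hu v rfl i x
    have h2 : ∀ n : Fin d → ℤ, lattice n ∈ G := by
      intro n
      have : lattice n = ∑ i, n i • EuclideanSpace.single i (1 : ℝ) := by
        ext j
        simp [Finset.sum_apply, Pi.single_apply]
      rw [this]
      exact G.sum_mem fun i _ => G.zsmul_mem (h1 i) _
    have h3 := h2 (fun i => ⌊z.1 i⌋) (fold .torus z).1 z.2
    have h4 : (fold .torus z).1 + lattice (fun i => ⌊z.1 i⌋) = z.1 := by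
      ext i
      simp [fold]
    rw [h4] at h3
    exact h3.symm

/-- The extension to `ℝ × ℝ^d × ℝ^d` of a function on `(0, T) × Ω × ℝ^d`, by periodicity in `x`
and by zero in `t`. -/
noncomputable def extend {F : Type*} [Zero F] (Ω : SpatialDomain) (T : ℝ) (g : ℝ → Phase d → F) :
    ℝ × Phase d → F :=
  indicator (Ioo 0 T ×ˢ univ) fun p => g p.1 (fold Ω p.2)

theorem extend_of_mem {F : Type*} [Zero F] {g : ℝ → Phase d → F} {t : ℝ} (ht : t ∈ Ioo 0 T)
    (z : Phase d) : extend Ω T g (t, z) = g t (fold Ω z) :=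
  indicator_of_mem (mk_mem_prod ht (mem_univ z)) _

theorem extend_of_notMem {F : Type*} [Zero F] {g : ℝ → Phase d → F} {t : ℝ} (ht : t ∉ Ioo 0 T)
    (z : Phase d) : extend Ω T g (t, z) = 0 :=
  indicator_of_notMem (fun h => ht h.1) _

theorem quasiMeasurePreserving_prod_fold :
    Measure.QuasiMeasurePreserving (Prod.map id (fold Ω) : ℝ × Phase d → ℝ × Phase d)
      (((volume : Measure ℝ).restrict (Icc 0 T)).prod volume) (timePhaseMeasure Ω d T) := by
  refine ⟨measurable_id.prodMap measurable_fold, ?_⟩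
  rw [← Measure.map_prod_map _ _ measurable_id measurable_fold, Measure.map_id]
  exact Measure.AbsolutelyContinuous.prod Measure.AbsolutelyContinuous.rfl
    quasiMeasurePreserving_fold.absolutelyContinuous

theorem volume_restrict_le :
    (volume : Measure (ℝ × Phase d)).restrict (Ioo 0 T ×ˢ univ) ≤
      ((volume : Measure ℝ).restrict (Icc 0 T)).prod volume := by
  have h : ((volume : Measure ℝ).restrict (Icc 0 T)).prod (volume : Measure (Phase d)) =
      (volume : Measure (ℝ × Phase d)).restrict (Icc 0 T ×ˢ univ) := by
    rw [Measure.volume_eq_prod ℝ, ← Measure.prod_restrict, Measure.restrict_univ]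
  rw [h]
  exact Measure.restrict_mono (prod_mono Ioo_subset_Icc_self subset_rfl) le_rfl

theorem aestronglyMeasurable_extend {F : Type*} [NormedAddCommGroup F] {g : ℝ → Phase d → F}
    (hg : AEStronglyMeasurable (fun p : ℝ × Phase d => g p.1 p.2) (timePhaseMeasure Ω d T)) :
    AEStronglyMeasurable (extend Ω T g) volume := by
  rw [extend, aestronglyMeasurable_indicator_iff (measurableSet_Ioo.prod .univ)]
  exact (hg.comp_quasiMeasurePreserving quasiMeasurePreserving_prod_fold).mono_measure
    volume_restrict_le

theorem ae_extend {P : ℝ → Phase d → Prop}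
    (h : ∀ᵐ p ∂(timePhaseMeasure Ω d T), P p.1 p.2) :
    ∀ᵐ p ∂(volume : Measure (ℝ × Phase d)), p.1 ∈ Ioo 0 T → P p.1 (fold Ω p.2) := by
  have h1 : ∀ᵐ p ∂((volume : Measure (ℝ × Phase d)).restrict (Ioo 0 T ×ˢ univ)),
      P p.1 (fold Ω p.2) :=
    volume_restrict_le.absolutelyContinuous.ae_le (quasiMeasurePreserving_prod_fold.ae h)
  rw [ae_restrict_iff' (measurableSet_Ioo.prod .univ)] at h1
  filter_upwards [h1] with p hp ht using hp ⟨ht, mem_univ _⟩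

/-- Bump-like functions which vanish unless `t ∈ [a, b] ⊆ (0, T)`. -/
structure IsInteriorBump (T R a b : ℝ) (ψ : ℝ × Phase d → ℝ) : Prop extends IsBumpLike R ψ where
  pos_left : 0 < a
  lt_right : b < T
  time_support : ∀ (t : ℝ) (z : Phase d), t ∉ Icc a b → ψ (t, z) = 0

theorem IsInteriorBump.dirD {R a b : ℝ} {ψ : ℝ × Phase d → ℝ} (h : IsInteriorBump T R a b ψ)
    (e : ℝ × Phase d) : IsInteriorBump T R a b (dirD e ψ) := by
  refine ⟨h.toIsBumpLike.dirD e, h.pos_left, h.lt_right, fun t z ht => ?_⟩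
  have ho : IsOpen {p : ℝ × Phase d | p.1 ∈ (Icc a b)ᶜ} :=
    isClosed_Icc.isOpen_compl.preimage continuous_fst
  have : ψ =ᶠ[nhds (t, z)] fun _ => 0 := by
    filter_upwards [ho.mem_nhds ht] with p hp using h.time_support p.1 p.2 hp
  rw [Vlasov.dirD, this.fderiv_eq]
  simp

theorem IsInteriorBump.sum {R a b : ℝ} {ι : Type*} {s : Finset ι} {ψ : ι → ℝ × Phase d → ℝ}
    (h : ∀ i, IsInteriorBump T R a b (ψ i)) (ha : 0 < a) (hb : b < T) :
    IsInteriorBump T R a b (fun p => ∑ i ∈ s, ψ i p) :=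
  ⟨⟨ContDiff.sum fun i _ => (h i).smooth,
    fun t x v hxv => Finset.sum_eq_zero fun i _ => (h i).support t x v hxv⟩, ha, hb,
    fun t z ht => Finset.sum_eq_zero fun i _ => (h i).time_support t z ht⟩

theorem IsInteriorBump.hasCompactSupport {R a b : ℝ} {ψ : ℝ × Phase d → ℝ}
    (h : IsInteriorBump T R a b ψ) : HasCompactSupport ψ := by
  refine HasCompactSupport.intro (K := Icc a b ×ˢ
      (Metric.closedBall (0 : E d) R ×ˢ Metric.closedBall (0 : E d) R))
    (isCompact_Icc.prod ((isCompact_closedBall _ _).prod (isCompact_closedBall _ _)))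
    fun p hp => ?_
  by_contra hne
  refine hp ⟨?_, ?_, ?_⟩
  · by_contra h'
    exact hne (h.time_support p.1 p.2 h')
  · rw [mem_closedBall_zero_iff]
    by_contra! h'
    exact hne (h.support p.1 p.2.1 p.2.2 (Or.inl h'))
  · rw [mem_closedBall_zero_iff]
    by_contra! h'
    exact hne (h.support p.1 p.2.1 p.2.2 (Or.inr h'))

theorem periodize_sum {R : ℝ} {ι : Type*} {s : Finset ι} {ψ : ι → ℝ × Phase d → ℝ}
    (h : ∀ i, IsBumpLike R (ψ i)) (p : ℝ × Phase d) :
    periodize Ω (fun p => ∑ i ∈ s, ψ i p) p = ∑ i ∈ s, periodize Ω (ψ i) p := by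
  cases Ω with
  | wholeSpace => rfl
  | torus =>
    have hs : IsBumpLike R (fun p => ∑ i ∈ s, ψ i p) :=
      ⟨ContDiff.sum fun i _ => (h i).smooth,
        fun t x v hxv => Finset.sum_eq_zero fun i _ => (h i).support t x v hxv⟩
    rw [hs.periodize_eq_sum le_rfl, Finset.sum_comm]
    exact Finset.sum_congr rfl fun i _ => ((h i).periodize_eq_sum le_rfl).symm

theorem IsInteriorBump.periodize_time_support {R a b : ℝ} {ψ : ℝ × Phase d → ℝ}
    (h : IsInteriorBump T R a b ψ) {t : ℝ} (ht : t ∉ Icc a b) (z : Phase d) :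
    periodize Ω ψ (t, z) = 0 := by
  cases Ω with
  | wholeSpace => exact h.time_support t z ht
  | torus =>
    refine (tsum_congr fun n => ?_).trans tsum_zero
    rw [Prod.mk_add_mk, add_zero]
    exact h.time_support t _ ht

theorem IsInteriorBump.isInteriorTestFunction {R a b : ℝ} {ψ : ℝ × Phase d → ℝ}
    (h : IsInteriorBump T R a b ψ) : IsInteriorTestFunction Ω T (periodize Ω ψ) :=
  { toIsTestFunction := h.toIsBumpLike.isTest_periodize.isTestFunction
    time_support := ⟨a, b, h.pos_left, h.lt_right,
      fun _ z ht => h.periodize_time_support ht z⟩ }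

/-- Unfolding in space-time. -/
theorem IsInteriorBump.integral_extend_mul {R a b : ℝ} {ψ : ℝ × Phase d → ℝ}
    (hψ : IsInteriorBump T R a b ψ) (hT : 0 ≤ T) {g : ℝ → Phase d → ℝ}
    (hint : Integrable (fun p => extend Ω T g p * ψ p) volume) :
    ∫ p, extend Ω T g p * ψ p =
      ∫ t in (0 : ℝ)..T, ∫ z, g t z * periodize Ω ψ (t, z) ∂(phaseMeasure Ω d) := by
  rw [Measure.volume_eq_prod] at hint ⊢
  rw [integral_prod _ hint, intervalIntegral.integral_of_le hT,
    integral_Ioc_eq_integral_Ioo, ← integral_indicator measurableSet_Ioo]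
  refine integral_congr_ae ?_
  filter_upwards [hint.prod_right_ae] with t ht
  by_cases h : t ∈ Ioo 0 T
  · rw [indicator_of_mem h]
    simp only [extend_of_mem h] at ht ⊢
    exact hψ.toIsBumpLike.integral_fold_mul (g t) t ht
  · rw [indicator_of_notMem h]
    simp only [extend_of_notMem h, zero_mul, integral_zero]

/-- The phase measure charges only positions in the cell, so it suffices that φ vanishes off a
compact set there; periodizations do, although their support in ℝ^d is not compact. -/
theorem integrable_smul_of_isLocInt {F : Type*} [NormedAddCommGroup F] [NormedSpace ℝ F]
    {g : ℝ → Phase d → F} (hg : IsLocInt Ω T g) {φ : ℝ × Phase d → ℝ} (hφ : Continuous φ)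
    {a b R : ℝ} (ha : 0 < a) (hb : b < T)
    (hR : ∀ (t : ℝ) (z : Phase d), z.1 ∈ cell Ω d → (R < ‖z.1‖ ∨ R < ‖z.2‖) → φ (t, z) = 0)
    (ht : ∀ (t : ℝ) (z : Phase d), t ∉ Icc a b → φ (t, z) = 0) :
    Integrable (fun p : ℝ × Phase d => φ p • g p.1 p.2)
      ((volume : Measure ℝ).prod (phaseMeasure Ω d)) := by
  set S : Set (ℝ × Phase d) := Icc a b ×ˢ
      (Metric.closedBall (0 : E d) R ×ˢ Metric.closedBall (0 : E d) R) with hS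
  have hSc : IsCompact S :=
    isCompact_Icc.prod ((isCompact_closedBall _ _).prod (isCompact_closedBall _ _))
  have hsub : S ⊆ Ioo 0 T ×ˢ univ := fun p hp =>
    ⟨⟨ha.trans_le hp.1.1, hp.1.2.trans_lt hb⟩, mem_univ _⟩
  have h1 := hg.integrableOn_compact_subset hsub hSc
  have h2 : IntegrableOn (fun p : ℝ × Phase d => φ p • g p.1 p.2) S
      ((volume : Measure ℝ).prod (phaseMeasure Ω d)) :=
    h1.continuousOn_smul hφ.continuousOn hSc
  have h3 := h2.integrable_indicator hSc.measurableSet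
  refine h3.congr ?_
  have hcell : ∀ᵐ p ∂((volume : Measure ℝ).prod (phaseMeasure Ω d)), p.2.1 ∈ cell Ω d :=
    Measure.quasiMeasurePreserving_snd.ae ae_mem_cell
  filter_upwards [hcell] with p hp
  by_cases h : p ∈ S
  · rw [indicator_of_mem h]
  · rw [indicator_of_notMem h]
    have : φ p = 0 := by
      by_contra hne
      refine h ⟨?_, ?_, ?_⟩
      · by_contra h'
        exact hne (ht p.1 p.2 h')
      · rw [mem_closedBall_zero_iff]
        by_contra! h'
        exact hne (hR p.1 p.2 hp (Or.inl h'))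
      · rw [mem_closedBall_zero_iff]
        by_contra! h'
        exact hne (hR p.1 p.2 hp (Or.inr h'))
    rw [this, zero_smul]

theorem integrable_bump_mul {R a b : ℝ} {ψ : ℝ × Phase d → ℝ} (hψ : IsInteriorBump T R a b ψ)
    {g : ℝ × Phase d → ℝ} (hg : LocallyIntegrable g volume) :
    Integrable (fun p => g p * ψ p) volume := by
  have := hg.integrable_smul_right_of_hasCompactSupport hψ.smooth.continuous hψ.hasCompactSupport
  refine this.congr (Filter.Eventually.of_forall fun p => ?_)
  simp [smul_eq_mul, mul_comm]

theorem locallyIntegrable_of_ae_norm_le {F : Type*} [NormedAddCommGroup F] {g : ℝ × Phase d → F}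
    (hg : AEStronglyMeasurable g volume) {b : ℝ × Phase d → ℝ} (hb : Continuous b)
    (h : ∀ᵐ p, ‖g p‖ ≤ b p) : LocallyIntegrable g volume :=
  (hb.locallyIntegrable).mono hg (by
    filter_upwards [h] with p hp using hp.trans (le_abs_self _))

end Unfold

/-! ### The strong solution as a distributional solution on all of ℝ^d -/

section StrongSolution

variable {d : ℕ} {Ω : SpatialDomain} {ε T : ℝ} {K : E d → E d} {f : ℝ → Phase d → ℝ}
  {gx gv : ℝ → Phase d → E d}

/-- The derivative of `f` along the free transport and the force field. -/
noncomputable def transport (Ω : SpatialDomain) (K : E d → E d) (f : ℝ → Phase d → ℝ)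
    (gx gv : ℝ → Phase d → E d) (t : ℝ) (z : Phase d) : ℝ :=
  inner ℝ z.2 (gx t z) + inner ℝ (force Ω K (f t) z.1) (gv t z)

theorem IsStrongSolution.aestronglyMeasurable (hf : IsStrongSolution Ω ε T K f gx gv) :
    AEStronglyMeasurable (fun p : ℝ × Phase d => f p.1 p.2) (timePhaseMeasure Ω d T) := by
  have h1 : AEStronglyMeasurable (fun p : ℝ × Phase d => f p.1 p.2)
      (((volume : Measure ℝ).prod (phaseMeasure Ω d)).restrict (Icc 0 T ×ˢ univ)) :=
    hf.continuousOn.aestronglyMeasurable (measurableSet_Icc.prod .univ)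
  rwa [← Measure.prod_restrict, Measure.restrict_univ] at h1

/-- The solution, extended by its values at the end points. -/
noncomputable def clampTime (T : ℝ) (f : ℝ → Phase d → ℝ) (p : ℝ × Phase d) : ℝ :=
  f (max 0 (min p.1 T)) p.2

theorem clamp_mem (hT : 0 ≤ T) (t : ℝ) : max 0 (min t T) ∈ Icc 0 T :=
  ⟨le_max_left _ _, max_le hT (min_le_right _ _)⟩

theorem clampTime_of_mem {t : ℝ} (ht : t ∈ Icc 0 T) (z : Phase d) :
    clampTime T f (t, z) = f t z := by
  simp only [clampTime]
  rw [min_eq_left ht.2, max_eq_right ht.1]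

theorem IsStrongSolution.continuous_clampTime (hf : IsStrongSolution Ω ε T K f gx gv)
    (hT : 0 ≤ T) : Continuous (clampTime T f) := by
  have h : Continuous (fun p : ℝ × Phase d => (max 0 (min p.1 T), p.2)) := by fun_prop
  exact hf.continuousOn.comp_continuous h fun p => ⟨clamp_mem hT _, mem_univ _⟩

theorem IsStrongSolution.clampTime_pos (hf : IsStrongSolution Ω ε T K f gx gv)
    (hT : 0 ≤ T) (p : ℝ × Phase d) : 0 < clampTime T f p := hf.pos _ (clamp_mem hT _) _

theorem IsStrongSolution.periodicIn_clampTime (hf : IsStrongSolution Ω ε T K f gx gv)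
    (hT : 0 ≤ T) : PeriodicIn Ω (clampTime T f) := by
  intro hΩ i p
  have := hf.periodic _ (clamp_mem hT p.1) p.2.2 hΩ i p.2.1
  simp only [clampTime, xUnit, Prod.fst_add, Prod.snd_add, add_zero]
  rw [show p.2 + (EuclideanSpace.single i (1 : ℝ), (0 : E d)) =
    (p.2.1 + EuclideanSpace.single i 1, p.2.2) from Prod.ext rfl (add_zero _)]
  exact this

theorem IsStrongSolution.extend_eq (hf : IsStrongSolution Ω ε T K f gx gv)
    {p : ℝ × Phase d} (hp : p.1 ∈ Ioo 0 T) : extend Ω T f p = clampTime T f p := by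
  have hp' : p.1 ∈ Icc 0 T := Ioo_subset_Icc_self hp
  rw [show p = (p.1, p.2) from rfl, extend_of_mem hp, clampTime_of_mem hp']
  exact apply_fold_of_isPeriodic (hf.periodic _ hp') _

/-- Bounds on almost every time slice combine to a bound on the product by Fubini, applied to a
measurable representative because the set where the bound holds must be measurable. -/
theorem ae_prod_of_ae_eLpNorm_top_le {F : Type*} [NormedAddCommGroup F] {g : ℝ → Phase d → F}
    (hg : AEStronglyMeasurable (fun p : ℝ × Phase d => g p.1 p.2) (timePhaseMeasure Ω d T)) {M : ℝ}
    (hM : 0 ≤ M)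
    (h : ∀ᵐ t ∂((volume : Measure ℝ).restrict (Icc 0 T)),
      eLpNorm (g t) ∞ (phaseMeasure Ω d) ≤ ENNReal.ofReal M) :
    ∀ᵐ p ∂(timePhaseMeasure Ω d T), ‖g p.1 p.2‖ ≤ M := by
  have hms : MeasurableSet {p : ℝ × Phase d | ‖hg.mk _ p‖ ≤ M} :=
    measurableSet_le hg.stronglyMeasurable_mk.norm.measurable measurable_const
  have h1 : ∀ᵐ p ∂(timePhaseMeasure Ω d T), ‖hg.mk _ p‖ ≤ M := by
    refine (Measure.ae_prod_iff_ae_ae hms).2 ?_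
    filter_upwards [h, ae_ae_eq_mk hg] with t ht hmk
    rw [eLpNorm_exponent_top] at ht
    filter_upwards [hmk, ae_le_eLpNormEssSup (f := g t) (μ := phaseMeasure Ω d)] with z h1 h2
    rw [← h1]
    have h3 := h2.trans ht
    rw [← ofReal_norm] at h3
    exact (ENNReal.ofReal_le_ofReal_iff hM).1 h3
  filter_upwards [h1, hg.ae_eq_mk] with p hp h2
  rw [h2]; exact hp

theorem IsStrongSolution.exists_bound (hf : IsStrongSolution Ω ε T K f gx gv) :
    ∃ M : ℝ, 0 ≤ M ∧ (∀ᵐ p ∂(timePhaseMeasure Ω d T), ‖gx p.1 p.2‖ ≤ M) ∧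
      (∀ᵐ p ∂(timePhaseMeasure Ω d T), ‖gv p.1 p.2‖ ≤ M) ∧
      ∀ᵐ p ∂(timePhaseMeasure Ω d T), ‖f p.1 p.2‖ ≤ M := by
  obtain ⟨M, hM⟩ := hf.sobolev ∞ le_top
  have hle : ENNReal.ofReal M ≤ ENNReal.ofReal (max M 0) :=
    ENNReal.ofReal_le_ofReal (le_max_left _ _)
  have h0 : 0 ≤ max M 0 := le_max_right _ _
  refine ⟨max M 0, h0, ae_prod_of_ae_eLpNorm_top_le hf.measurable_gx h0 ?_,
    ae_prod_of_ae_eLpNorm_top_le hf.measurable_gv h0 ?_,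
    ae_prod_of_ae_eLpNorm_top_le hf.aestronglyMeasurable h0 ?_⟩
  · filter_upwards [hM] with t ht using ht.2.1.trans hle
  · filter_upwards [hM] with t ht using ht.2.2.trans hle
  · filter_upwards [hM] with t ht using ht.1.trans hle

theorem norm_extend_le {F : Type*} [NormedAddCommGroup F] {g : ℝ → Phase d → F}
    {b : Phase d → ℝ} (hb : ∀ z, 0 ≤ b z) (hbf : ∀ z, b (fold Ω z) = b z)
    (h : ∀ᵐ p ∂(timePhaseMeasure Ω d T), ‖g p.1 p.2‖ ≤ b p.2) :
    ∀ᵐ p ∂(volume : Measure (ℝ × Phase d)), ‖extend Ω T g p‖ ≤ b p.2 := by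
  filter_upwards [ae_extend (P := fun t z => ‖g t z‖ ≤ b z) h] with p hp
  by_cases ht : p.1 ∈ Ioo 0 T
  · rw [show p = (p.1, p.2) from rfl, extend_of_mem ht, ← hbf]
    exact hp ht
  · rw [show p = (p.1, p.2) from rfl, extend_of_notMem ht, norm_zero]
    exact hb _

theorem locallyIntegrable_extend {F : Type*} [NormedAddCommGroup F] {g : ℝ → Phase d → F}
    (hg : AEStronglyMeasurable (fun p : ℝ × Phase d => g p.1 p.2) (timePhaseMeasure Ω d T))
    {b : Phase d → ℝ} (hbc : Continuous b) (hb : ∀ z, 0 ≤ b z) (hbf : ∀ z, b (fold Ω z) = b z)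
    (h : ∀ᵐ p ∂(timePhaseMeasure Ω d T), ‖g p.1 p.2‖ ≤ b p.2) :
    LocallyIntegrable (extend Ω T g) volume :=
  locallyIntegrable_of_ae_norm_le (aestronglyMeasurable_extend hg) (hbc.comp continuous_snd)
    (norm_extend_le hb hbf h)

theorem IsStrongSolution.aestronglyMeasurable_transport (hf : IsStrongSolution Ω ε T K f gx gv)
    (hK : MemLp K ∞ (volume : Measure (E d))) :
    AEStronglyMeasurable (fun p : ℝ × Phase d => transport Ω K f gx gv p.1 p.2)
      (timePhaseMeasure Ω d T) := by
  refine AEStronglyMeasurable.add ?_ ?_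
  · exact AEStronglyMeasurable.inner (by fun_prop) hf.measurable_gx
  · exact AEStronglyMeasurable.inner (aestronglyMeasurable_force hK hf.aestronglyMeasurable
      fun t ht => (hf.probDensity t ht).integrable) hf.measurable_gv

theorem IsStrongSolution.ae_norm_force_le (hf : IsStrongSolution Ω ε T K f gx gv)
    (hK : MemLp K ∞ (volume : Measure (E d))) :
    ∀ᵐ p ∂(timePhaseMeasure Ω d T), ‖force Ω K (f p.1) p.2.1‖ ≤ supNorm K := by
  have h : ∀ᵐ t ∂((volume : Measure ℝ).restrict (Icc 0 T)), ∀ x, ‖force Ω K (f t) x‖ ≤ supNorm K := by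
    filter_upwards [ae_restrict_mem measurableSet_Icc] with t ht x
    exact (hf.probDensity t ht).norm_force_le hK x
  filter_upwards [Measure.quasiMeasurePreserving_fst.ae h] with p hp using hp _

/-- Growth in v is at most linear, so the transport term is locally bounded and can be mollified. -/
theorem IsStrongSolution.ae_norm_transport_le (hf : IsStrongSolution Ω ε T K f gx gv)
    (hK : MemLp K ∞ (volume : Measure (E d))) {M : ℝ}
    (h1 : ∀ᵐ p ∂(timePhaseMeasure Ω d T), ‖gx p.1 p.2‖ ≤ M)
    (h2 : ∀ᵐ p ∂(timePhaseMeasure Ω d T), ‖gv p.1 p.2‖ ≤ M) :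
    ∀ᵐ p ∂(timePhaseMeasure Ω d T),
      ‖transport Ω K f gx gv p.1 p.2‖ ≤ (‖p.2.2‖ + supNorm K) * M := by
  filter_upwards [h1, h2, hf.ae_norm_force_le hK] with p h1 h2 h3
  rw [transport, add_mul]
  refine (norm_add_le _ _).trans (add_le_add ?_ ?_)
  · exact (norm_inner_le_norm _ _).trans (mul_le_mul_of_nonneg_left h1 (norm_nonneg _))
  · exact (norm_inner_le_norm _ _).trans (mul_le_mul h3 h2 (norm_nonneg _) supNorm_nonneg)

theorem IsStrongSolution.locallyIntegrable_extend_transport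
    (hf : IsStrongSolution Ω ε T K f gx gv) (hK : MemLp K ∞ (volume : Measure (E d))) :
    LocallyIntegrable (extend Ω T (transport Ω K f gx gv)) volume := by
  obtain ⟨M, hM, h1, h2, -⟩ := hf.exists_bound
  exact locallyIntegrable_extend (hf.aestronglyMeasurable_transport hK)
    (b := fun z => (‖z.2‖ + supNorm K) * M) (by fun_prop)
    (fun z => mul_nonneg (add_nonneg (norm_nonneg _) supNorm_nonneg) hM)
    (fun z => by simp only [fold_snd]) (hf.ae_norm_transport_le hK h1 h2)

theorem IsStrongSolution.locallyIntegrable_extend_gx (hf : IsStrongSolution Ω ε T K f gx gv) :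
    LocallyIntegrable (extend Ω T gx) volume := by
  obtain ⟨M, hM, h1, -, -⟩ := hf.exists_bound
  exact locallyIntegrable_extend hf.measurable_gx (b := fun _ => M) (by fun_prop)
    (fun z => hM) (fun z => rfl) h1

theorem IsStrongSolution.locallyIntegrable_extend_gv (hf : IsStrongSolution Ω ε T K f gx gv) :
    LocallyIntegrable (extend Ω T gv) volume := by
  obtain ⟨M, hM, -, h2, -⟩ := hf.exists_bound
  exact locallyIntegrable_extend hf.measurable_gv (b := fun _ => M) (by fun_prop)
    (fun z => hM) (fun z => rfl) h2

theorem IsInteriorBump.clampTime_mul {R a b : ℝ} {ψ : ℝ × Phase d → ℝ}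
    (hψ : IsInteriorBump T R a b ψ) (hf : IsStrongSolution Ω ε T K f gx gv) (p : ℝ × Phase d) :
    clampTime T f p * ψ p = extend Ω T f p * ψ p := by
  by_cases hp : p.1 ∈ Ioo 0 T
  · rw [hf.extend_eq hp]
  · have : ψ p = 0 := hψ.time_support p.1 p.2 fun h =>
      hp ⟨hψ.pos_left.trans_le h.1, h.2.trans_lt hψ.lt_right⟩
    rw [this, mul_zero, mul_zero]

theorem IsInteriorBump.integral_clampTime_mul {R a b : ℝ} {ψ : ℝ × Phase d → ℝ}
    (hψ : IsInteriorBump T R a b ψ) (hf : IsStrongSolution Ω ε T K f gx gv) (hT : 0 ≤ T) :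
    ∫ p, clampTime T f p * ψ p =
      ∫ t in (0 : ℝ)..T, ∫ z, f t z * periodize Ω ψ (t, z) ∂(phaseMeasure Ω d) := by
  have h1 := integrable_bump_mul hψ (hf.continuous_clampTime hT).locallyIntegrable
  have h2 : (fun p => clampTime T f p * ψ p) = fun p => extend Ω T f p * ψ p :=
    funext (hψ.clampTime_mul hf)
  rw [h2] at h1 ⊢
  exact hψ.integral_extend_mul hT h1

/-- The weak gradient on the whole space. -/
theorem IsStrongSolution.integral_mul_dirD (hf : IsStrongSolution Ω ε T K f gx gv) (hT : 0 ≤ T)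
    {R a b : ℝ} {ψ : ℝ × Phase d → ℝ} (hψ : IsInteriorBump T R a b ψ) (h k : E d) :
    ∫ p, clampTime T f p * dirD (0, (h, k)) ψ p =
      -∫ p, (inner ℝ (extend Ω T gx p) h + inner ℝ (extend Ω T gv p) k) * ψ p := by
  have he : ∀ p, inner ℝ (extend Ω T gx p) h + inner ℝ (extend Ω T gv p) k =
      extend Ω T (fun t z => inner ℝ (gx t z) h + inner ℝ (gv t z) k) p := by
    intro p
    by_cases hp : p.1 ∈ Ioo 0 T
    · rw [show p = (p.1, p.2) from rfl, extend_of_mem hp, extend_of_mem hp, extend_of_mem hp]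
    · rw [show p = (p.1, p.2) from rfl, extend_of_notMem hp, extend_of_notMem hp,
        extend_of_notMem hp]
      simp
  have hli : LocallyIntegrable
      (fun p => inner ℝ (extend Ω T gx p) h + inner ℝ (extend Ω T gv p) k) volume := by
    refine LocallyIntegrable.add ?_ ?_
    · intro p
      obtain ⟨U, hU, hi⟩ := hf.locallyIntegrable_extend_gx p
      exact ⟨U, hU, hi.inner_const h⟩
    · intro p
      obtain ⟨U, hU, hi⟩ := hf.locallyIntegrable_extend_gv p
      exact ⟨U, hU, hi.inner_const k⟩
  have hint := integrable_bump_mul hψ hli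
  simp only [he] at hint ⊢
  rw [(hψ.dirD _).integral_clampTime_mul hf hT, hψ.integral_extend_mul hT hint,
    ← intervalIntegral.integral_neg, intervalIntegral.integral_of_le hT,
    intervalIntegral.integral_of_le hT]
  have hw := ae_restrict_of_ae_restrict_of_subset (Ioc_subset_Icc_self (a := 0) (b := T))
    hf.weakGradient
  refine integral_congr_ae ?_
  filter_upwards [hw] with t ht
  have htest := hψ.toIsBumpLike.isTest_periodize (Ω := Ω)
  have h1 : IsTestFunction Ω (fun p : ℝ × Phase d => periodize Ω ψ (t, p.2)) := by
    have h2 := htest.isTestFunction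
    obtain ⟨R', hR'⟩ := h2.compact_support
    exact ⟨h2.smooth.comp (contDiff_const.prodMk contDiff_snd), fun _ v => h2.periodic t v,
      R', fun _ x v hx hxv => hR' t x v hx hxv⟩
  have h3 := ht (fun z => periodize Ω ψ (t, z)) h1 h k
  simp only [fderiv_phase_slice htest.smooth.differentiable_infty] at h3
  rw [← hψ.toIsBumpLike.dirD_periodize]
  refine h3.trans ?_
  congr 1
  exact integral_congr_ae (Filter.Eventually.of_forall fun z => mul_comm _ _)

/-- The equation on the whole space. -/
theorem IsStrongSolution.integral_mul_dirD_time (hf : IsStrongSolution Ω ε T K f gx gv)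
    (hK : MemLp K ∞ (volume : Measure (E d))) (hT : 0 ≤ T)
    {R a b : ℝ} {ψ : ℝ × Phase d → ℝ} (hψ : IsInteriorBump T R a b ψ) :
    (∫ p, clampTime T f p * dirD (1, 0) ψ p) +
      ε * ∫ p, clampTime T f p * ∑ i, dirD (vUnit i) (dirD (vUnit i) ψ) p =
      ∫ p, extend Ω T (transport Ω K f gx gv) p * ψ p := by
  obtain ⟨ft, lap, hft, hlap, heq⟩ := hf.equation
  have hint := integrable_bump_mul hψ (hf.locallyIntegrable_extend_transport hK)
  have hL : IsInteriorBump T R a b (fun p => ∑ i, dirD (vUnit i) (dirD (vUnit i) ψ) p) :=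
    IsInteriorBump.sum (fun i => (hψ.dirD _).dirD _) hψ.pos_left hψ.lt_right
  have htest := hψ.toIsBumpLike.isTest_periodize (Ω := Ω)
  have hitest := hψ.isInteriorTestFunction (Ω := Ω)
  obtain ⟨R', -, hR'⟩ := exists_compact_of_support htest.support
  rw [(hψ.dirD _).integral_clampTime_mul hf hT, hL.integral_clampTime_mul hf hT,
    hψ.integral_extend_mul hT hint]
  have h1 := hft.2 _ hitest
  have h2 := hlap.2 _ hitest
  have h3 : ∀ t z, periodize Ω (fun p => ∑ i, dirD (vUnit i) (dirD (vUnit i) ψ) p) (t, z) =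
      laplacianV (periodize Ω ψ) t z := by
    intro t z
    rw [laplacianV_eq_sum htest.smooth, periodize_sum fun i => (hψ.toIsBumpLike.dirD _).dirD _]
    refine Finset.sum_congr rfl fun i _ => ?_
    rw [hψ.toIsBumpLike.dirD_periodize, (hψ.toIsBumpLike.dirD _).dirD_periodize]
  have hi1 := integrable_smul_of_isLocInt hft.1 htest.smooth.continuous hψ.pos_left hψ.lt_right hR'
    fun t z ht => hψ.periodize_time_support ht z
  have hi2 := integrable_smul_of_isLocInt hlap.1 htest.smooth.continuous hψ.pos_left hψ.lt_right hR'
    fun t z ht => hψ.periodize_time_support ht z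
  simp only [h3, ← hψ.toIsBumpLike.dirD_periodize]
  rw [h2]
  change (∫ t in (0 : ℝ)..T, ∫ z, f t z * fderiv ℝ (periodize Ω ψ) (t, z) (1, 0)
    ∂(phaseMeasure Ω d)) + _ = _
  rw [h1, neg_add_eq_sub]
  have hi1' := hi1.integral_prod_left
  have hi2' := hi2.integral_prod_left
  simp only [smul_eq_mul] at hi1 hi2 hi1' hi2'
  rw [← intervalIntegral.integral_sub hi2'.intervalIntegrable hi1'.intervalIntegrable,
    intervalIntegral.integral_of_le hT, intervalIntegral.integral_of_le hT,
    integral_Ioc_eq_integral_Ioo, integral_Ioc_eq_integral_Ioo]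
  refine integral_congr_ae ?_
  filter_upwards [Measure.ae_ae_of_ae_prod heq, ae_restrict_of_ae hi1.prod_right_ae,
    ae_restrict_of_ae hi2.prod_right_ae] with t ht hit1 hit2
  rw [← integral_sub hit2 hit1]
  refine integral_congr_ae ?_
  filter_upwards [ht] with z hz
  rw [transport]
  -- At almost every point the equation turns the difference of the diffusion term and the time
  -- derivative into the transport term.
  linear_combination -(periodize Ω ψ (t, z)) * hz

end StrongSolution


/-! ### Mollification -/

section Mollify

open Filter Topology ContinuousLinearMap

variable {d : ℕ} {Ω : SpatialDomain} {T : ℝ}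

open scoped Convolution

instance instIsNegInvariantTimePhase : (volume : Measure (ℝ × Phase d)).IsNegInvariant :=
  Measure.IsAddHaarMeasure.isNegInvariant_of_regular _

/-- The convolution with a normalized bump function. -/
noncomputable def mollify {F : Type*} [NormedAddCommGroup F] [NormedSpace ℝ F]
    (B : ContDiffBump (0 : ℝ × Phase d)) (g : ℝ × Phase d → F) : ℝ × Phase d → F :=
  B.normed volume ⋆[lsmul ℝ ℝ, volume] g

theorem mollify_apply {F : Type*} [NormedAddCommGroup F] [NormedSpace ℝ F]
    (B : ContDiffBump (0 : ℝ × Phase d)) (g : ℝ × Phase d → F) (p : ℝ × Phase d) :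
    mollify B g p = ∫ q, B.normed volume (p - q) • g q :=
  convolution_lsmul_swap

theorem contDiff_mollify {F : Type*} [NormedAddCommGroup F] [NormedSpace ℝ F]
    (B : ContDiffBump (0 : ℝ × Phase d)) {g : ℝ × Phase d → F}
    (hg : LocallyIntegrable g volume) : ContDiff ℝ ∞ (mollify B g) :=
  B.hasCompactSupport_normed.contDiff_convolution_left _ B.contDiff_normed hg

theorem dirD_convolution {k g : ℝ × Phase d → ℝ} (hk : ContDiff ℝ ∞ k) (hkc : HasCompactSupport k)
    (hg : LocallyIntegrable g volume) (e : ℝ × Phase d) :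
    dirD e (k ⋆[lsmul ℝ ℝ, volume] g) = (dirD e k) ⋆[lsmul ℝ ℝ, volume] g := by
  funext p
  have h1 : HasFDerivAt (g ⋆[(lsmul ℝ ℝ).flip, volume] k)
      ((g ⋆[(lsmul ℝ ℝ).flip.precompR (ℝ × Phase d), volume] fderiv ℝ k) p) p :=
    hkc.hasFDerivAt_convolution_right _ hg (hk.of_le (by simp)) p
  rw [dirD, ← convolution_flip, h1.fderiv,
    convolution_precompR_apply _ hg (hkc.fderiv ℝ) (hk.continuous_fderiv (by simp)),
    ← convolution_flip]
  rfl

theorem hasCompactSupport_dirD {k : ℝ × Phase d → ℝ} (hkc : HasCompactSupport k)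
    (e : ℝ × Phase d) : HasCompactSupport (dirD e k) := hkc.fderiv_apply ℝ e

theorem fderiv_comp_const_sub (p : ℝ × Phase d) {k : ℝ × Phase d → ℝ} (hk : ContDiff ℝ ∞ k)
    (e q : ℝ × Phase d) :
    dirD e (fun q => k (p - q)) q = -dirD e k (p - q) := by
  have h1 : HasFDerivAt (fun q : ℝ × Phase d => p - q)
      (-(ContinuousLinearMap.id ℝ (ℝ × Phase d))) q := (hasFDerivAt_id q).const_sub p
  have h2 := (hk.differentiable_infty (p - q)).hasFDerivAt.comp q h1
  have h3 : fderiv ℝ (fun q => k (p - q)) q = _ := h2.fderiv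
  rw [dirD, h3]
  simp [dirD]

/-- The mollification kernel centred at p can be used as a test function as long as p keeps distance
`B.rOut` from the initial and final times. -/
theorem isInteriorBump_normed_sub (B : ContDiffBump (0 : ℝ × Phase d)) {p : ℝ × Phase d}
    (hp : p.1 ∈ Ioo B.rOut (T - B.rOut)) :
    IsInteriorBump T (‖p.2‖ + B.rOut) (p.1 - B.rOut) (p.1 + B.rOut)
      (fun q => B.normed volume (p - q)) := by
  have hz : ∀ y : ℝ × Phase d, B.rOut ≤ ‖y‖ → B.normed volume y = 0 := by
    intro y hy
    by_contra hne
    have : y ∈ Function.support (B.normed volume) := hne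
    rw [B.support_normed_eq, mem_ball_zero_iff] at this
    linarith
  refine ⟨⟨?_, fun t x v hxv => hz _ ?_⟩, by linarith [hp.1], by linarith [hp.2],
    fun t z ht => hz _ ?_⟩
  · exact B.contDiff_normed.comp (contDiff_const.sub contDiff_id)
  · have h0 : ‖p.2 - (x, v)‖ ≤ ‖p - (t, (x, v))‖ := norm_snd_le (p - (t, (x, v)))
    have h1 : ‖((x, v) : Phase d)‖ - ‖p.2‖ ≤ ‖p.2 - (x, v)‖ := by
      rw [norm_sub_rev]; exact norm_sub_norm_le _ _
    have h2 : ‖x‖ ≤ ‖((x, v) : Phase d)‖ := norm_fst_le ((x, v) : Phase d)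
    have h3 : ‖v‖ ≤ ‖((x, v) : Phase d)‖ := norm_snd_le ((x, v) : Phase d)
    rcases hxv with h | h <;> linarith
  · have h0 : ‖p.1 - t‖ ≤ ‖p - (t, z)‖ := norm_fst_le (p - (t, z))
    by_contra! h
    have h1 := (h0.trans_lt h).le
    rw [Real.norm_eq_abs, abs_le] at h1
    exact ht ⟨by linarith [h1.2], by linarith [h1.1]⟩

theorem integral_normed_sub (B : ContDiffBump (0 : ℝ × Phase d)) (p : ℝ × Phase d) :
    ∫ q, B.normed volume (p - q) = 1 := by
  rw [integral_sub_left_eq_self (fun q => B.normed volume q) volume p]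
  exact B.integral_normed

theorem integrable_normed_smul {F : Type*} [NormedAddCommGroup F] [NormedSpace ℝ F]
    (B : ContDiffBump (0 : ℝ × Phase d)) {g : ℝ × Phase d → F} (hg : LocallyIntegrable g volume)
    (p : ℝ × Phase d) : Integrable (fun q => B.normed volume (p - q) • g q) volume := by
  refine hg.integrable_smul_left_of_hasCompactSupport (f := g) ?_ ?_
  · exact B.continuous_normed.comp (continuous_const.sub continuous_id)
  · exact B.hasCompactSupport_normed.comp_homeomorph (Homeomorph.subLeft p)

theorem norm_mollify_le {F : Type*} [NormedAddCommGroup F] [NormedSpace ℝ F]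
    (B : ContDiffBump (0 : ℝ × Phase d)) {g : ℝ × Phase d → F} {p : ℝ × Phase d} {C : ℝ}
    (h : ∀ᵐ q, ‖q - p‖ ≤ B.rOut → ‖g q‖ ≤ C) : ‖mollify B g p‖ ≤ C := by
  have hi : Integrable (fun q => B.normed volume (p - q)) volume :=
    B.integrable_normed.comp_sub_left p
  rw [mollify_apply]
  calc _ ≤ ∫ q, B.normed volume (p - q) * C := by
        refine norm_integral_le_of_norm_le (hi.mul_const C) ?_
        filter_upwards [h] with q hq
        rw [norm_smul, Real.norm_of_nonneg (B.nonneg_normed _)]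
        by_cases hd : ‖q - p‖ ≤ B.rOut
        · exact mul_le_mul_of_nonneg_left (hq hd) (B.nonneg_normed _)
        · have : B.normed volume (p - q) = 0 := by
            by_contra hne
            have : p - q ∈ Function.support (B.normed volume) := hne
            rw [B.support_normed_eq, mem_ball_zero_iff, norm_sub_rev] at this
            exact hd this.le
          rw [this, zero_mul, zero_mul]
    _ = C := by rw [integral_mul_const, integral_normed_sub, one_mul]

theorem mollify_nonneg (B : ContDiffBump (0 : ℝ × Phase d)) {g : ℝ × Phase d → ℝ}
    (h : ∀ q, 0 ≤ g q) (p : ℝ × Phase d) : 0 ≤ mollify B g p := by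
  rw [mollify_apply]
  exact integral_nonneg fun q => mul_nonneg (B.nonneg_normed _) (h q)

theorem periodicIn_mollify (B : ContDiffBump (0 : ℝ × Phase d)) {g : ℝ × Phase d → ℝ}
    (h : PeriodicIn Ω g) : PeriodicIn Ω (mollify B g) := by
  intro hΩ i p
  have := integral_add_right_eq_self (μ := (volume : Measure (ℝ × Phase d)))
    (fun q => B.normed volume (p + xUnit i - q) • g q) (xUnit i)
  rw [mollify_apply, mollify_apply, ← this]
  simp only [add_sub_add_right_eq_sub, h hΩ i]

/-- A sequence of bump functions with radii tending to zero. -/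
noncomputable def mollSeq (d : ℕ) (n : ℕ) : ContDiffBump (0 : ℝ × Phase d) where
  rIn := 1 / ((n : ℝ) + 1) / 2
  rOut := 1 / ((n : ℝ) + 1)
  rIn_pos := by positivity
  rIn_lt_rOut := half_lt_self (by positivity)

theorem mollSeq_rOut (n : ℕ) : (mollSeq d n).rOut = 1 / ((n : ℝ) + 1) := rfl

theorem tendsto_mollSeq_rOut : Tendsto (fun n => (mollSeq d n).rOut) atTop (𝓝 0) :=
  tendsto_one_div_add_atTop_nhds_zero_nat

theorem mollSeq_rOut_le_one (n : ℕ) : (mollSeq d n).rOut ≤ 1 := by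
  rw [mollSeq_rOut, div_le_one (by positivity)]
  linarith [(Nat.cast_nonneg n : (0 : ℝ) ≤ n)]

theorem tendsto_mollify_of_continuous {g : ℝ × Phase d → ℝ} (hg : Continuous g)
    (p : ℝ × Phase d) : Tendsto (fun n => mollify (mollSeq d n) g p) atTop (𝓝 (g p)) :=
  ContDiffBump.convolution_tendsto_right_of_continuous tendsto_mollSeq_rOut hg p

theorem ae_tendsto_mollify {F : Type*} [NormedAddCommGroup F] [NormedSpace ℝ F] [CompleteSpace F]
    {g : ℝ × Phase d → F} (hg : LocallyIntegrable g volume) :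
    ∀ᵐ p, Tendsto (fun n => mollify (mollSeq d n) g p) atTop (𝓝 (g p)) :=
  -- The ratio 2 of outer to inner radius is the same for every n, which keeps the kernels
  -- comparable to averages over balls; Lebesgue differentiation then gives convergence almost
  -- everywhere.
  ContDiffBump.ae_convolution_tendsto_right_of_locallyIntegrable (K := 2) tendsto_mollSeq_rOut
    (Eventually.of_forall fun n => by simp only [mollSeq]; linarith) hg

theorem tendstoUniformlyOn_mollify {g : ℝ × Phase d → ℝ} (hg : Continuous g)
    {S : Set (ℝ × Phase d)} (hS : IsCompact S) :
    TendstoUniformlyOn (fun n => mollify (mollSeq d n) g) g atTop S := by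
  rw [Metric.tendstoUniformlyOn_iff]
  intro ε hε
  have h := hS.uniformContinuousAt_of_continuousAt g (fun p _ => hg.continuousAt)
    (Metric.dist_mem_uniformity (half_pos hε))
  obtain ⟨η, hη, h⟩ := Metric.mem_uniformity_dist.1 h
  filter_upwards [(tendsto_order.1 (tendsto_mollSeq_rOut (d := d))).2 η hη] with n hn p hp
  rw [dist_comm]
  refine (ContDiffBump.dist_normed_convolution_le hg.aestronglyMeasurable (ε := ε / 2)
    fun q hq => ?_).trans_lt (half_lt_self hε)
  have := h (a := p) (b := q) (by rw [dist_comm]; exact (Metric.mem_ball.1 hq).trans hn) hp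
  rw [dist_comm]
  exact (show dist (g p) (g q) < ε / 2 from this).le

end Mollify

/-! ### Equations satisfied by the mollified strong solution -/

section StrongSolution

variable {d : ℕ} {Ω : SpatialDomain} {ε T : ℝ} {K : E d → E d} {f : ℝ → Phase d → ℝ}
  {gx gv : ℝ → Phase d → E d}

open scoped Convolution in
-- The weak gradient tested against q ↦ B(p − q): passing from the derivative of the kernel to that
-- of the test function changes the sign, which cancels the sign in the weak formulation.
theorem IsStrongSolution.dirD_mollify (hf : IsStrongSolution Ω ε T K f gx gv) (hT : 0 ≤ T)
    (B : ContDiffBump (0 : ℝ × Phase d)) {p : ℝ × Phase d}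
    (hp : p.1 ∈ Ioo B.rOut (T - B.rOut)) (h k : E d) :
    dirD (0, (h, k)) (mollify B (clampTime T f)) p =
      inner ℝ (mollify B (extend Ω T gx) p) h + inner ℝ (mollify B (extend Ω T gv) p) k := by
  have hψ := isInteriorBump_normed_sub B hp
  have h1 := hf.integral_mul_dirD hT hψ h k
  have hc := (hf.continuous_clampTime hT).locallyIntegrable (μ := volume)
  rw [mollify, dirD_convolution B.contDiff_normed B.hasCompactSupport_normed hc,
    convolution_lsmul_swap]
  simp only [fderiv_comp_const_sub p B.contDiff_normed] at h1
  have h2 : ∫ q, dirD (0, (h, k)) (B.normed volume) (p - q) • clampTime T f q =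
      ∫ q, (inner ℝ (extend Ω T gx q) h + inner ℝ (extend Ω T gv q) k) *
        B.normed volume (p - q) := by
    rw [← neg_inj, ← h1, ← integral_neg]
    refine integral_congr_ae (Filter.Eventually.of_forall fun q => ?_)
    simp only [smul_eq_mul]
    ring
  have i1 := integrable_normed_smul B hf.locallyIntegrable_extend_gx p
  have i2 := integrable_normed_smul B hf.locallyIntegrable_extend_gv p
  rw [h2, mollify_apply, mollify_apply, real_inner_comm, real_inner_comm k,
    ← integral_inner i1, ← integral_inner i2, ← integral_add (i1.const_inner _)
    (i2.const_inner _)]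
  refine integral_congr_ae (Filter.Eventually.of_forall fun q => ?_)
  simp only [inner_smul_right, real_inner_comm h, real_inner_comm k]
  ring

open scoped Convolution in
-- The transport term is mollified as a whole. It is not the transport of the mollified gradients,
-- because v and the force do not commute with convolution; the discrepancy disappears only in the
-- limit.
theorem IsStrongSolution.dirD_time_mollify (hf : IsStrongSolution Ω ε T K f gx gv)
    (hK : MemLp K ∞ (volume : Measure (E d))) (hT : 0 ≤ T)
    (B : ContDiffBump (0 : ℝ × Phase d)) {p : ℝ × Phase d}
    (hp : p.1 ∈ Ioo B.rOut (T - B.rOut)) :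
    dirD (1, 0) (mollify B (clampTime T f)) p =
      ε * ∑ i, dirD (vUnit i) (dirD (vUnit i) (mollify B (clampTime T f))) p -
        mollify B (extend Ω T (transport Ω K f gx gv)) p := by
  have hψ := isInteriorBump_normed_sub B hp
  have h1 := hf.integral_mul_dirD_time hK hT hψ
  have hc := (hf.continuous_clampTime hT).locallyIntegrable (μ := volume)
  have hB := B.contDiff_normed (μ := volume) (n := ⊤)
  have hBc := B.hasCompactSupport_normed (μ := volume)
  have h2 : ∀ e, dirD e (fun q => B.normed volume (p - q)) =
      fun q => -dirD e (B.normed volume) (p - q) := fun e =>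
    funext fun q => fderiv_comp_const_sub p hB e q
  have h3 : ∀ e q, dirD e (dirD e (fun q => B.normed volume (p - q))) q =
      dirD e (dirD e (B.normed volume)) (p - q) := by
    intro e q
    have h4 : ContDiff ℝ ∞ (fun q => -dirD e (B.normed volume) q) := (contDiff_dirD hB e).neg
    rw [h2, fderiv_comp_const_sub p (k := fun q => -dirD e (B.normed volume) q) h4 e q]
    have h5 : dirD e (fun q => -dirD e (B.normed volume) q) (p - q) =
        -dirD e (dirD e (B.normed volume)) (p - q) := by
      simp only [dirD]
      rw [fderiv_fun_neg]
      rfl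
    rw [h5, neg_neg]
  have h4 : ∀ e, dirD e (dirD e (mollify B (clampTime T f))) p =
      ∫ q, clampTime T f q * dirD e (dirD e (fun q => B.normed volume (p - q))) q := by
    intro e
    rw [mollify, dirD_convolution hB hBc hc, dirD_convolution (contDiff_dirD hB e)
      (hasCompactSupport_dirD hBc e) hc, convolution_lsmul_swap]
    refine integral_congr_ae (Filter.Eventually.of_forall fun q => ?_)
    simp only [h3, smul_eq_mul, mul_comm]
  have h5 : dirD (1, 0) (mollify B (clampTime T f)) p =
      -∫ q, clampTime T f q * dirD (1, 0) (fun q => B.normed volume (p - q)) q := by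
    rw [mollify, dirD_convolution hB hBc hc, convolution_lsmul_swap, ← integral_neg]
    refine integral_congr_ae (Filter.Eventually.of_forall fun q => ?_)
    simp only [h2, smul_eq_mul]
    ring
  have h6 : ∫ q, clampTime T f q * ∑ i, dirD (vUnit i) (dirD (vUnit i)
      (fun q => B.normed volume (p - q))) q =
      ∑ i, dirD (vUnit i) (dirD (vUnit i) (mollify B (clampTime T f))) p := by
    simp only [Finset.mul_sum, h4]
    rw [integral_finsetSum]
    intro i _
    exact integrable_bump_mul ((hψ.dirD _).dirD _) hc
  have h7 : ∫ q, extend Ω T (transport Ω K f gx gv) q * B.normed volume (p - q) =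
      mollify B (extend Ω T (transport Ω K f gx gv)) p := by
    rw [mollify_apply]
    refine integral_congr_ae (Filter.Eventually.of_forall fun q => ?_)
    simp only [smul_eq_mul, mul_comm]
  rw [h6, h7] at h1
  rw [h5]
  linarith

/-- A nonempty open set has positive measure, so a continuous function cannot violate an almost
everywhere bound inside U, nor on its closure. This carries the essential bound on f to every time,
including 0 and T. -/
theorem le_of_ae_le_of_isOpen {g : ℝ × Phase d → ℝ} (hg : Continuous g)
    {U : Set (ℝ × Phase d)} (hU : IsOpen U) {M : ℝ}
    (h : ∀ᵐ p, p ∈ U → g p ≤ M) : ∀ p ∈ closure U, g p ≤ M := by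
  have ho : IsOpen {p | p ∈ U ∧ M < g p} := hU.inter (isOpen_lt continuous_const hg)
  have h0 : volume {p | p ∈ U ∧ M < g p} = 0 := by
    rw [ae_iff] at h
    refine measure_mono_null (fun p hp => ?_) h
    simp only [mem_ofPred_eq, Classical.not_imp, not_le]
    exact hp
  have he := (ho.measure_eq_zero_iff volume).1 h0
  refine closure_minimal (fun p hp => ?_) (isClosed_le hg continuous_const)
  by_contra hlt
  have : p ∈ {p | p ∈ U ∧ M < g p} := ⟨hp, not_le.1 hlt⟩
  rw [he] at this
  exact this

theorem IsStrongSolution.clampTime_le (hf : IsStrongSolution Ω ε T K f gx gv) (hT : 0 < T)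
    {M : ℝ} (h : ∀ᵐ p ∂(timePhaseMeasure Ω d T), ‖f p.1 p.2‖ ≤ M) (p : ℝ × Phase d) :
    clampTime T f p ≤ M := by
  have h1 := ae_extend (P := fun t z => ‖f t z‖ ≤ M) h
  have h2 : ∀ᵐ p : ℝ × Phase d, p ∈ (Ioo 0 T ×ˢ univ : Set (ℝ × Phase d)) →
      clampTime T f p ≤ M := by
    filter_upwards [h1] with p hp hpU
    rw [← hf.extend_eq hpU.1, show p = (p.1, p.2) from rfl, extend_of_mem hpU.1]
    exact (le_abs_self _).trans (hp hpU.1)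
  have h3 := le_of_ae_le_of_isOpen (hf.continuous_clampTime hT.le) (isOpen_Ioo.prod isOpen_univ) h2
    (max 0 (min p.1 T), p.2) (by
      rw [closure_prod_eq, closure_Ioo hT.ne, closure_univ]
      exact ⟨clamp_mem hT.le _, mem_univ _⟩)
  rwa [clampTime_of_mem (clamp_mem hT.le _)] at h3

end StrongSolution


/-! ### Weak solutions tested against smooth functions -/

section WeakSolution

variable {d : ℕ} {Ω : SpatialDomain} {ε T : ℝ} {K : E d → E d} {u : ℝ → Phase d → ℝ}
  {g : ℝ → Phase d → E d}

theorem IsWeakSolution.integrable (hu : IsWeakSolution Ω ε T K u) :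
    Integrable (fun p : ℝ × Phase d => u p.1 p.2) (timePhaseMeasure Ω d T) := by
  rw [timePhaseMeasure, integrable_prod_iff hu.measurable]
  refine ⟨?_, ?_⟩
  · filter_upwards [ae_restrict_mem measurableSet_Icc] with t ht
    exact (hu.probDensity t ht).integrable
  · refine (integrable_const (1 : ℝ)).congr ?_
    filter_upwards [ae_restrict_mem measurableSet_Icc] with t ht
    exact (hu.probDensity t ht).integral_abs.symm

theorem IsWeakSolution.aestronglyMeasurable_force (hu : IsWeakSolution Ω ε T K u)
    (hK : MemLp K ∞ (volume : Measure (E d))) :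
    AEStronglyMeasurable (fun p : ℝ × Phase d => force Ω K (u p.1) p.2.1)
      (timePhaseMeasure Ω d T) :=
  Vlasov.aestronglyMeasurable_force hK hu.measurable fun t ht => (hu.probDensity t ht).integrable

theorem ae_timePhaseMeasure_mem :
    ∀ᵐ p ∂(timePhaseMeasure Ω d T), p.1 ∈ Icc 0 T ∧ p.2.1 ∈ cell Ω d := by
  filter_upwards [Measure.quasiMeasurePreserving_fst.ae
    (ae_restrict_mem (measurableSet_Icc (a := (0 : ℝ)) (b := T))),
    Measure.quasiMeasurePreserving_snd.ae (ae_mem_cell (Ω := Ω) (d := d))] with p h1 h2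
    using ⟨h1, h2⟩

theorem IsWeakSolution.integrable_mul (hu : IsWeakSolution Ω ε T K u) {Q : ℝ × Phase d → ℝ}
    (hQ : AEStronglyMeasurable Q (timePhaseMeasure Ω d T)) {C : ℝ}
    (hC : ∀ t ∈ Icc 0 T, ∀ z : Phase d, z.1 ∈ cell Ω d → |Q (t, z)| ≤ C) :
    Integrable (fun p : ℝ × Phase d => u p.1 p.2 * Q p) (timePhaseMeasure Ω d T) := by
  refine Integrable.mul_bdd (c := C) hu.integrable hQ ?_
  filter_upwards [ae_timePhaseMeasure_mem] with p hp
  exact hC p.1 hp.1 p.2 hp.2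

theorem intervalIntegrable_of_integrable {h : ℝ × Phase d → ℝ}
    (hh : Integrable h (timePhaseMeasure Ω d T)) {a b : ℝ} (ha : a ∈ Icc 0 T) (hb : b ∈ Icc 0 T) :
    IntervalIntegrable (fun s => ∫ z, h (s, z) ∂(phaseMeasure Ω d)) volume a b := by
  have h1 : IntegrableOn (fun s => ∫ z, h (s, z) ∂(phaseMeasure Ω d)) (Icc 0 T) :=
    hh.integral_prod_left
  rw [intervalIntegrable_iff]
  exact h1.mono_set (uIoc_subset_uIcc.trans (uIcc_subset_Icc ha hb))

theorem IsTest.fderiv_support {φ : ℝ × Phase d → ℝ} (h : IsTest Ω φ) :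
    ∃ R : ℝ, ∀ (t : ℝ) (x v : E d), (R < ‖v‖ ∨ (Ω = .wholeSpace ∧ R < ‖x‖)) →
      fderiv ℝ φ (t, (x, v)) = 0 := by
  obtain ⟨R, hR⟩ := h.support
  refine ⟨R, fun t x v hxv => ?_⟩
  have : φ =ᶠ[nhds (t, (x, v))] fun _ => 0 := by
    rcases hxv with hv | ⟨hΩ, hx⟩
    · have ho : IsOpen {p : ℝ × Phase d | R < ‖p.2.2‖} :=
        isOpen_lt continuous_const (by fun_prop)
      filter_upwards [ho.mem_nhds hv] with p hp using hR p.1 p.2.1 p.2.2 (Or.inl hp)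
    · have ho : IsOpen {p : ℝ × Phase d | R < ‖p.2.1‖} :=
        isOpen_lt continuous_const (by fun_prop)
      filter_upwards [ho.mem_nhds hx] with p hp using hR p.1 p.2.1 p.2.2 (Or.inr ⟨hΩ, hp⟩)
  rw [this.fderiv_eq]
  simp

/-- The integrand of the weak formulation. -/
noncomputable def weakOperator (Ω : SpatialDomain) (ε : ℝ) (K : E d → E d)
    (u : ℝ → Phase d → ℝ) (φ : ℝ × Phase d → ℝ) (p : ℝ × Phase d) : ℝ :=
  fderiv ℝ φ p (1, (p.2.2, force Ω K (u p.1) p.2.1)) + ε * laplacianV φ p.1 p.2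

theorem IsWeakSolution.aestronglyMeasurable_fderiv_apply (hu : IsWeakSolution Ω ε T K u)
    (hK : MemLp K ∞ (volume : Measure (E d))) {φ : ℝ × Phase d → ℝ} (hφ : ContDiff ℝ ∞ φ) (c : ℝ) :
    AEStronglyMeasurable (fun p : ℝ × Phase d =>
      fderiv ℝ φ p (c, (p.2.2, force Ω K (u p.1) p.2.1))) (timePhaseMeasure Ω d T) := by
  have h1 : AEStronglyMeasurable (fun p : ℝ × Phase d =>
      (fderiv ℝ φ p, ((c, (p.2.2, force Ω K (u p.1) p.2.1)) : ℝ × Phase d)))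
      (timePhaseMeasure Ω d T) := by
    refine AEStronglyMeasurable.prodMk ?_ (aestronglyMeasurable_const.prodMk
      (AEStronglyMeasurable.prodMk (by fun_prop) (hu.aestronglyMeasurable_force hK)))
    exact (hφ.continuous_fderiv (by simp)).aestronglyMeasurable
  exact isBoundedBilinearMap_apply.continuous.comp_aestronglyMeasurable h1

theorem continuous_laplacianV {φ : ℝ × Phase d → ℝ} (hφ : ContDiff ℝ ∞ φ) :
    Continuous (fun p : ℝ × Phase d => laplacianV φ p.1 p.2) := by
  simp only [laplacianV_eq_sum hφ]
  exact continuous_finsetSum _ fun i _ =>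
    (contDiff_dirD (contDiff_dirD hφ _) _).continuous

theorem IsTest.exists_bound_laplacianV {φ : ℝ × Phase d → ℝ} (h : IsTest Ω φ) (T : ℝ) :
    ∃ C : ℝ, 0 ≤ C ∧ ∀ t ∈ Icc 0 T, ∀ z : Phase d, z.1 ∈ cell Ω d → |laplacianV φ t z| ≤ C := by
  choose C hC0 hC using fun i : Fin d => ((h.dirD (vUnit i)).dirD (vUnit i)).exists_bound T
  refine ⟨∑ i, C i, Finset.sum_nonneg fun i _ => hC0 i, fun t ht z hz => ?_⟩
  rw [laplacianV_eq_sum h.smooth]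
  exact (Finset.abs_sum_le_sum_abs _ _).trans (Finset.sum_le_sum fun i _ => hC i t ht z hz)

/-- On the support of the test function v is bounded, and the force is bounded by `supNorm K`; hence
the operator is bounded while `u` is integrable. -/
theorem IsWeakSolution.integrable_weakOperator (hu : IsWeakSolution Ω ε T K u)
    (hK : MemLp K ∞ (volume : Measure (E d))) {φ : ℝ × Phase d → ℝ} (hφ : IsTest Ω φ) :
    Integrable (fun p : ℝ × Phase d => u p.1 p.2 * weakOperator Ω ε K u φ p)
      (timePhaseMeasure Ω d T) := by
  obtain ⟨R, hR0, hR⟩ := exists_compact_of_support hφ.fderiv_support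
  obtain ⟨C, hC0, hC⟩ := exists_bound_of_support (hφ.smooth.continuous_fderiv (by simp))
    hφ.fderiv_support T
  obtain ⟨C', hC0', hC'⟩ := hφ.exists_bound_laplacianV T
  refine hu.integrable_mul (C := C * (1 + R + supNorm K) + |ε| * C')
    ((hu.aestronglyMeasurable_fderiv_apply hK hφ.smooth 1).add
      ((continuous_laplacianV hφ.smooth).aestronglyMeasurable.const_mul ε)) fun t ht z hz => ?_
  refine (abs_add_le _ _).trans (add_le_add ?_ ?_)
  · by_cases h : R < ‖z.1‖ ∨ R < ‖z.2‖
    · rw [hR t z hz h]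
      simp only [zero_apply, abs_zero]
      have := supNorm_nonneg (K := K)
      positivity
    · push Not at h
      refine (ContinuousLinearMap.le_opNorm _ _).trans (mul_le_mul (hC t ht z hz) ?_
        (norm_nonneg _) hC0)
      have h1 := (hu.probDensity t ht).norm_force_le hK z.1
      have h2 := norm_nonneg (force Ω K (u t) z.1)
      simp only [Prod.norm_def, norm_one]
      refine max_le (by linarith) (max_le (by linarith [h.2]) (by linarith))
  · rw [abs_mul]
    exact mul_le_mul_of_nonneg_left (hC' t ht z hz) (abs_nonneg _)

theorem IsWeakSolution.integral_sub_eq (hu : IsWeakSolution Ω ε T K u)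
    (hK : MemLp K ∞ (volume : Measure (E d))) {φ : ℝ × Phase d → ℝ} (hφ : IsTest Ω φ)
    {a b : ℝ} (ha : a ∈ Icc 0 T) (hb : b ∈ Icc 0 T) :
    ∫ z, u b z * φ (b, z) ∂(phaseMeasure Ω d) - ∫ z, u a z * φ (a, z) ∂(phaseMeasure Ω d) =
      ∫ s in a..b, ∫ z, u s z * weakOperator Ω ε K u φ (s, z) ∂(phaseMeasure Ω d) := by
  have h1 := hu.equation φ hφ.isTestFunction a ha
  have h2 := hu.equation φ hφ.isTestFunction b hb
  have h0 : (0 : ℝ) ∈ Icc 0 T := ⟨le_rfl, ha.1.trans ha.2⟩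
  have hi := hu.integrable_weakOperator hK hφ
  rw [h1, h2, ← intervalIntegral.integral_interval_sub_left
    (intervalIntegrable_of_integrable hi h0 hb) (intervalIntegrable_of_integrable hi h0 ha)]
  simp only [weakOperator]
  ring

theorem IsWeakSolution.continuousOn_integral (hu : IsWeakSolution Ω ε T K u)
    (hK : MemLp K ∞ (volume : Measure (E d))) {φ : ℝ × Phase d → ℝ} (hφ : IsTest Ω φ) :
    ContinuousOn (fun t => ∫ z, u t z * φ (t, z) ∂(phaseMeasure Ω d)) (Icc 0 T) := by
  rcases lt_or_ge T 0 with hT | hT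
  · rw [Icc_eq_empty (not_le.2 hT)]; exact continuousOn_empty _
  have h0 : (0 : ℝ) ∈ Icc 0 T := ⟨le_rfl, hT⟩
  have hi := (hu.integrable_weakOperator hK hφ).integral_prod_left
  have hc := intervalIntegral.continuousOn_primitive_interval' (μ := volume)
    (intervalIntegrable_of_integrable (hu.integrable_weakOperator hK hφ) h0 ⟨hT, le_rfl⟩)
    (left_mem_uIcc)
  rw [uIcc_of_le hT] at hc
  have hc2 := hc.const_add (∫ z, u 0 z * φ (0, z) ∂(phaseMeasure Ω d))
  refine hc2.congr fun t ht => ?_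
  have := hu.integral_sub_eq hK hφ h0 ht
  simp only
  linarith

/-- The function φ need not vanish near the times 0 and T, so it is multiplied by a bump in time
which equals 1 on [a, b] and is supported in a slightly larger interval inside (0, T). -/
theorem integrableOn_smul_of_isLocInt {F : Type*} [NormedAddCommGroup F] [NormedSpace ℝ F]
    {g : ℝ → Phase d → F} (hg : IsLocInt Ω T g) {φ : ℝ × Phase d → ℝ} (hφ : IsTest Ω φ)
    {a b : ℝ} (ha : 0 < a) (hb : b < T) :
    Integrable (fun p : ℝ × Phase d => φ p • g p.1 p.2)
      (((volume : Measure ℝ).restrict (Icc a b)).prod (phaseMeasure Ω d)) := by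
  obtain ⟨a', ha'0, ha'⟩ := exists_between ha
  obtain ⟨b', hbb', hb'⟩ := exists_between hb
  obtain ⟨R, -, hR⟩ := exists_compact_of_support hφ.support
  let c : ℝ := (a + b) / 2
  rcases lt_or_ge b a with hab | hab
  · rw [Icc_eq_empty (not_le.2 hab)]; simp
  let θ : ContDiffBump c := ⟨(b - a) / 2 + min (a - a') (b' - b) / 2,
    (b - a) / 2 + min (a - a') (b' - b), by
      have : 0 < min (a - a') (b' - b) := lt_min (by linarith) (by linarith)
      linarith, by
      have : 0 < min (a - a') (b' - b) := lt_min (by linarith) (by linarith)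
      linarith⟩
  have hmin : 0 < min (a - a') (b' - b) := lt_min (by linarith) (by linarith)
  have hθ1 : ∀ t ∈ Icc a b, θ t = 1 := by
    intro t ht
    refine θ.one_of_mem_closedBall ?_
    rw [Metric.mem_closedBall, Real.dist_eq, abs_le]
    simp only [θ, c]
    constructor <;> linarith [ht.1, ht.2]
  have hθ0 : ∀ t, t ∉ Icc a' b' → θ t = 0 := by
    intro t ht
    refine θ.zero_of_le_dist ?_
    by_contra! h
    rw [Real.dist_eq] at h
    have h1 := abs_lt.1 h
    simp only [θ, c] at h1
    have := min_le_left (a - a') (b' - b)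
    have := min_le_right (a - a') (b' - b)
    exact ht ⟨by linarith [h1.1], by linarith [h1.2]⟩
  have h1 := integrable_smul_of_isLocInt hg (R := R) (φ := fun p => θ p.1 * φ p)
    ((θ.continuous.comp continuous_fst).mul hφ.smooth.continuous) ha'0 hb'
    (fun t z hz h => by simp only [hR t z hz h, mul_zero])
    (fun t z ht => by simp only [hθ0 t ht, zero_mul])
  have h2 : Integrable (fun p : ℝ × Phase d => (θ p.1 * φ p) • g p.1 p.2)
      (((volume : Measure ℝ).restrict (Icc a b)).prod (phaseMeasure Ω d)) := by
    have := h1.restrict (s := Icc a b ×ˢ univ)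
    rwa [← Measure.prod_restrict, Measure.restrict_univ] at this
  refine h2.congr ?_
  filter_upwards [Measure.quasiMeasurePreserving_fst.ae
    (ae_restrict_mem (measurableSet_Icc (a := a) (b := b)))] with p hp
  rw [hθ1 _ hp, one_mul]

theorem dirD_time_mul {θ : ℝ → ℝ} (hθ : ContDiff ℝ ∞ θ) {φ : ℝ × Phase d → ℝ}
    (hφ : ContDiff ℝ ∞ φ) (e : Phase d) (p : ℝ × Phase d) :
    fderiv ℝ (fun p : ℝ × Phase d => θ p.1 * φ p) p (0, e) = θ p.1 * fderiv ℝ φ p (0, e) := by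
  have h1 : HasFDerivAt (fun p : ℝ × Phase d => θ p.1)
      ((fderiv ℝ θ p.1).comp (ContinuousLinearMap.fst ℝ ℝ (Phase d))) p :=
    (hθ.differentiable_infty p.1).hasFDerivAt.comp p hasFDerivAt_fst
  have h2 : fderiv ℝ (fun p : ℝ × Phase d => θ p.1 * φ p) p = _ :=
    (h1.mul (hφ.differentiable_infty p).hasFDerivAt).fderiv
  rw [h2]
  simp

/-- The weak velocity gradient at almost every fixed time. -/
theorem IsWeakSolution.ae_integral_mul_dirD (hu : IsWeakSolution Ω ε T K u)
    (hg : IsWeakGradientV Ω T u g) {φ : ℝ × Phase d → ℝ} (hφ : IsTest Ω φ) (k : E d) :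
    ∀ᵐ s, s ∈ Ioo 0 T → ∫ z, u s z * dirD (0, (0, k)) φ (s, z) ∂(phaseMeasure Ω d) +
      ∫ z, φ (s, z) * inner ℝ (g s z) k ∂(phaseMeasure Ω d) = 0 := by
  obtain ⟨C, hC0, hC⟩ := (hφ.dirD (0, (0, k))).exists_bound T
  have hi1 := hu.integrable_mul (hφ.dirD (0, (0, k))).smooth.continuous.aestronglyMeasurable hC
  have hI1 : IntegrableOn (fun s => ∫ z, u s z * dirD (0, (0, k)) φ (s, z) ∂(phaseMeasure Ω d))
      (Icc 0 T) := hi1.integral_prod_left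
  have hI2 : ∀ a b : ℝ, 0 < a → b < T → IntegrableOn
      (fun s => ∫ z, φ (s, z) * inner ℝ (g s z) k ∂(phaseMeasure Ω d)) (Icc a b) := by
    intro a b ha hb
    have h1 := ((integrableOn_smul_of_isLocInt hg.1 hφ ha hb).inner_const (𝕜 := ℝ) k).integral_prod_left
    simp only [inner_smul_left, RCLike.conj_to_real] at h1
    exact h1
  -- Localization in time: testing the space-time gradient with θ(t)φ for all θ supported in (0, T)
  -- and applying the fundamental lemma of the calculus of variations.
  refine isOpen_Ioo.ae_eq_zero_of_integral_contDiff_smul_eq_zero ?_ ?_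
  · rw [locallyIntegrableOn_iff isOpen_Ioo.isLocallyClosed]
    intro S hS hSc
    rcases S.eq_empty_or_nonempty with rfl | hne
    · exact integrableOn_empty
    obtain ⟨a, ha, ha'⟩ := hSc.exists_isLeast hne
    obtain ⟨b, hb, hb'⟩ := hSc.exists_isGreatest hne
    have hsub : S ⊆ Icc a b := fun s hs => ⟨ha' hs, hb' hs⟩
    exact (hI1.mono_set (hS.trans Ioo_subset_Icc_self)).add
      ((hI2 a b (hS ha).1 (hS hb).2).mono_set hsub)
  · intro θ hθ hθc hθs
    rcases (tsupport θ).eq_empty_or_nonempty with he | hne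
    · have : θ = 0 := tsupport_eq_empty_iff.1 he
      simp [this]
    obtain ⟨a, ha, ha'⟩ := hθc.isCompact.exists_isLeast hne
    obtain ⟨b, hb, hb'⟩ := hθc.isCompact.exists_isGreatest hne
    have ha0 := (hθs ha).1
    have hbT := (hθs hb).2
    have hab : a ≤ b := ha' hb
    have hθ0 : ∀ t, t ∉ Icc a b → θ t = 0 := by
      intro t ht
      by_contra h
      exact ht ⟨ha' (subset_tsupport _ h), hb' (subset_tsupport _ h)⟩
    have hT : (0 : ℝ) ≤ T := by linarith
    have htest : IsInteriorTestFunction Ω T (fun p : ℝ × Phase d => θ p.1 * φ p) := by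
      obtain ⟨R, hR⟩ := hφ.isTestFunction.compact_support
      refine ⟨⟨(hθ.comp contDiff_fst).mul hφ.smooth, fun t v hΩ i x => ?_,
        R, fun t x v hx hxv => ?_⟩, a, b, ha0, hbT, fun t z ht => ?_⟩
      · have := hφ.periodic.isPeriodic t v hΩ i x
        simp only at this ⊢
        rw [this]
      · simp only [hR t x v hx hxv, mul_zero]
      · simp only [hθ0 t ht, zero_mul]
    have h1 := hg.2 _ htest k
    simp only [dirD_time_mul hθ hφ.smooth] at h1
    have e1 : ∀ t, ∫ z, u t z * (θ t * fderiv ℝ φ (t, z) (0, (0, k))) ∂(phaseMeasure Ω d) =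
        θ t * ∫ z, u t z * dirD (0, (0, k)) φ (t, z) ∂(phaseMeasure Ω d) := by
      intro t
      rw [← integral_const_mul]
      exact integral_congr_ae (Filter.Eventually.of_forall fun z => by simp only [dirD]; ring)
    have e2 : ∀ t, ∫ z, θ t * φ (t, z) * inner ℝ (g t z) k ∂(phaseMeasure Ω d) =
        θ t * ∫ z, φ (t, z) * inner ℝ (g t z) k ∂(phaseMeasure Ω d) := by
      intro t
      rw [← integral_const_mul]
      exact integral_congr_ae (Filter.Eventually.of_forall fun z => by ring)
    simp only [e1, e2] at h1
    have r : ∀ G : ℝ → ℝ, ∫ t in (0 : ℝ)..T, θ t * G t = ∫ t in Icc a b, θ t * G t := by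
      intro G
      rw [intervalIntegral.integral_of_le hT, integral_Ioc_eq_integral_Ioo]
      refine setIntegral_eq_of_subset_of_forall_sdiff_eq_zero measurableSet_Ioo
        (fun t ht => ⟨ha0.trans_le ht.1, ht.2.trans_lt hbT⟩) fun t ht => ?_
      rw [hθ0 t ht.2, zero_mul]
    rw [r, r] at h1
    have r2 : ∫ t, θ t • (∫ z, u t z * dirD (0, (0, k)) φ (t, z) ∂(phaseMeasure Ω d) +
        ∫ z, φ (t, z) * inner ℝ (g t z) k ∂(phaseMeasure Ω d)) =
        ∫ t in Icc a b, θ t • (∫ z, u t z * dirD (0, (0, k)) φ (t, z) ∂(phaseMeasure Ω d) +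
        ∫ z, φ (t, z) * inner ℝ (g t z) k ∂(phaseMeasure Ω d)) :=
      (setIntegral_eq_integral_of_forall_compl_eq_zero fun t ht => by
        rw [hθ0 t ht, zero_smul]).symm
    rw [r2]
    simp only [smul_eq_mul, mul_add]
    rw [integral_add, h1, neg_add_cancel]
    · exact (hI1.mono_set (Icc_subset_Icc ha0.le hbT.le)).continuousOn_mul
        hθ.continuous.continuousOn isCompact_Icc
    · exact (hI2 a b ha0 hbT).continuousOn_mul hθ.continuous.continuousOn isCompact_Icc

end WeakSolution


/-! ### The regularized entropy inequality -/

section ProductRules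

variable {d : ℕ}

theorem dirD_mul {a b : ℝ × Phase d → ℝ} (ha : ContDiff ℝ ∞ a) (hb : ContDiff ℝ ∞ b)
    (e p : ℝ × Phase d) :
    dirD e (fun p => a p * b p) p = a p * dirD e b p + b p * dirD e a p := by
  have h : fderiv ℝ (fun p => a p * b p) p = _ :=
    ((ha.differentiable_infty p).hasFDerivAt.mul (hb.differentiable_infty p).hasFDerivAt).fderiv
  rw [dirD, h]
  simp [dirD]

theorem dirD_add {a b : ℝ × Phase d → ℝ} (ha : ContDiff ℝ ∞ a) (hb : ContDiff ℝ ∞ b)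
    (e p : ℝ × Phase d) :
    dirD e (fun p => a p + b p) p = dirD e a p + dirD e b p := by
  have h : fderiv ℝ (fun p => a p + b p) p = _ :=
    ((ha.differentiable_infty p).hasFDerivAt.add (hb.differentiable_infty p).hasFDerivAt).fderiv
  rw [dirD, h]
  simp [dirD]

variable {F : ℝ × Phase d → ℝ} {δ : ℝ}

theorem contDiff_log_add (hF : ContDiff ℝ ∞ F) (hF0 : ∀ p, 0 ≤ F p) (hδ : 0 < δ) :
    ContDiff ℝ ∞ (fun p => Real.log (F p + δ)) :=
  (hF.add contDiff_const).log fun p => by have := hF0 p; positivity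

theorem dirD_log_add (hF : ContDiff ℝ ∞ F) (hF0 : ∀ p, 0 ≤ F p) (hδ : 0 < δ)
    (e p : ℝ × Phase d) :
    dirD e (fun p => Real.log (F p + δ)) p = dirD e F p / (F p + δ) := by
  have hne : F p + δ ≠ 0 := by have := hF0 p; positivity
  have h : fderiv ℝ (fun p => Real.log (F p + δ)) p = _ :=
    (((hF.differentiable_infty p).hasFDerivAt.add_const δ).log hne).fderiv
  rw [dirD, h]
  simp [dirD]
  ring

/-- Differentiate (F + δ) ∂log(F + δ) = ∂F once more. -/
theorem dirD_dirD_log_add (hF : ContDiff ℝ ∞ F) (hF0 : ∀ p, 0 ≤ F p) (hδ : 0 < δ)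
    (e p : ℝ × Phase d) :
    dirD e (dirD e (fun p => Real.log (F p + δ))) p =
      dirD e (dirD e F) p / (F p + δ) - (dirD e F p / (F p + δ)) ^ 2 := by
  have hne : F p + δ ≠ 0 := by have := hF0 p; positivity
  have hl := contDiff_dirD (contDiff_log_add hF hF0 hδ) e
  have h1 : (fun p => (F p + δ) * dirD e (fun p => Real.log (F p + δ)) p) = dirD e F := by
    funext q
    have : F q + δ ≠ 0 := by have := hF0 q; positivity
    rw [dirD_log_add hF hF0 hδ]
    field_simp
  have h2 := dirD_mul (a := fun p => F p + δ) (hF.add contDiff_const) hl e p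
  rw [h1] at h2
  have h3 : dirD e (fun p => F p + δ) p = dirD e F p := by
    rw [dirD_add hF contDiff_const]; simp [dirD]
  rw [h3] at h2
  rw [h2, dirD_log_add hF hF0 hδ]
  field_simp
  ring

/-- The arrangement prepares two later steps: the term with the second derivative of F cancels the
diffusion in the equation of F, and the total derivative of χ ∂log(F + δ) is ready for integration
by parts against u. -/
theorem dirD_dirD_mul_log (hF : ContDiff ℝ ∞ F) (hF0 : ∀ p, 0 ≤ F p) (hδ : 0 < δ)
    {χ : ℝ × Phase d → ℝ} (hχ : ContDiff ℝ ∞ χ) (e p : ℝ × Phase d) :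
    dirD e (dirD e (fun p => χ p * Real.log (F p + δ))) p =
      2 * dirD e (fun p => χ p * dirD e (fun p => Real.log (F p + δ)) p) p
        - χ p / (F p + δ) * dirD e (dirD e F) p + χ p * (dirD e F p / (F p + δ)) ^ 2
        + Real.log (F p + δ) * dirD e (dirD e χ) p := by
  have hl := contDiff_log_add hF hF0 hδ
  have h1 : dirD e (fun p => χ p * Real.log (F p + δ)) =
      fun p => χ p * dirD e (fun p => Real.log (F p + δ)) p +
        Real.log (F p + δ) * dirD e χ p := funext fun q => dirD_mul hχ hl e q
  rw [h1, dirD_add (hχ.mul (contDiff_dirD hl e)) (hl.mul (contDiff_dirD hχ e)),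
    dirD_mul hχ (contDiff_dirD hl e), dirD_mul hl (contDiff_dirD hχ e),
    dirD_dirD_log_add hF hF0 hδ, dirD_log_add hF hF0 hδ]
  ring

end ProductRules

/-! ### Testing with χ log(F + δ) -/

section Cutoff

variable {d : ℕ} {Ω : SpatialDomain} {ε T : ℝ} {K : E d → E d} {u : ℝ → Phase d → ℝ}
  {f : ℝ → Phase d → ℝ} {gx gv : ℝ → Phase d → E d} {g : ℝ → Phase d → E d}

/-- Time-independent cut-off functions whose transport and diffusion errors are at most `C`. -/
structure IsCutoff (Ω : SpatialDomain) (C : ℝ) (χ : ℝ × Phase d → ℝ) : Prop extends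
    IsTest Ω χ where
  time_indep : ∀ t z, χ (t, z) = χ (0, z)
  nonneg : ∀ p, 0 ≤ χ p
  le_one : ∀ p, χ p ≤ 1
  bound_fderiv : ∀ (p : ℝ × Phase d) (y : E d),
    |fderiv ℝ χ p (0, (p.2.2, y))| ≤ C * (1 + ‖y‖)
  bound_laplacian : ∀ p, |∑ i, dirD (vUnit i) (dirD (vUnit i) χ) p| ≤ C

theorem IsCutoff.dirD_time {C : ℝ} {χ : ℝ × Phase d → ℝ} (hχ : IsCutoff Ω C χ)
    (p : ℝ × Phase d) : dirD (1, 0) χ p = 0 := by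
  have h1 : χ = fun p : ℝ × Phase d => (fun z => χ (0, z)) p.2 :=
    funext fun p => hχ.time_indep p.1 p.2
  have h2 : DifferentiableAt ℝ (fun z => χ (0, z)) p.2 :=
    (hχ.smooth.comp (contDiff_const.prodMk contDiff_id)).differentiable_infty p.2
  have h3 : fderiv ℝ (fun p : ℝ × Phase d => (fun z => χ (0, z)) p.2) p = _ :=
    (h2.hasFDerivAt.comp p hasFDerivAt_snd).fderiv
  rw [dirD, h1, h3]
  simp

/-- The first order terms in the evolution of `∫ u χ log (F + δ)`. -/
noncomputable def drift (Ω : SpatialDomain) (ε δ : ℝ) (K : E d → E d) (u : ℝ → Phase d → ℝ)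
    (χ F : ℝ × Phase d → ℝ) (GX GV : ℝ × Phase d → E d) (G : ℝ × Phase d → ℝ)
    (p : ℝ × Phase d) : ℝ :=
  χ p / (F p + δ) * (inner ℝ p.2.2 (GX p) + inner ℝ (force Ω K (u p.1) p.2.1) (GV p) - G p) +
    Real.log (F p + δ) * (fderiv ℝ χ p (0, (p.2.2, force Ω K (u p.1) p.2.1)) +
      ε * ∑ i, dirD (vUnit i) (dirD (vUnit i) χ) p)

theorem abs_log_le {δ M x : ℝ} (hδ : 0 < δ) (hx : 0 ≤ x) (hxM : x ≤ M) :
    |Real.log (x + δ)| ≤ |Real.log δ| + |Real.log (M + δ)| := by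
  have h1 : Real.log δ ≤ Real.log (x + δ) := Real.log_le_log hδ (by linarith)
  have h2 : Real.log (x + δ) ≤ Real.log (M + δ) := Real.log_le_log (by linarith) (by linarith)
  rw [abs_le]
  constructor
  · have := neg_abs_le (Real.log δ); have := abs_nonneg (Real.log (M + δ)); linarith
  · have := le_abs_self (Real.log (M + δ)); have := abs_nonneg (Real.log δ); linarith

/-- The bound depends on F and the fields only through M, so it dominates the drifts of all
mollifications. The summand 1 in the assumption on G allows for a mollification radius of at most 1.
-/
theorem abs_drift_le {δ : ℝ} (hδ : 0 < δ) (hε : 0 ≤ ε) {C : ℝ} {χ : ℝ × Phase d → ℝ}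
    (hχ : IsCutoff Ω C χ) {R : ℝ} (hR0 : 0 ≤ R)
    (hR : ∀ (t : ℝ) (z : Phase d), z.1 ∈ cell Ω d → (R < ‖z.1‖ ∨ R < ‖z.2‖) → χ (t, z) = 0)
    {F : ℝ × Phase d → ℝ} {GX GV : ℝ × Phase d → E d} {G : ℝ × Phase d → ℝ} {M κ : ℝ} (hM : 0 ≤ M)
    {p : ℝ × Phase d} (hp : p.2.1 ∈ cell Ω d) (hF0 : 0 ≤ F p) (hFM : F p ≤ M)
    (hGX : ‖GX p‖ ≤ M) (hGV : ‖GV p‖ ≤ M) (hG : |G p| ≤ (‖p.2.2‖ + 1 + κ) * M) (hκ0 : 0 ≤ κ)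
    (hκ : ‖force Ω K (u p.1) p.2.1‖ ≤ κ) :
    |drift Ω ε δ K u χ F GX GV G p| ≤ 1 / δ * ((2 * R + 2 * κ + 1) * M) +
      (|Real.log δ| + |Real.log (M + δ)|) * (C * (1 + κ) + ε * C) := by
  have hC : 0 ≤ C := (abs_nonneg _).trans (hχ.bound_laplacian p)
  refine (abs_add_le _ _).trans (add_le_add ?_ ?_)
  · rw [abs_mul]
    by_cases h : R < ‖p.2.1‖ ∨ R < ‖p.2.2‖
    · rw [show χ p = 0 from hR p.1 p.2 hp h]
      simp only [zero_div, abs_zero, zero_mul]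
      positivity
    · push Not at h
      refine mul_le_mul ?_ ?_ (abs_nonneg _) (by positivity)
      · rw [abs_of_nonneg (div_nonneg (hχ.nonneg p) (by linarith))]
        exact div_le_div₀ zero_le_one (hχ.le_one p) hδ (by linarith)
      · have h1 : |inner ℝ p.2.2 (GX p)| ≤ R * M :=
          (abs_real_inner_le_norm _ _).trans (mul_le_mul h.2 hGX (norm_nonneg _) hR0)
        have h2 : |inner ℝ (force Ω K (u p.1) p.2.1) (GV p)| ≤ κ * M :=
          (abs_real_inner_le_norm _ _).trans (mul_le_mul hκ hGV (norm_nonneg _) hκ0)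
        have h3 : |G p| ≤ (R + 1 + κ) * M :=
          hG.trans (mul_le_mul_of_nonneg_right (by linarith [h.2]) hM)
        rw [abs_le] at h1 h2 h3 ⊢
        constructor <;> linarith
  · rw [abs_mul]
    refine mul_le_mul (abs_log_le hδ hF0 hFM) ?_ (abs_nonneg _) (by positivity)
    refine (abs_add_le _ _).trans (add_le_add ?_ ?_)
    · exact (hχ.bound_fderiv p _).trans (mul_le_mul_of_nonneg_left (by linarith) hC)
    · rw [abs_mul, abs_of_nonneg hε]
      exact mul_le_mul_of_nonneg_left (hχ.bound_laplacian p) hε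

theorem IsWeakSolution.aestronglyMeasurable_drift (hu : IsWeakSolution Ω ε T K u)
    (hK : MemLp K ∞ (volume : Measure (E d))) {δ C : ℝ}
    {χ : ℝ × Phase d → ℝ} (hχ : IsCutoff Ω C χ)
    {F : ℝ × Phase d → ℝ} {GX GV : ℝ × Phase d → E d} {G : ℝ × Phase d → ℝ}
    (hF : AEStronglyMeasurable F (timePhaseMeasure Ω d T))
    (hGX : AEStronglyMeasurable GX (timePhaseMeasure Ω d T))
    (hGV : AEStronglyMeasurable GV (timePhaseMeasure Ω d T))
    (hG : AEStronglyMeasurable G (timePhaseMeasure Ω d T)) :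
    AEStronglyMeasurable (drift Ω ε δ K u χ F GX GV G) (timePhaseMeasure Ω d T) := by
  have hFδ : AEMeasurable (fun p => F p + δ) (timePhaseMeasure Ω d T) :=
    hF.aemeasurable.add_const δ
  have hχm : AEMeasurable χ (timePhaseMeasure Ω d T) :=
    hχ.smooth.continuous.measurable.aemeasurable
  refine AEStronglyMeasurable.add (AEStronglyMeasurable.mul ?_ ?_)
    (AEStronglyMeasurable.mul ?_ ?_)
  · exact (hχm.div hFδ).aestronglyMeasurable
  · exact ((AEStronglyMeasurable.inner (by fun_prop) hGX).add
      ((hu.aestronglyMeasurable_force hK).inner hGV)).sub hG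
  · exact (Real.measurable_log.comp_aemeasurable hFδ).aestronglyMeasurable
  · refine (hu.aestronglyMeasurable_fderiv_apply hK hχ.smooth 0).add
      (AEStronglyMeasurable.const_mul ?_ ε)
    exact (continuous_finsetSum _ fun i _ =>
      (contDiff_dirD (contDiff_dirD hχ.smooth _) _).continuous).aestronglyMeasurable

theorem fderiv_apply_split (φ : ℝ × Phase d → ℝ) (p : ℝ × Phase d) (x v : E d) :
    fderiv ℝ φ p (1, (x, v)) = dirD (1, 0) φ p + fderiv ℝ φ p (0, (x, v)) := by
  rw [dirD, ← map_add]
  simp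

/-- Substituting the equation of F for ∂_t F cancels the Laplacian of F. The first order terms form
the drift, and the diffusion leaves 2 div_v(χ ∇_v log(F + δ)) + χ |∇_v log(F + δ)|². -/
theorem IsStrongSolution.weakOperator_mul_log (hf : IsStrongSolution Ω ε T K f gx gv)
    (hK : MemLp K ∞ (volume : Measure (E d))) (hT : 0 ≤ T)
    (B : ContDiffBump (0 : ℝ × Phase d)) {δ C : ℝ} (hδ : 0 < δ) {χ : ℝ × Phase d → ℝ}
    (hχ : IsCutoff Ω C χ) {p : ℝ × Phase d} (hp : p.1 ∈ Ioo B.rOut (T - B.rOut)) :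
    weakOperator Ω ε K u
      (fun p => χ p * Real.log (mollify B (clampTime T f) p + δ)) p =
      drift Ω ε δ K u χ (mollify B (clampTime T f)) (mollify B (extend Ω T gx))
        (mollify B (extend Ω T gv)) (mollify B (extend Ω T (transport Ω K f gx gv))) p +
      ε * ∑ i, (2 * dirD (vUnit i) (fun p => χ p *
          dirD (vUnit i) (fun p => Real.log (mollify B (clampTime T f) p + δ)) p) p +
        χ p * (dirD (vUnit i) (mollify B (clampTime T f)) p /
          (mollify B (clampTime T f) p + δ)) ^ 2) := by
  set F := mollify B (clampTime T f) with hFdef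
  have hF : ContDiff ℝ ∞ F := contDiff_mollify B (hf.continuous_clampTime hT).locallyIntegrable
  have hF0 : ∀ p, 0 ≤ F p := mollify_nonneg B fun q => (hf.clampTime_pos hT q).le
  have hl := contDiff_log_add hF hF0 hδ
  have hφ : ContDiff ℝ ∞ (fun p => χ p * Real.log (F p + δ)) := hχ.smooth.mul hl
  have hw : F p + δ ≠ 0 := by have := hF0 p; positivity
  have h1 : ∀ e, dirD e (fun p => χ p * Real.log (F p + δ)) p =
      χ p / (F p + δ) * dirD e F p + Real.log (F p + δ) * dirD e χ p := by
    intro e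
    rw [dirD_mul hχ.smooth hl, dirD_log_add hF hF0 hδ]
    ring
  have h2 := hf.dirD_mollify hT B hp p.2.2 (force Ω K (u p.1) p.2.1)
  have h3 := hf.dirD_time_mollify hK hT B hp
  rw [← hFdef] at h2 h3
  rw [weakOperator, laplacianV_eq_sum hφ, fderiv_apply_split,
    show fderiv ℝ (fun p => χ p * Real.log (F p + δ)) p
      (0, (p.2.2, force Ω K (u p.1) p.2.1)) = dirD (0, (p.2.2, force Ω K (u p.1) p.2.1))
      (fun p => χ p * Real.log (F p + δ)) p from rfl, h1, h1, hχ.dirD_time, h2, h3, drift]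
  simp only [Prod.mk.eta, dirD_dirD_mul_log hF hF0 hδ hχ.smooth, Finset.sum_add_distrib,
    Finset.sum_sub_distrib, ← Finset.mul_sum]
  rw [real_inner_comm, real_inner_comm (force Ω K (u p.1) p.2.1)]
  simp only [dirD]
  ring

end Cutoff

/-! ### Fisher information and the dissipation of entropy -/

section Fisher

variable {d : ℕ} {Ω : SpatialDomain} {ε T : ℝ} {K : E d → E d} {u : ℝ → Phase d → ℝ}
  {g : ℝ → Phase d → E d}

theorem aestronglyMeasurable_of_isLocInt {F : Type*} [NormedAddCommGroup F]
    {g : ℝ → Phase d → F} (hg : IsLocInt Ω T g) :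
    AEStronglyMeasurable (fun p : ℝ × Phase d => g p.1 p.2) (timePhaseMeasure Ω d T) := by
  have h1 := hg.aestronglyMeasurable
  rw [← Measure.prod_restrict, Measure.restrict_univ,
    Measure.restrict_congr_set Ioo_ae_eq_Icc] at h1
  exact h1

theorem fisherInfo_mono {s t : ℝ} (hst : s ≤ t) : fisherInfo Ω u g s ≤ fisherInfo Ω u g t :=
  lintegral_mono_set (Icc_subset_Icc_right hst)

/-- For ε > 0 the right side of the dissipation inequality is finite, so the Fisher information is
too. For ε = 0 the given g carries no information and is replaced by 0, which makes both cases
uniform. -/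
theorem EntropyDissipation.exists_gradient (hε : 0 ≤ ε) (hT : 0 ≤ T)
    (h : EntropyDissipation Ω ε T u) :
    ∃ g : ℝ → Phase d → E d, IsLocInt Ω T g ∧ (0 < ε → IsWeakGradientV Ω T u g) ∧
      fisherInfo Ω u g T ≠ ⊤ ∧
      ∀ t ∈ Icc 0 T, entropy Ω (u t) + ε * (fisherInfo Ω u g t).toReal ≤ entropy Ω (u 0) := by
  obtain ⟨g, hg, hle⟩ := h
  rcases hε.eq_or_lt with rfl | hε
  · have h0 : ∀ t, fisherInfo Ω u (fun _ _ => (0 : E d)) t = 0 := fun t => by simp [fisherInfo]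
    refine ⟨fun _ _ => 0, ?_, fun h => absurd h (lt_irrefl _), by simp [h0], fun t ht => ?_⟩
    · exact locallyIntegrableOn_zero
    · have := hle t ht
      simpa using this
  · have hfin : ∀ t ∈ Icc 0 T, fisherInfo Ω u g t ≠ ⊤ := by
      intro t ht htop
      have := hle t ht
      rw [htop, ENNReal.mul_top (by simpa using hε)] at this
      simp at this
    refine ⟨g, (hg hε).1, hg, hfin T ⟨hT, le_rfl⟩, fun t ht => ?_⟩
    have h1 := hle t ht
    have h2 : ((ENNReal.ofReal ε * fisherInfo Ω u g t : ℝ≥0∞) : EReal) =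
        ((ε * (fisherInfo Ω u g t).toReal : ℝ) : EReal) := by
      rw [← ENNReal.ofReal_toReal (hfin t ht), ← ENNReal.ofReal_mul hε.le,
        EReal.coe_ennreal_ofReal, ENNReal.toReal_ofReal ENNReal.toReal_nonneg,
        max_eq_left (by positivity)]
    rw [h2] at h1
    exact_mod_cast h1

/-- The Fisher information at a fixed time. -/
noncomputable def fisherAt (Ω : SpatialDomain) (u : ℝ → Phase d → ℝ) (g : ℝ → Phase d → E d)
    (s : ℝ) : ℝ≥0∞ :=
  ∫⁻ z, ‖g s z‖ₑ ^ 2 / ENNReal.ofReal (u s z) ∂(phaseMeasure Ω d)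

theorem IsWeakSolution.aemeasurable_fisher (hu : IsWeakSolution Ω ε T K u)
    (hg : IsLocInt Ω T g) :
    AEMeasurable (fun p : ℝ × Phase d => ‖g p.1 p.2‖ₑ ^ 2 / ENNReal.ofReal (u p.1 p.2))
      (timePhaseMeasure Ω d T) :=
  ((aestronglyMeasurable_of_isLocInt hg).enorm.pow_const 2).div
    hu.measurable.aemeasurable.ennreal_ofReal

theorem IsWeakSolution.aemeasurable_fisherAt (hu : IsWeakSolution Ω ε T K u)
    (hg : IsLocInt Ω T g) :
    AEMeasurable (fisherAt Ω u g) ((volume : Measure ℝ).restrict (Icc 0 T)) :=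
  (hu.aemeasurable_fisher hg).lintegral_prod_right'

theorem IsWeakSolution.ae_fisherAt_lt_top (hu : IsWeakSolution Ω ε T K u)
    (hg : IsLocInt Ω T g) (hfin : fisherInfo Ω u g T ≠ ⊤) :
    ∀ᵐ s ∂((volume : Measure ℝ).restrict (Icc 0 T)), fisherAt Ω u g s < ⊤ :=
  ae_lt_top' (hu.aemeasurable_fisherAt hg) hfin

theorem integral_toReal_fisherAt_le (hu : IsWeakSolution Ω ε T K u) (hg : IsLocInt Ω T g)
    (hfin : fisherInfo Ω u g T ≠ ⊤) {a b t : ℝ} (ha : 0 ≤ a) (hbt : b ≤ t) (ht : t ≤ T)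
    (hab : a ≤ b) :
    IntervalIntegrable (fun s => (fisherAt Ω u g s).toReal) volume a b ∧
    ∫ s in a..b, (fisherAt Ω u g s).toReal ≤ (fisherInfo Ω u g t).toReal := by
  have hsub : Ioc a b ⊆ Icc 0 T :=
    Ioc_subset_Icc_self.trans (Icc_subset_Icc ha (hbt.trans ht))
  have hsub' : Ioc a b ⊆ Icc 0 t := Ioc_subset_Icc_self.trans (Icc_subset_Icc ha hbt)
  have hm := hu.aemeasurable_fisherAt hg
  have hI : IntegrableOn (fun s => (fisherAt Ω u g s).toReal) (Icc 0 T) :=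
    integrable_toReal_of_lintegral_ne_top hm hfin
  refine ⟨?_, ?_⟩
  · rw [intervalIntegrable_iff, uIoc_of_le hab]
    exact hI.mono_set hsub
  · rw [intervalIntegral.integral_of_le hab, integral_toReal
      (hm.mono_measure (Measure.restrict_mono hsub le_rfl))
      (ae_restrict_of_ae_restrict_of_subset hsub (hu.ae_fisherAt_lt_top hg hfin))]
    refine ENNReal.toReal_mono (ne_top_of_le_ne_top hfin (fisherInfo_mono ht)) ?_
    exact lintegral_mono_set hsub'

/-- Young's inequality for the dissipation terms. -/
theorem neg_toReal_le_sum {χ u : ℝ} {y g : E d} (hχ : 0 ≤ χ) (hχ1 : χ ≤ 1) (hu : 0 ≤ u)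
    (hfin : ‖g‖ₑ ^ 2 / ENNReal.ofReal u < ⊤) :
    -(‖g‖ₑ ^ 2 / ENNReal.ofReal u).toReal ≤ ∑ i, (u * (χ * y i ^ 2) - 2 * (χ * y i * g i)) := by
  have hr : (‖g‖ₑ ^ 2 / ENNReal.ofReal u).toReal = ‖g‖ ^ 2 / u := by
    simp [ENNReal.toReal_div, ENNReal.toReal_ofReal hu]
  rw [hr]
  rcases hu.eq_or_lt with rfl | hu
  -- Where u = 0, finiteness of the quotient forces the gradient to vanish, a nonzero number divided
  -- by 0 being ⊤.
  · have hg : g = 0 := by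
      by_contra hne
      have : ‖g‖ₑ ^ 2 ≠ 0 := by simpa using hne
      rw [ENNReal.ofReal_zero, ENNReal.div_zero this] at hfin
      exact lt_irrefl _ hfin
    simp [hg]
  · have h1 : ‖g‖ ^ 2 / u = ∑ i, g i ^ 2 / u := by
      rw [EuclideanSpace.real_norm_sq_eq, Finset.sum_div]
    rw [h1, ← Finset.sum_neg_distrib]
    refine Finset.sum_le_sum fun i _ => ?_
    -- Complete the square; the cut-off multiplies the y terms only, and χ ≤ 1 lets the term g²/u
    -- keep the factor 1.
    have h2 : 0 ≤ (u * y i - g i) ^ 2 / u := by positivity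
    have h3 : (u * y i - g i) ^ 2 / u = u * y i ^ 2 - 2 * (y i * g i) + g i ^ 2 / u := by
      field_simp
      ring
    have h4 : 0 ≤ g i ^ 2 / u := by positivity
    nlinarith

end Fisher


/-! ### The entropy inequality for mollified test functions -/

section Regularized

variable {d : ℕ} {Ω : SpatialDomain} {ε T : ℝ} {K : E d → E d} {u : ℝ → Phase d → ℝ}
  {f : ℝ → Phase d → ℝ} {gx gv : ℝ → Phase d → E d} {g : ℝ → Phase d → E d}

/-- Here y plays the role of ∇_v log(F + δ), D i that of ∂_i(χ y_i), and `hibp` is integration by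
parts in v. It turns the right side into ∫ (u χ |y|² − 2 χ y·g), which is bounded below pointwise by
Young's inequality. -/
theorem neg_toReal_lintegral_le {u : Phase d → ℝ} {g : Phase d → E d} {χ : Phase d → ℝ}
    {y : Phase d → E d} {D : Fin d → Phase d → ℝ} (hu : ∀ᵐ z ∂(phaseMeasure Ω d), 0 ≤ u z)
    (hχ0 : ∀ z, 0 ≤ χ z) (hχ1 : ∀ z, χ z ≤ 1)
    (hm : AEMeasurable (fun z => ‖g z‖ₑ ^ 2 / ENNReal.ofReal (u z)) (phaseMeasure Ω d))
    (hfin : ∫⁻ z, ‖g z‖ₑ ^ 2 / ENNReal.ofReal (u z) ∂(phaseMeasure Ω d) < ⊤)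
    (hD : ∀ i, Integrable (fun z => u z * D i z) (phaseMeasure Ω d))
    (hy : ∀ i, Integrable (fun z => u z * (χ z * y z i ^ 2)) (phaseMeasure Ω d))
    (hV : ∀ i, Integrable (fun z => χ z * y z i * g z i) (phaseMeasure Ω d))
    (hibp : ∀ i, ∫ z, u z * D i z ∂(phaseMeasure Ω d) +
      ∫ z, χ z * y z i * g z i ∂(phaseMeasure Ω d) = 0) :
    -(∫⁻ z, ‖g z‖ₑ ^ 2 / ENNReal.ofReal (u z) ∂(phaseMeasure Ω d)).toReal ≤
      ∫ z, u z * ∑ i, (2 * D i z + χ z * y z i ^ 2) ∂(phaseMeasure Ω d) := by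
  have hlt := ae_lt_top' hm hfin.ne
  have s1 : ∀ i ∈ Finset.univ, Integrable (fun z => 2 * (u z * D i z) +
      u z * (χ z * y z i ^ 2)) (phaseMeasure Ω d) := fun i _ => ((hD i).const_mul 2).add (hy i)
  have s2 : ∀ i ∈ Finset.univ, Integrable (fun z => u z * (χ z * y z i ^ 2) -
      2 * (χ z * y z i * g z i)) (phaseMeasure Ω d) := fun i _ => (hy i).sub ((hV i).const_mul 2)
  have e1 : ∫ z, u z * ∑ i, (2 * D i z + χ z * y z i ^ 2) ∂(phaseMeasure Ω d) =
      ∑ i, ∫ z, (u z * (χ z * y z i ^ 2) - 2 * (χ z * y z i * g z i)) ∂(phaseMeasure Ω d) := by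
    have : ∀ z, u z * ∑ i, (2 * D i z + χ z * y z i ^ 2) =
        ∑ i, (2 * (u z * D i z) + u z * (χ z * y z i ^ 2)) := by
      intro z
      rw [Finset.mul_sum]
      exact Finset.sum_congr rfl fun i _ => by ring
    simp only [this]
    rw [integral_finsetSum _ s1]
    refine Finset.sum_congr rfl fun i _ => ?_
    rw [integral_add ((hD i).const_mul 2) (hy i), integral_sub (hy i) ((hV i).const_mul 2),
      integral_const_mul, integral_const_mul]
    linarith [hibp i]
  rw [e1, ← integral_finsetSum _ s2,
    ← integral_toReal hm hlt, ← integral_neg]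
  refine integral_mono_ae (integrable_toReal_of_lintegral_ne_top hm hfin.ne).neg
    (integrable_finsetSum _ s2) ?_
  filter_upwards [hu, hlt] with z h1 h2
  exact neg_toReal_le_sum (hχ0 z) (hχ1 z) h1 h2

theorem norm_velocity_le_add_one (p q : ℝ × Phase d) {r : ℝ} (hr : r ≤ 1) (h : ‖q - p‖ ≤ r) :
    ‖q.2.2‖ ≤ ‖p.2.2‖ + 1 := by
  have h1 : ‖q.2.2 - p.2.2‖ ≤ ‖q - p‖ := (norm_snd_le (q - p).2).trans (norm_snd_le (q - p))
  have h2 : ‖q.2.2‖ ≤ ‖p.2.2‖ + ‖q.2.2 - p.2.2‖ := by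
    simpa using norm_add_le p.2.2 (q.2.2 - p.2.2)
  linarith

theorem IsStrongSolution.exists_bound_mollify (hf : IsStrongSolution Ω ε T K f gx gv)
    (hK : MemLp K ∞ (volume : Measure (E d))) (hT : 0 < T) :
    ∃ M : ℝ, 0 ≤ M ∧ (∀ p, clampTime T f p ≤ M) ∧
      (∀ᵐ p ∂(timePhaseMeasure Ω d T), ‖gx p.1 p.2‖ ≤ M) ∧
      (∀ᵐ p ∂(timePhaseMeasure Ω d T), ‖gv p.1 p.2‖ ≤ M) ∧
      ∀ B : ContDiffBump (0 : ℝ × Phase d), B.rOut ≤ 1 → ∀ p,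
        mollify B (clampTime T f) p ≤ M ∧ ‖mollify B (extend Ω T gx) p‖ ≤ M ∧
        ‖mollify B (extend Ω T gv) p‖ ≤ M ∧
        |mollify B (extend Ω T (transport Ω K f gx gv)) p| ≤ (‖p.2.2‖ + 1 + supNorm K) * M := by
  obtain ⟨M, hM, h1, h2, h3⟩ := hf.exists_bound
  have hc := hf.clampTime_le hT h3
  refine ⟨M, hM, hc, h1, h2, fun B hB p => ⟨?_, ?_, ?_, ?_⟩⟩
  · refine (Real.le_norm_self _).trans (norm_mollify_le B (Filter.Eventually.of_forall fun q _ => ?_))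
    rw [Real.norm_of_nonneg (hf.clampTime_pos hT.le q).le]
    exact hc q
  · refine norm_mollify_le B ?_
    filter_upwards [norm_extend_le (Ω := Ω) (b := fun _ => M) (fun _ => hM) (fun _ => rfl) h1]
      with q hq _ using hq
  · refine norm_mollify_le B ?_
    filter_upwards [norm_extend_le (Ω := Ω) (b := fun _ => M) (fun _ => hM) (fun _ => rfl) h2]
      with q hq _ using hq
  · rw [← Real.norm_eq_abs]
    refine norm_mollify_le B ?_
    filter_upwards [norm_extend_le (Ω := Ω) (b := fun z => (‖z.2‖ + supNorm K) * M)
      (fun z => mul_nonneg (add_nonneg (norm_nonneg _) supNorm_nonneg) hM)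
      (fun z => by simp only [fold_snd]) (hf.ae_norm_transport_le hK h1 h2)] with q hq hqp
    refine hq.trans (mul_le_mul_of_nonneg_right ?_ hM)
    linarith [norm_velocity_le_add_one p q hB hqp]

/-- The function `χ log (F + δ)`, where `F` is a mollification of the strong solution. -/
noncomputable def logTest (T δ : ℝ) (f : ℝ → Phase d → ℝ) (χ : ℝ × Phase d → ℝ)
    (B : ContDiffBump (0 : ℝ × Phase d)) (p : ℝ × Phase d) : ℝ :=
  χ p * Real.log (mollify B (clampTime T f) p + δ)

/-- The drift of the mollified strong solution. -/
noncomputable def mollDrift (Ω : SpatialDomain) (ε δ T : ℝ) (K : E d → E d)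
    (u f : ℝ → Phase d → ℝ) (gx gv : ℝ → Phase d → E d) (χ : ℝ × Phase d → ℝ)
    (B : ContDiffBump (0 : ℝ × Phase d)) : ℝ × Phase d → ℝ :=
  drift Ω ε δ K u χ (mollify B (clampTime T f)) (mollify B (extend Ω T gx))
    (mollify B (extend Ω T gv)) (mollify B (extend Ω T (transport Ω K f gx gv)))

theorem IsStrongSolution.contDiff_mollify_clampTime (hf : IsStrongSolution Ω ε T K f gx gv)
    (hT : 0 ≤ T) (B : ContDiffBump (0 : ℝ × Phase d)) :
    ContDiff ℝ ∞ (mollify B (clampTime T f)) :=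
  contDiff_mollify B (hf.continuous_clampTime hT).locallyIntegrable

theorem IsStrongSolution.mollify_clampTime_nonneg (hf : IsStrongSolution Ω ε T K f gx gv)
    (hT : 0 ≤ T) (B : ContDiffBump (0 : ℝ × Phase d)) (p : ℝ × Phase d) :
    0 ≤ mollify B (clampTime T f) p :=
  mollify_nonneg B (fun q => (hf.clampTime_pos hT q).le) p

theorem PeriodicIn.log_add {F : ℝ × Phase d → ℝ} (hF : PeriodicIn Ω F) (δ : ℝ) :
    PeriodicIn Ω (fun p => Real.log (F p + δ)) :=
  fun hΩ i p => by simp only [hF hΩ i p]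

theorem IsStrongSolution.isTest_logTest (hf : IsStrongSolution Ω ε T K f gx gv) (hT : 0 ≤ T)
    {δ : ℝ} (hδ : 0 < δ) {χ : ℝ × Phase d → ℝ} (hχ : IsTest Ω χ)
    (B : ContDiffBump (0 : ℝ × Phase d)) : IsTest Ω (logTest T δ f χ B) :=
  hχ.mul_right (contDiff_log_add (hf.contDiff_mollify_clampTime hT B)
    (hf.mollify_clampTime_nonneg hT B) hδ)
    ((periodicIn_mollify B (hf.periodicIn_clampTime hT)).log_add δ)

theorem IsWeakSolution.exists_bound_mollDrift (hu : IsWeakSolution Ω ε T K u)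
    (hf : IsStrongSolution Ω ε T K f gx gv)
    (hK : MemLp K ∞ (volume : Measure (E d))) (hε : 0 ≤ ε) (hT : 0 < T) {δ C : ℝ} (hδ : 0 < δ)
    {χ : ℝ × Phase d → ℝ} (hχ : IsCutoff Ω C χ) :
    ∃ A : ℝ, ∀ B : ContDiffBump (0 : ℝ × Phase d), B.rOut ≤ 1 → ∀ t ∈ Icc 0 T, ∀ z : Phase d,
      z.1 ∈ cell Ω d → |mollDrift Ω ε δ T K u f gx gv χ B (t, z)| ≤ A := by
  obtain ⟨M, hM, -, -, -, hB⟩ := hf.exists_bound_mollify hK hT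
  obtain ⟨R, hR0, hR⟩ := exists_compact_of_support hχ.support
  refine ⟨1 / δ * ((2 * R + 2 * supNorm K + 1) * M) +
    (|Real.log δ| + |Real.log (M + δ)|) * (C * (1 + supNorm K) + ε * C),
    fun B hB1 t ht z hz => ?_⟩
  obtain ⟨h1, h2, h3, h4⟩ := hB B hB1 (t, z)
  exact abs_drift_le (p := (t, z)) hδ hε hχ hR0 hR hM hz (hf.mollify_clampTime_nonneg hT.le B _) h1 h2 h3
    h4 supNorm_nonneg ((hu.probDensity t ht).norm_force_le hK z.1)

theorem IsWeakSolution.aestronglyMeasurable_mollDrift (hu : IsWeakSolution Ω ε T K u)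
    (hf : IsStrongSolution Ω ε T K f gx gv)
    (hK : MemLp K ∞ (volume : Measure (E d))) (hT : 0 < T) {δ C : ℝ}
    {χ : ℝ × Phase d → ℝ} (hχ : IsCutoff Ω C χ) (B : ContDiffBump (0 : ℝ × Phase d)) :
    AEStronglyMeasurable (mollDrift Ω ε δ T K u f gx gv χ B) (timePhaseMeasure Ω d T) :=
  hu.aestronglyMeasurable_drift hK hχ
    (hf.contDiff_mollify_clampTime hT.le B).continuous.aestronglyMeasurable
    (contDiff_mollify B hf.locallyIntegrable_extend_gx).continuous.aestronglyMeasurable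
    (contDiff_mollify B hf.locallyIntegrable_extend_gv).continuous.aestronglyMeasurable
    (contDiff_mollify B (hf.locallyIntegrable_extend_transport hK)).continuous.aestronglyMeasurable

theorem ae_of_ae_restrict_Icc {P : ℝ → Prop}
    (h : ∀ᵐ s ∂((volume : Measure ℝ).restrict (Icc 0 T)), P s) {a b : ℝ} (ha : 0 ≤ a)
    (hb : b ≤ T) : ∀ᵐ s ∂((volume : Measure ℝ).restrict (Icc a b)), P s :=
  ae_restrict_of_ae_restrict_of_subset (Icc_subset_Icc ha hb) h

theorem inner_single_right (x : E d) (i : Fin d) :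
    inner ℝ x (EuclideanSpace.single i (1 : ℝ)) = x i := by
  rw [EuclideanSpace.inner_single_right]; simp

/-- The dissipation of the diffusion is controlled by the Fisher information. -/
theorem IsWeakSolution.ae_le_integral_weakOperator (hu : IsWeakSolution Ω ε T K u)
    (hf : IsStrongSolution Ω ε T K f gx gv)
    (hK : MemLp K ∞ (volume : Measure (E d))) (hε : 0 ≤ ε) (hT : 0 < T)
    (hg : IsLocInt Ω T g) (hgw : 0 < ε → IsWeakGradientV Ω T u g)
    (hfin : fisherInfo Ω u g T ≠ ⊤) {δ C : ℝ} (hδ : 0 < δ)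
    {χ : ℝ × Phase d → ℝ} (hχ : IsCutoff Ω C χ) (B : ContDiffBump (0 : ℝ × Phase d))
    (hB : B.rOut ≤ 1) {a b : ℝ} (ha : B.rOut < a) (hb : b < T - B.rOut) :
    ∀ᵐ s ∂((volume : Measure ℝ).restrict (Icc a b)),
      ∫ z, u s z * mollDrift Ω ε δ T K u f gx gv χ B (s, z) ∂(phaseMeasure Ω d) -
        ε * (fisherAt Ω u g s).toReal ≤
      ∫ z, u s z * weakOperator Ω ε K u (logTest T δ f χ B) (s, z) ∂(phaseMeasure Ω d) := by
  have hr := B.rOut_pos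
  have ha0 : 0 < a := hr.trans ha
  have hbT : b < T := by linarith
  set F := mollify B (clampTime T f) with hFdef
  have hF : ContDiff ℝ ∞ F := hf.contDiff_mollify_clampTime hT.le B
  have hF0 : ∀ p, 0 ≤ F p := hf.mollify_clampTime_nonneg hT.le B
  have hFp : PeriodicIn Ω F := periodicIn_mollify B (hf.periodicIn_clampTime hT.le)
  have hl := contDiff_log_add hF hF0 hδ
  set V : Fin d → ℝ × Phase d → ℝ := fun i p =>
    χ p * dirD (vUnit i) (fun p => Real.log (F p + δ)) p with hVdef
  have hV : ∀ i, IsTest Ω (V i) := fun i =>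
    hχ.toIsTest.mul_right (contDiff_dirD hl _) ((hFp.log_add δ).dirD _)
  have hW : ∀ i, IsTest Ω (fun p => V i p * dirD (vUnit i) (fun p => Real.log (F p + δ)) p) :=
    fun i => (hV i).mul_right (contDiff_dirD hl _) ((hFp.log_add δ).dirD _)
  have hop : ∀ s ∈ Icc a b, ∀ z, u s z * weakOperator Ω ε K u (logTest T δ f χ B) (s, z) =
      u s z * mollDrift Ω ε δ T K u f gx gv χ B (s, z) +
        ε * (u s z * ∑ i, (2 * dirD (vUnit i) (V i) (s, z) + χ (s, z) *
          (dirD (vUnit i) F (s, z) / (F (s, z) + δ)) ^ 2)) := by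
    intro s hs z
    have := hf.weakOperator_mul_log (u := u) hK hT.le B hδ hχ (p := (s, z))
      ⟨ha.trans_le hs.1, hs.2.trans_lt hb⟩
    rw [show logTest T δ f χ B = fun p => χ p * Real.log (mollify B (clampTime T f) p + δ) from rfl,
      this, mollDrift]
    ring
  obtain ⟨A, hA⟩ := hu.exists_bound_mollDrift hf hK hε hT hδ hχ
  have hD := hu.integrable_mul (hu.aestronglyMeasurable_mollDrift hf hK hT hχ B) (hA B hB)
  have hDs := ae_of_ae_restrict_Icc hD.prod_right_ae ha0.le hbT.le
  -- Without diffusion there is no weak gradient of u to use, but every term with ε drops out and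
  -- equality holds.
  rcases hε.eq_or_lt with h0 | hε
  · filter_upwards [ae_restrict_mem measurableSet_Icc] with s hs
    refine le_of_eq ?_
    have hz : ∀ x : ℝ, ε * x = 0 := fun x => by rw [← h0, zero_mul]
    simp only [hop s hs, hz, add_zero, sub_zero]
  have i1 : ∀ᵐ s ∂((volume : Measure ℝ).restrict (Icc a b)), ∀ i,
      Integrable (fun z => u s z * dirD (vUnit i) (V i) (s, z)) (phaseMeasure Ω d) := by
    refine ae_all_iff.2 fun i => ?_
    obtain ⟨C, -, hC⟩ := ((hV i).dirD (vUnit i)).exists_bound T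
    exact ae_of_ae_restrict_Icc (hu.integrable_mul
      ((hV i).dirD (vUnit i)).smooth.continuous.aestronglyMeasurable hC).prod_right_ae ha0.le hbT.le
  have i2 : ∀ᵐ s ∂((volume : Measure ℝ).restrict (Icc a b)), ∀ i,
      Integrable (fun z => u s z * (V i (s, z) * dirD (vUnit i)
        (fun p => Real.log (F p + δ)) (s, z))) (phaseMeasure Ω d) := by
    refine ae_all_iff.2 fun i => ?_
    obtain ⟨C, -, hC⟩ := (hW i).exists_bound T
    exact ae_of_ae_restrict_Icc (hu.integrable_mul
      (hW i).smooth.continuous.aestronglyMeasurable hC).prod_right_ae ha0.le hbT.le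
  have i3 : ∀ᵐ s ∂((volume : Measure ℝ).restrict (Icc a b)), ∀ i,
      Integrable (fun z => V i (s, z) * g s z i) (phaseMeasure Ω d) := by
    refine ae_all_iff.2 fun i => ?_
    have h1 := ((integrableOn_smul_of_isLocInt hg (hV i) ha0 hbT).inner_const (𝕜 := ℝ)
      (EuclideanSpace.single i (1 : ℝ))).prod_right_ae
    simpa only [inner_smul_left, RCLike.conj_to_real, inner_single_right] using h1
  -- Integration by parts in v at almost every fixed time, with χ ∂_i log(F + δ) as the test
  -- function.
  have i4 : ∀ᵐ s ∂((volume : Measure ℝ).restrict (Icc a b)), ∀ i, s ∈ Ioo 0 T →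
      ∫ z, u s z * dirD (vUnit i) (V i) (s, z) ∂(phaseMeasure Ω d) +
        ∫ z, V i (s, z) * g s z i ∂(phaseMeasure Ω d) = 0 := by
    refine ae_all_iff.2 fun i => ae_restrict_of_ae ?_
    have h1 := hu.ae_integral_mul_dirD (hgw hε) (hV i) (EuclideanSpace.single i (1 : ℝ))
    simpa only [inner_single_right, vUnit] using h1
  have i5 := ae_of_ae_restrict_Icc (hu.aemeasurable_fisher hg).aestronglyMeasurable.prodMk_left
    ha0.le hbT.le
  have i6 := ae_of_ae_restrict_Icc (hu.ae_fisherAt_lt_top hg hfin) ha0.le hbT.le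
  filter_upwards [ae_restrict_mem measurableSet_Icc, hDs, i1, i2, i3, i4, i5, i6]
    with s hs hDs i1 i2 i3 i4 i5 i6
  have hs0 : s ∈ Ioo 0 T := ⟨ha0.trans_le hs.1, hs.2.trans_lt hbT⟩
  have hy : ∀ i, (fun z => u s z * (χ (s, z) *
      (WithLp.toLp 2 (fun i => dirD (vUnit i) F (s, z) / (F (s, z) + δ)) : E d) i ^ 2)) =
      fun z => u s z * (V i (s, z) * dirD (vUnit i) (fun p => Real.log (F p + δ)) (s, z)) := by
    intro i
    funext z
    simp only [hVdef, dirD_log_add hF hF0 hδ]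
    ring
  have hVi : ∀ i z, V i (s, z) = χ (s, z) *
      (WithLp.toLp 2 (fun i => dirD (vUnit i) F (s, z) / (F (s, z) + δ)) : E d) i := by
    intro i z
    simp only [hVdef, dirD_log_add hF hF0 hδ]
  have key := neg_toReal_lintegral_le (Ω := Ω) (u := u s) (g := g s) (χ := fun z => χ (s, z))
    (y := fun z => WithLp.toLp 2 (fun i => dirD (vUnit i) F (s, z) / (F (s, z) + δ)))
    (D := fun i z => dirD (vUnit i) (V i) (s, z))
    (hu.probDensity s (Ioo_subset_Icc_self hs0)).nonneg (fun z => hχ.nonneg _)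
    (fun z => hχ.le_one _) i5.aemeasurable i6 i1 (fun i => by rw [hy]; exact i2 i)
    (fun i => by simpa only [hVi] using i3 i) (fun i => by simpa only [hVi] using i4 i hs0)
  have hJ : Integrable (fun z => u s z * ∑ i, (2 * dirD (vUnit i) (V i) (s, z) + χ (s, z) *
          (dirD (vUnit i) F (s, z) / (F (s, z) + δ)) ^ 2)) (phaseMeasure Ω d) := by
    have h1 := integrable_finsetSum Finset.univ (fun i _ => ((i1 i).const_mul 2).add (i2 i))
    refine h1.congr (Filter.Eventually.of_forall fun z => ?_)
    simp only [Finset.mul_sum, Pi.add_apply]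
    refine Finset.sum_congr rfl fun i _ => ?_
    simp only [hVdef, dirD_log_add hF hF0 hδ]
    ring
  simp only [hop s hs]
  rw [integral_add hDs (hJ.const_mul ε), integral_const_mul]
  have := mul_le_mul_of_nonneg_left key hε.le
  change ε * -(fisherAt Ω u g s).toReal ≤ _ at this
  linarith

/-- The regularized entropy inequality. -/
theorem IsWeakSolution.integral_mollDrift_le (hu : IsWeakSolution Ω ε T K u)
    (hf : IsStrongSolution Ω ε T K f gx gv)
    (hK : MemLp K ∞ (volume : Measure (E d))) (hε : 0 ≤ ε) (hT : 0 < T)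
    (hg : IsLocInt Ω T g) (hgw : 0 < ε → IsWeakGradientV Ω T u g)
    (hfin : fisherInfo Ω u g T ≠ ⊤) {δ C : ℝ} (hδ : 0 < δ)
    {χ : ℝ × Phase d → ℝ} (hχ : IsCutoff Ω C χ) (B : ContDiffBump (0 : ℝ × Phase d))
    (hB : B.rOut ≤ 1) {a b t : ℝ} (ha : B.rOut < a) (hab : a ≤ b) (hb : b < T - B.rOut)
    (hbt : b ≤ t) (ht : t ≤ T) :
    (∫ s in a..b, ∫ z, u s z * mollDrift Ω ε δ T K u f gx gv χ B (s, z) ∂(phaseMeasure Ω d)) -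
        ε * (fisherInfo Ω u g t).toReal ≤
      ∫ z, u b z * logTest T δ f χ B (b, z) ∂(phaseMeasure Ω d) -
        ∫ z, u a z * logTest T δ f χ B (a, z) ∂(phaseMeasure Ω d) := by
  have hr := B.rOut_pos
  have ha0 : 0 < a := hr.trans ha
  have hbT : b < T := by linarith
  have haT : a ∈ Icc 0 T := ⟨ha0.le, hab.trans hbT.le⟩
  have hbT' : b ∈ Icc 0 T := ⟨ha0.le.trans hab, hbT.le⟩
  have hφ := hf.isTest_logTest hT.le hδ hχ.toIsTest B
  obtain ⟨A, hA⟩ := hu.exists_bound_mollDrift hf hK hε hT hδ hχ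
  have hD := intervalIntegrable_of_integrable (hu.integrable_mul
    (hu.aestronglyMeasurable_mollDrift hf hK hT hχ B) (hA B hB)) haT hbT'
  have hO := intervalIntegrable_of_integrable (hu.integrable_weakOperator hK hφ) haT hbT'
  obtain ⟨hFi, hFle⟩ := integral_toReal_fisherAt_le hu hg hfin ha0.le hbt ht hab
  rw [hu.integral_sub_eq hK hφ haT hbT']
  calc _ ≤ (∫ s in a..b, ∫ z, u s z * mollDrift Ω ε δ T K u f gx gv χ B (s, z)
          ∂(phaseMeasure Ω d)) - ε * ∫ s in a..b, (fisherAt Ω u g s).toReal := by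
        have := mul_le_mul_of_nonneg_left hFle hε
        linarith
    _ = ∫ s in a..b, (∫ z, u s z * mollDrift Ω ε δ T K u f gx gv χ B (s, z)
          ∂(phaseMeasure Ω d) - ε * (fisherAt Ω u g s).toReal) := by
        rw [intervalIntegral.integral_sub hD (hFi.const_mul ε),
          intervalIntegral.integral_const_mul]
    _ ≤ _ := intervalIntegral.integral_mono_ae_restrict hab (hD.sub (hFi.const_mul ε)) hO
        (hu.ae_le_integral_weakOperator hf hK hε hT hg hgw hfin hδ hχ B hB ha hb)

end Regularized


/-! ### Removal of the mollification -/

section RegularizedLimit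

open Filter Topology

variable {d : ℕ} {Ω : SpatialDomain} {ε T : ℝ} {K : E d → E d} {u : ℝ → Phase d → ℝ}
  {f : ℝ → Phase d → ℝ} {gx gv : ℝ → Phase d → E d} {g : ℝ → Phase d → E d}

/-- The limit of the mollified drifts. -/
noncomputable def limitDrift (Ω : SpatialDomain) (ε δ T : ℝ) (K : E d → E d)
    (u f : ℝ → Phase d → ℝ) (gx gv : ℝ → Phase d → E d) (χ : ℝ × Phase d → ℝ) :
    ℝ × Phase d → ℝ :=
  drift Ω ε δ K u χ (clampTime T f) (extend Ω T gx)
    (extend Ω T gv) (extend Ω T (transport Ω K f gx gv))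

theorem timePhaseMeasure_absolutelyContinuous :
    timePhaseMeasure Ω d T ≪ (volume : Measure (ℝ × Phase d)) := by
  rw [Measure.volume_eq_prod ℝ]
  exact Measure.AbsolutelyContinuous.prod Measure.restrict_le_self.absolutelyContinuous
    phaseMeasure_le.absolutelyContinuous

theorem IsStrongSolution.ae_tendsto_mollDrift (hf : IsStrongSolution Ω ε T K f gx gv)
    (hK : MemLp K ∞ (volume : Measure (E d))) (hT : 0 < T) {δ : ℝ} (hδ : 0 < δ)
    (χ : ℝ × Phase d → ℝ) :
    ∀ᵐ p ∂(timePhaseMeasure Ω d T), Tendsto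
      (fun n => mollDrift Ω ε δ T K u f gx gv χ (mollSeq d n) p) atTop
      (𝓝 (limitDrift Ω ε δ T K u f gx gv χ p)) := by
  refine timePhaseMeasure_absolutelyContinuous.ae_le ?_
  filter_upwards [ae_tendsto_mollify hf.locallyIntegrable_extend_gx,
    ae_tendsto_mollify hf.locallyIntegrable_extend_gv,
    ae_tendsto_mollify (hf.locallyIntegrable_extend_transport hK)] with p h1 h2 h3
  have h0 := (tendsto_mollify_of_continuous (hf.continuous_clampTime hT.le) p).add_const δ
  have hpos : clampTime T f p + δ ≠ 0 := by have := hf.clampTime_pos hT.le p; positivity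
  refine Tendsto.add (Tendsto.mul ?_ ?_) (Tendsto.mul ?_ tendsto_const_nhds)
  · exact tendsto_const_nhds.div h0 hpos
  · exact ((tendsto_const_nhds.inner h1).add (tendsto_const_nhds.inner h2)).sub h3
  · exact (Real.continuousAt_log hpos).tendsto.comp h0

theorem restrict_Ioc_prod_le {a b : ℝ} (ha : 0 ≤ a) (hb : b ≤ T) :
    ((volume : Measure ℝ).restrict (Ioc a b)).prod (phaseMeasure Ω d) ≤
      timePhaseMeasure Ω d T :=
  Measure.prod_mono (Measure.restrict_mono
    (Ioc_subset_Icc_self.trans (Icc_subset_Icc ha hb)) le_rfl) le_rfl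

theorem intervalIntegral_integral_eq {h : ℝ × Phase d → ℝ}
    (hh : Integrable h (timePhaseMeasure Ω d T)) {a b : ℝ} (ha : 0 ≤ a) (hab : a ≤ b)
    (hb : b ≤ T) :
    ∫ s in a..b, ∫ z, h (s, z) ∂(phaseMeasure Ω d) =
      ∫ p, h p ∂(((volume : Measure ℝ).restrict (Ioc a b)).prod (phaseMeasure Ω d)) := by
  rw [intervalIntegral.integral_of_le hab,
    integral_prod _ (hh.mono_measure (restrict_Ioc_prod_le ha hb))]

/-- Dominated convergence against a weak solution. -/
theorem IsWeakSolution.tendsto_intervalIntegral (hu : IsWeakSolution Ω ε T K u)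
    {Q : ℕ → ℝ × Phase d → ℝ} {Q' : ℝ × Phase d → ℝ}
    (hQ : ∀ n, AEStronglyMeasurable (Q n) (timePhaseMeasure Ω d T)) {A : ℝ}
    (hA : ∀ n, ∀ᵐ p ∂(timePhaseMeasure Ω d T), |Q n p| ≤ A)
    (hlim : ∀ᵐ p ∂(timePhaseMeasure Ω d T), Tendsto (fun n => Q n p) atTop (𝓝 (Q' p)))
    {a b : ℝ} (ha : 0 ≤ a) (hab : a ≤ b) (hb : b ≤ T) :
    Integrable (fun p : ℝ × Phase d => u p.1 p.2 * Q' p) (timePhaseMeasure Ω d T) ∧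
    Tendsto (fun n => ∫ s in a..b, ∫ z, u s z * Q n (s, z) ∂(phaseMeasure Ω d)) atTop
      (𝓝 (∫ s in a..b, ∫ z, u s z * Q' (s, z) ∂(phaseMeasure Ω d))) := by
  have hQ'm : AEStronglyMeasurable Q' (timePhaseMeasure Ω d T) :=
    aestronglyMeasurable_of_tendsto_ae atTop hQ hlim
  have hQ'A : ∀ᵐ p ∂(timePhaseMeasure Ω d T), |Q' p| ≤ A := by
    filter_upwards [hlim, ae_all_iff.2 hA] with p h1 h2
    exact le_of_tendsto h1.abs (Eventually.of_forall h2)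
  have hi : ∀ n, Integrable (fun p : ℝ × Phase d => u p.1 p.2 * Q n p) (timePhaseMeasure Ω d T) :=
    fun n => hu.integrable.mul_bdd (c := A) (hQ n) (hA n)
  have hi' : Integrable (fun p : ℝ × Phase d => u p.1 p.2 * Q' p) (timePhaseMeasure Ω d T) :=
    hu.integrable.mul_bdd (c := A) hQ'm hQ'A
  refine ⟨hi', ?_⟩
  have e : ∀ n, ∫ s in a..b, ∫ z, u s z * Q n (s, z) ∂(phaseMeasure Ω d) =
      ∫ p, u p.1 p.2 * Q n p ∂(((volume : Measure ℝ).restrict (Ioc a b)).prod (phaseMeasure Ω d)) :=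
    fun n => intervalIntegral_integral_eq (hi n) ha hab hb
  have e' : ∫ s in a..b, ∫ z, u s z * Q' (s, z) ∂(phaseMeasure Ω d) =
      ∫ p, u p.1 p.2 * Q' p ∂(((volume : Measure ℝ).restrict (Ioc a b)).prod (phaseMeasure Ω d)) :=
    intervalIntegral_integral_eq hi' ha hab hb
  simp only [e, e']
  have hle := restrict_Ioc_prod_le (d := d) (Ω := Ω) ha hb
  refine tendsto_integral_of_dominated_convergence (fun p => |u p.1 p.2| * A)
    (fun n => (hi n).aestronglyMeasurable.mono_measure hle)
    ((hu.integrable.abs.mul_const A).mono_measure hle) (fun n => ?_) ?_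
  · filter_upwards [ae_mono hle (hA n)] with p hp
    rw [Real.norm_eq_abs, abs_mul]
    exact mul_le_mul_of_nonneg_left hp (abs_nonneg _)
  · filter_upwards [ae_mono hle hlim] with p hp
    exact hp.const_mul _

/-- The pairing of the weak solution with `χ log (f + δ)`. -/
noncomputable def logPairing (Ω : SpatialDomain) (T δ : ℝ) (u f : ℝ → Phase d → ℝ)
    (χ : ℝ × Phase d → ℝ) (t : ℝ) : ℝ :=
  ∫ z, u t z * (χ (t, z) * Real.log (clampTime T f (t, z) + δ)) ∂(phaseMeasure Ω d)

theorem abs_log_add_sub_log_add_le {δ x y : ℝ} (hδ : 0 < δ) (hx : 0 ≤ x) (hy : 0 ≤ y) :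
    |Real.log (x + δ) - Real.log (y + δ)| ≤ |x - y| / δ := by
  have key : ∀ x y : ℝ, 0 ≤ x → 0 ≤ y → Real.log (x + δ) - Real.log (y + δ) ≤ |x - y| / δ := by
    intro x y hx hy
    have h1 : 0 < x + δ := by linarith
    have h2 : 0 < y + δ := by linarith
    rw [← Real.log_div h1.ne' h2.ne']
    refine (Real.log_le_sub_one_of_pos (div_pos h1 h2)).trans ?_
    rw [div_sub_one h2.ne', show x + δ - (y + δ) = x - y by ring]
    calc (x - y) / (y + δ) ≤ |x - y| / (y + δ) := by gcongr; exact le_abs_self _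
      _ ≤ |x - y| / δ := by gcongr; linarith
  rw [abs_le]
  have h1 := key x y hx hy
  have h2 := key y x hy hx
  rw [abs_sub_comm] at h2
  constructor <;> linarith

theorem IsProbDensity.abs_integral_mul_le {w q : Phase d → ℝ} (hw : IsProbDensity Ω w) {C : ℝ}
    (hq : ∀ z : Phase d, z.1 ∈ cell Ω d → |q z| ≤ C) :
    |∫ z, w z * q z ∂(phaseMeasure Ω d)| ≤ C := by
  have h1 : ‖∫ z, w z * q z ∂(phaseMeasure Ω d)‖ ≤ ∫ z, |w z| * C ∂(phaseMeasure Ω d) := by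
    refine norm_integral_le_of_norm_le (hw.integrable.abs.mul_const C) ?_
    filter_upwards [ae_mem_cell] with z hz
    rw [Real.norm_eq_abs, abs_mul]
    exact mul_le_mul_of_nonneg_left (hq z hz) (abs_nonneg _)
  rwa [integral_mul_const, hw.integral_abs, one_mul] at h1

/-- Mollifications of the continuous f converge uniformly on the compact support of χ, log(· + δ) is
Lipschitz with constant 1/δ, and u(t) has mass one. Uniformity in t passes the continuity of the
weak solution in time on to the limit pairing. -/
theorem IsWeakSolution.tendstoUniformlyOn_logTest (hu : IsWeakSolution Ω ε T K u)
    (hf : IsStrongSolution Ω ε T K f gx gv) (hK : MemLp K ∞ (volume : Measure (E d))) (hT : 0 < T)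
    {δ C : ℝ} (hδ : 0 < δ) {χ : ℝ × Phase d → ℝ} (hχ : IsCutoff Ω C χ) :
    TendstoUniformlyOn
      (fun n t => ∫ z, u t z * logTest T δ f χ (mollSeq d n) (t, z) ∂(phaseMeasure Ω d))
      (logPairing Ω T δ u f χ) atTop (Icc 0 T) := by
  obtain ⟨M, hM, hc, -, -, hB⟩ := hf.exists_bound_mollify hK hT
  obtain ⟨R, hR0, hR⟩ := exists_compact_of_support hχ.support
  have hcomp : IsCompact (Icc 0 T ×ˢ
      (Metric.closedBall (0 : E d) R ×ˢ Metric.closedBall (0 : E d) R)) :=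
    isCompact_Icc.prod ((isCompact_closedBall _ _).prod (isCompact_closedBall _ _))
  have hun := tendstoUniformlyOn_mollify (hf.continuous_clampTime hT.le) hcomp
  rw [Metric.tendstoUniformlyOn_iff] at hun ⊢
  intro η hη
  filter_upwards [hun (η * δ / 2) (by positivity)] with n hn t ht
  obtain ⟨C', hC'0, hC'⟩ := (hf.isTest_logTest hT.le hδ hχ.toIsTest (mollSeq d n)).exists_bound T
  have hcl : Continuous fun z : Phase d => χ (t, z) * Real.log (clampTime T f (t, z) + δ) := by
    have h1 : Continuous fun z : Phase d => clampTime T f (t, z) + δ :=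
      ((hf.continuous_clampTime hT.le).comp (by fun_prop)).add continuous_const
    exact (hχ.smooth.continuous.comp (by fun_prop)).mul
      (h1.log fun z => by have := hf.clampTime_pos hT.le (t, z); positivity)
  have hi1 : Integrable (fun z => u t z * logTest T δ f χ (mollSeq d n) (t, z))
      (phaseMeasure Ω d) := by
    refine (hu.probDensity t ht).integrable.mul_bdd (c := C') ?_ ?_
    · exact ((hf.isTest_logTest hT.le hδ hχ.toIsTest
        (mollSeq d n)).smooth.continuous.comp (by fun_prop)).aestronglyMeasurable
    · filter_upwards [ae_mem_cell] with z hz using hC' t ht z hz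
  have hi2 : Integrable (fun z => u t z * (χ (t, z) * Real.log (clampTime T f (t, z) + δ)))
      (phaseMeasure Ω d) := by
    refine (hu.probDensity t ht).integrable.mul_bdd
      (c := |Real.log δ| + |Real.log (M + δ)|) hcl.aestronglyMeasurable
      (Eventually.of_forall fun z => ?_)
    rw [Real.norm_eq_abs, abs_mul, abs_of_nonneg (hχ.nonneg _)]
    refine (mul_le_of_le_one_left (abs_nonneg _) (hχ.le_one _)).trans ?_
    exact abs_log_le hδ (hf.clampTime_pos hT.le _).le (hc _)
  rw [dist_eq_norm, logPairing, ← integral_sub hi2 hi1]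
  simp only [← mul_sub]
  refine ((hu.probDensity t ht).abs_integral_mul_le (C := η / 2) fun z hz => ?_).trans_lt
    (half_lt_self hη)
  rw [logTest, ← mul_sub, abs_mul, abs_of_nonneg (hχ.nonneg _)]
  by_cases h : R < ‖z.1‖ ∨ R < ‖z.2‖
  · rw [hR t z hz h, zero_mul]; positivity
  · push Not at h
    refine (mul_le_of_le_one_left (abs_nonneg _) (hχ.le_one _)).trans ?_
    refine (abs_log_add_sub_log_add_le hδ (hf.clampTime_pos hT.le _).le
      (hf.mollify_clampTime_nonneg hT.le _ _)).trans ?_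
    rw [div_le_iff₀ hδ]
    have := hn (t, z) ⟨ht, by simpa using h.1, by simpa using h.2⟩
    rw [Real.dist_eq] at this
    linarith

theorem IsWeakSolution.continuousOn_logPairing (hu : IsWeakSolution Ω ε T K u)
    (hf : IsStrongSolution Ω ε T K f gx gv) (hK : MemLp K ∞ (volume : Measure (E d))) (hT : 0 < T)
    {δ C : ℝ} (hδ : 0 < δ) {χ : ℝ × Phase d → ℝ} (hχ : IsCutoff Ω C χ) :
    ContinuousOn (logPairing Ω T δ u f χ) (Icc 0 T) :=
  (hu.tendstoUniformlyOn_logTest hf hK hT hδ hχ).continuousOn (Frequently.of_forall fun n =>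
    hu.continuousOn_integral hK (hf.isTest_logTest hT.le hδ hχ.toIsTest (mollSeq d n)))

theorem IsWeakSolution.integral_limitDrift_le (hu : IsWeakSolution Ω ε T K u)
    (hf : IsStrongSolution Ω ε T K f gx gv)
    (hK : MemLp K ∞ (volume : Measure (E d))) (hε : 0 ≤ ε) (hT : 0 < T)
    (hg : IsLocInt Ω T g) (hgw : 0 < ε → IsWeakGradientV Ω T u g)
    (hfin : fisherInfo Ω u g T ≠ ⊤) {δ C : ℝ} (hδ : 0 < δ)
    {χ : ℝ × Phase d → ℝ} (hχ : IsCutoff Ω C χ) {a b t : ℝ} (ha : 0 < a) (hab : a ≤ b)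
    (hb : b < T) (hbt : b ≤ t) (ht : t ≤ T) :
    Integrable (fun p : ℝ × Phase d => u p.1 p.2 * limitDrift Ω ε δ T K u f gx gv χ p)
      (timePhaseMeasure Ω d T) ∧
    (∫ s in a..b, ∫ z, u s z * limitDrift Ω ε δ T K u f gx gv χ (s, z) ∂(phaseMeasure Ω d)) -
        ε * (fisherInfo Ω u g t).toReal ≤
      logPairing Ω T δ u f χ b - logPairing Ω T δ u f χ a := by
  obtain ⟨A, hA⟩ := hu.exists_bound_mollDrift hf hK hε hT hδ hχ
  obtain ⟨h1, h2⟩ := hu.tendsto_intervalIntegral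
    (fun n => hu.aestronglyMeasurable_mollDrift hf hK hT (δ := δ) hχ (mollSeq d n)) (A := A)
    (fun n => by
      filter_upwards [ae_timePhaseMeasure_mem] with p hp
      exact hA _ (mollSeq_rOut_le_one n) p.1 hp.1 p.2 hp.2)
    (hf.ae_tendsto_mollDrift hK hT hδ χ) ha.le hab hb.le
  refine ⟨h1, ?_⟩
  have h3 := hu.tendstoUniformlyOn_logTest hf hK hT hδ hχ
  have hb' : b ∈ Icc 0 T := ⟨ha.le.trans hab, hb.le⟩
  have ha' : a ∈ Icc 0 T := ⟨ha.le, hab.trans hb.le⟩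
  refine le_of_tendsto_of_tendsto (h2.sub_const _)
    ((h3.tendsto_at hb').sub (h3.tendsto_at ha')) ?_
  have hr := tendsto_mollSeq_rOut (d := d)
  filter_upwards [(tendsto_order.1 hr).2 a ha, (tendsto_order.1 hr).2 (T - b) (by linarith)]
    with n hn1 hn2
  exact hu.integral_mollDrift_le hf hK hε hT hg hgw hfin hδ hχ _ (mollSeq_rOut_le_one n) hn1 hab
    (by linarith) hbt ht

/-- Mollification in time restricted the inequality to [a, b] inside (0, T). Continuity of the
pairing and of the primitive of the drift now allows a → 0 and b → t, with t = T included. -/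
theorem IsWeakSolution.integral_limitDrift_le_zero (hu : IsWeakSolution Ω ε T K u)
    (hf : IsStrongSolution Ω ε T K f gx gv)
    (hK : MemLp K ∞ (volume : Measure (E d))) (hε : 0 ≤ ε) (hT : 0 < T)
    (hg : IsLocInt Ω T g) (hgw : 0 < ε → IsWeakGradientV Ω T u g)
    (hfin : fisherInfo Ω u g T ≠ ⊤) {δ C : ℝ} (hδ : 0 < δ)
    {χ : ℝ × Phase d → ℝ} (hχ : IsCutoff Ω C χ) {t : ℝ} (ht0 : 0 ≤ t) (ht : t ≤ T) :
    (∫ s in (0 : ℝ)..t, ∫ z, u s z * limitDrift Ω ε δ T K u f gx gv χ (s, z)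
        ∂(phaseMeasure Ω d)) - ε * (fisherInfo Ω u g t).toReal ≤
      logPairing Ω T δ u f χ t - logPairing Ω T δ u f χ 0 := by
  rcases ht0.eq_or_lt with rfl | ht0
  · have : 0 ≤ ε * (fisherInfo Ω u g 0).toReal := by positivity
    simpa using this
  set I : ℝ → ℝ := fun s => ∫ z, u s z * limitDrift Ω ε δ T K u f gx gv χ (s, z)
    ∂(phaseMeasure Ω d) with hI
  have key := fun (a b : ℝ) (h1 : 0 < a) (h2 : a ≤ b) (h3 : b < T) (h4 : b ≤ t) =>
    hu.integral_limitDrift_le hf hK hε hT hg hgw hfin hδ hχ h1 h2 h3 h4 ht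
  have hint := (key (t / 2) (t / 2) (by positivity) le_rfl (by linarith) (by linarith)).1
  have h0T : (0 : ℝ) ∈ Icc 0 T := ⟨le_rfl, hT.le⟩
  have hii : ∀ b ∈ Icc 0 T, IntervalIntegrable I volume 0 b := fun b hb =>
    intervalIntegrable_of_integrable hint h0T hb
  have hP : ContinuousOn (fun b => ∫ s in (0 : ℝ)..b, I s) (Icc 0 T) := by
    have := intervalIntegral.continuousOn_primitive_interval' (hii T ⟨hT.le, le_rfl⟩) left_mem_uIcc
    rwa [uIcc_of_le hT.le] at this
  have hQ := (hu.continuousOn_logPairing hf hK hT hδ hχ).sub hP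
  -- The shift by 2 gives r_n ≤ t/2, so that [r_n, t − r_n] is an interval for every n.
  set r : ℕ → ℝ := fun n => t / ((n : ℝ) + 2) with hr
  have hr0 : ∀ n, 0 < r n := fun n => by positivity
  have hrt : ∀ n, r n ≤ t / 2 := fun n =>
    div_le_div_of_nonneg_left ht0.le two_pos (by linarith [(Nat.cast_nonneg n : (0 : ℝ) ≤ n)])
  have hrlim : Tendsto r atTop (𝓝 0) :=
    tendsto_const_nhds.div_atTop (tendsto_atTop_add_const_right _ _ tendsto_natCast_atTop_atTop)
  have hlim : ∀ (c : ℝ) (s : ℕ → ℝ), c ∈ Icc 0 T → (∀ n, s n ∈ Icc 0 T) → Tendsto s atTop (𝓝 c) →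
      Tendsto (fun n => logPairing Ω T δ u f χ (s n) - ∫ q in (0 : ℝ)..s n, I q) atTop
        (𝓝 (logPairing Ω T δ u f χ c - ∫ q in (0 : ℝ)..c, I q)) := fun c s hc hs hsc =>
    (hQ c hc).tendsto.comp (tendsto_nhdsWithin_iff.2 ⟨hsc, Eventually.of_forall hs⟩)
  have hm1 : ∀ n, r n ∈ Icc 0 T := fun n => ⟨(hr0 n).le, by linarith [hrt n]⟩
  have hm2 : ∀ n, t - r n ∈ Icc 0 T := fun n => ⟨by linarith [hrt n], by linarith [hr0 n]⟩
  have l1 := hlim 0 r h0T hm1 hrlim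
  have l2 := hlim t (fun n => t - r n) ⟨ht0.le, ht⟩ hm2
    (by simpa using tendsto_const_nhds.sub hrlim)
  have := le_of_tendsto_of_tendsto' (l1.sub_const (ε * (fisherInfo Ω u g t).toReal)) l2
    fun n => by
      have h := (key (r n) (t - r n) (hr0 n) (by linarith [hrt n]) (by linarith [hr0 n])
        (by linarith [hr0 n])).2
      have hs := intervalIntegral.integral_interval_sub_left (hii _ (hm2 n)) (hii _ (hm1 n))
      rw [← hs] at h
      linarith
  simp only [intervalIntegral.integral_same] at this
  linarith

/-- The drift in terms of the strong solution. -/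
theorem limitDrift_eq {δ : ℝ}
    {χ : ℝ × Phase d → ℝ} {p : ℝ × Phase d} (hp : p.1 ∈ Ioo 0 T) (hpc : p.2.1 ∈ cell Ω d) :
    limitDrift Ω ε δ T K u f gx gv χ p =
      χ p / (f p.1 p.2 + δ) * inner ℝ (force Ω K (u p.1) p.2.1 - force Ω K (f p.1) p.2.1)
        (gv p.1 p.2) + Real.log (f p.1 p.2 + δ) *
          (fderiv ℝ χ p (0, (p.2.2, force Ω K (u p.1) p.2.1)) +
            ε * ∑ i, dirD (vUnit i) (dirD (vUnit i) χ) p) := by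
  obtain ⟨t, z⟩ := p
  simp only at hp hpc
  rw [limitDrift, drift, clampTime_of_mem (Ioo_subset_Icc_self hp), extend_of_mem hp,
    extend_of_mem hp, extend_of_mem hp, fold_of_mem_cell hpc, transport, inner_sub_left]
  ring

end RegularizedLimit


/-! ### A sequence of cut-offs with vanishing errors -/

section CutoffSequence

open Filter Topology

variable {d : ℕ} {Ω : SpatialDomain}

/-- Products of rescaled functions of `x` and `v`. -/
noncomputable def sepFun (α β : ℝ) (ψ₁ ψ₂ : E d → ℝ) (p : ℝ × Phase d) : ℝ :=
  ψ₁ (α • p.2.1) * ψ₂ (β • p.2.2)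

theorem contDiff_sepFun (α β : ℝ) {ψ₁ ψ₂ : E d → ℝ} (h₁ : ContDiff ℝ ∞ ψ₁) (h₂ : ContDiff ℝ ∞ ψ₂) :
    ContDiff ℝ ∞ (sepFun α β ψ₁ ψ₂) :=
  (h₁.comp ((contDiff_fst.comp contDiff_snd).const_smul α)).mul
    (h₂.comp ((contDiff_snd.comp contDiff_snd).const_smul β))

theorem fderiv_sepFun (α β : ℝ) {ψ₁ ψ₂ : E d → ℝ} (h₁ : ContDiff ℝ ∞ ψ₁) (h₂ : ContDiff ℝ ∞ ψ₂)
    (p : ℝ × Phase d) (s : ℝ) (h k : E d) :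
    fderiv ℝ (sepFun α β ψ₁ ψ₂) p (s, (h, k)) =
      ψ₁ (α • p.2.1) * (β * fderiv ℝ ψ₂ (β • p.2.2) k) +
        ψ₂ (β • p.2.2) * (α * fderiv ℝ ψ₁ (α • p.2.1) h) := by
  have l1 : HasFDerivAt (fun p : ℝ × Phase d => α • p.2.1)
      (α • (ContinuousLinearMap.fst ℝ (E d) (E d)).comp (ContinuousLinearMap.snd ℝ ℝ (Phase d))) p :=
    ((ContinuousLinearMap.fst ℝ (E d) (E d)).comp
      (ContinuousLinearMap.snd ℝ ℝ (Phase d))).hasFDerivAt.const_smul α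
  have l2 : HasFDerivAt (fun p : ℝ × Phase d => β • p.2.2)
      (β • (ContinuousLinearMap.snd ℝ (E d) (E d)).comp (ContinuousLinearMap.snd ℝ ℝ (Phase d))) p :=
    ((ContinuousLinearMap.snd ℝ (E d) (E d)).comp
      (ContinuousLinearMap.snd ℝ ℝ (Phase d))).hasFDerivAt.const_smul β
  have e : fderiv ℝ (sepFun α β ψ₁ ψ₂) p = _ :=
    (((h₁.differentiable_infty (α • p.2.1)).hasFDerivAt.comp p l1).mul
      ((h₂.differentiable_infty (β • p.2.2)).hasFDerivAt.comp p l2)).fderiv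
  rw [e]
  simp

theorem dirD_velocity_sepFun (α β : ℝ) {ψ₁ ψ₂ : E d → ℝ} (h₁ : ContDiff ℝ ∞ ψ₁)
    (h₂ : ContDiff ℝ ∞ ψ₂) (k : E d) :
    dirD (0, (0, k)) (sepFun α β ψ₁ ψ₂) = sepFun α β ψ₁ (fun v => β * fderiv ℝ ψ₂ v k) := by
  funext p
  rw [dirD, fderiv_sepFun α β h₁ h₂, sepFun]
  simp

theorem dirD_vUnit_sepFun (α β : ℝ) {ψ₁ ψ₂ : E d → ℝ} (h₁ : ContDiff ℝ ∞ ψ₁)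
    (h₂ : ContDiff ℝ ∞ ψ₂) (i : Fin d) :
    dirD (vUnit i) (sepFun α β ψ₁ ψ₂) =
      sepFun α β ψ₁ (fun v => β * fderiv ℝ ψ₂ v (EuclideanSpace.single i (1 : ℝ))) :=
  dirD_velocity_sepFun α β h₁ h₂ _

/-- A bump function on `ℝ^d`. -/
noncomputable def baseBump (d : ℕ) : ContDiffBump (0 : E d) := ⟨1, 2, one_pos, one_lt_two⟩

theorem exists_bound_baseBump (d : ℕ) : ∃ D : ℝ, 0 ≤ D ∧
    (∀ (x h : E d), |fderiv ℝ (baseBump d) x h| ≤ D * ‖h‖) ∧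
    ∀ x : E d, |∑ i, fderiv ℝ (fun v => fderiv ℝ (baseBump d) v (EuclideanSpace.single i (1 : ℝ))) x
      (EuclideanSpace.single i (1 : ℝ))| ≤ D := by
  have hc : ContDiff ℝ ∞ (baseBump d) := (baseBump d).contDiff
  have hs : HasCompactSupport (baseBump d) := (baseBump d).hasCompactSupport
  obtain ⟨D, hD⟩ := (hs.fderiv ℝ).exists_bound_of_continuous (hc.continuous_fderiv (by simp))
  have hc2 : ∀ i : Fin d, ContDiff ℝ ∞ (fun v => fderiv ℝ (baseBump d) v
      (EuclideanSpace.single i (1 : ℝ))) := fun i =>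
    (hc.fderiv_right (by simp)).clm_apply contDiff_const
  have hs2 : ∀ i : Fin d, HasCompactSupport (fun v => fderiv ℝ (baseBump d) v
      (EuclideanSpace.single i (1 : ℝ))) := fun i => hs.fderiv_apply ℝ _
  have hex : ∀ i : Fin d, ∃ D : ℝ, ∀ x, ‖fderiv ℝ (fun v => fderiv ℝ (baseBump d) v
      (EuclideanSpace.single i (1 : ℝ))) x (EuclideanSpace.single i (1 : ℝ))‖ ≤ D := fun i =>
    ((hs2 i).fderiv_apply ℝ _).exists_bound_of_continuous
      (((hc2 i).continuous_fderiv (by simp)).clm_apply continuous_const)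
  choose D' hD' using hex
  have hD0 : 0 ≤ D := (norm_nonneg _).trans (hD 0)
  have hD0' : ∀ i, 0 ≤ D' i := fun i => (norm_nonneg _).trans (hD' i 0)
  refine ⟨D + ∑ i, D' i, add_nonneg hD0 (Finset.sum_nonneg fun i _ => hD0' i),
    fun x h => ?_, fun x => ?_⟩
  · refine ((fderiv ℝ (baseBump d) x).le_opNorm h).trans (mul_le_mul_of_nonneg_right ?_ (norm_nonneg _))
    exact (hD x).trans (le_add_of_nonneg_right (Finset.sum_nonneg fun i _ => hD0' i))
  · refine (Finset.abs_sum_le_sum_abs _ _).trans ?_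
    refine (Finset.sum_le_sum fun i _ => hD' i x).trans (le_add_of_nonneg_left hD0)

/-- The scale of the cut-off in position. -/
def spaceScale (Ω : SpatialDomain) (β : ℝ) : ℝ :=
  match Ω with
  | .wholeSpace => β ^ 2
  | .torus => 0

theorem spaceScale_nonneg {β : ℝ} : 0 ≤ spaceScale Ω β := by
  cases Ω with
  | wholeSpace => exact sq_nonneg β
  | torus => exact le_rfl

theorem spaceScale_le {β : ℝ} : spaceScale Ω β ≤ β ^ 2 := by
  cases Ω with
  | wholeSpace => exact le_rfl
  | torus => exact sq_nonneg β

/-- A cut-off at scale `1 / β` in velocity. -/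
noncomputable def cutoff (Ω : SpatialDomain) (d : ℕ) (β : ℝ) : ℝ × Phase d → ℝ :=
  sepFun (spaceScale Ω β) β (baseBump d) (baseBump d)

theorem baseBump_eq_zero {x : E d} (hx : 2 < ‖x‖) : baseBump d x = 0 :=
  (baseBump d).zero_of_le_dist (by rw [dist_zero_right]; exact hx.le)

/-- The position is rescaled by β² and the velocity by β: the transport error v·∇_x χ is of order
β²|v|, and |v| ≤ 2/β on the support makes it of order β. On the torus no cut-off in position is
needed, and scale 0 makes χ independent of x. -/
theorem exists_isCutoff (Ω : SpatialDomain) (d : ℕ) : ∃ D : ℝ, 0 ≤ D ∧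
    ∀ β : ℝ, 0 < β → β ≤ 1 → IsCutoff Ω (D * β) (cutoff Ω d β) := by
  obtain ⟨D, hD0, hD1, hD2⟩ := exists_bound_baseBump d
  have hc : ContDiff ℝ ∞ (baseBump d) := (baseBump d).contDiff
  have h0 : ∀ x, 0 ≤ baseBump d x := fun x => (baseBump d).nonneg
  have h1 : ∀ x, baseBump d x ≤ 1 := fun x => (baseBump d).le_one
  refine ⟨2 * D, by positivity, fun β hβ hβ1 => ⟨⟨contDiff_sepFun _ _ hc hc, ?_, ?_⟩,
    fun t z => rfl, fun p => mul_nonneg (h0 _) (h0 _),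
    fun p => mul_le_one₀ (h1 _) (h0 _) (h1 _), fun p y => ?_, fun p => ?_⟩⟩
  · rintro rfl i p
    simp [cutoff, sepFun, spaceScale, xUnit]
  -- The position support has radius 2/β², and the velocity support has the smaller radius 2/β since
  -- β ≤ 1.
  · refine ⟨2 / β ^ 2, fun t x v h => ?_⟩
    rcases h with h | ⟨rfl, h⟩
    · have : 2 < ‖β • v‖ := by
        rw [norm_smul, Real.norm_of_nonneg hβ.le]
        rw [div_lt_iff₀ (by positivity)] at h
        nlinarith [norm_nonneg v]
      simp only [cutoff, sepFun, baseBump_eq_zero this, mul_zero]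
    · have : 2 < ‖β ^ 2 • x‖ := by
        rw [norm_smul, Real.norm_of_nonneg (by positivity)]
        rw [div_lt_iff₀ (by positivity)] at h
        linarith
      simp only [cutoff, sepFun, spaceScale, baseBump_eq_zero this, zero_mul]
  · rw [cutoff, fderiv_sepFun _ _ hc hc]
    refine (abs_add_le _ _).trans ?_
    have e1 : |baseBump d (spaceScale Ω β • p.2.1) *
        (β * fderiv ℝ (baseBump d) (β • p.2.2) y)| ≤ β * (D * ‖y‖) := by
      rw [abs_mul, abs_mul, abs_of_pos hβ, abs_of_nonneg (h0 _)]
      exact (mul_le_of_le_one_left (by positivity) (h1 _)).trans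
        (mul_le_mul_of_nonneg_left (hD1 _ _) hβ.le)
    have e2 : |baseBump d (β • p.2.2) * (spaceScale Ω β *
        fderiv ℝ (baseBump d) (spaceScale Ω β • p.2.1) p.2.2)| ≤ 2 * D * β := by
      by_cases h : 2 < ‖β • p.2.2‖
      · rw [baseBump_eq_zero h, zero_mul, abs_zero]; positivity
      · rw [not_lt, norm_smul, Real.norm_of_nonneg hβ.le] at h
        rw [abs_mul, abs_mul, abs_of_nonneg spaceScale_nonneg, abs_of_nonneg (h0 _)]
        calc _ ≤ spaceScale Ω β * |fderiv ℝ (baseBump d) (spaceScale Ω β • p.2.1) p.2.2| :=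
              mul_le_of_le_one_left (mul_nonneg spaceScale_nonneg (abs_nonneg _)) (h1 _)
          _ ≤ β ^ 2 * (D * ‖p.2.2‖) := mul_le_mul spaceScale_le (hD1 _ _) (abs_nonneg _)
              (by positivity)
          _ = D * β * (β * ‖p.2.2‖) := by ring
          _ ≤ D * β * 2 := mul_le_mul_of_nonneg_left h (by positivity)
          _ = 2 * D * β := by ring
    have : 0 ≤ β * (D * ‖y‖) := by positivity
    linarith
  · have hc2 : ∀ i : Fin d, ContDiff ℝ ∞ (fun v => β * fderiv ℝ (baseBump d) v
        (EuclideanSpace.single i (1 : ℝ))) := fun i =>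
      contDiff_const.mul ((hc.fderiv_right (by simp)).clm_apply contDiff_const)
    have e1 : ∑ i, dirD (vUnit i) (dirD (vUnit i) (cutoff Ω d β)) p =
        baseBump d (spaceScale Ω β • p.2.1) * (β ^ 2 * ∑ i, fderiv ℝ (fun v =>
          fderiv ℝ (baseBump d) v (EuclideanSpace.single i (1 : ℝ))) (β • p.2.2)
            (EuclideanSpace.single i (1 : ℝ))) := by
      rw [Finset.mul_sum, Finset.mul_sum]
      refine Finset.sum_congr rfl fun i _ => ?_
      rw [cutoff, dirD_vUnit_sepFun _ _ hc hc, dirD_vUnit_sepFun _ _ hc (hc2 i), sepFun]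
      have hd : DifferentiableAt ℝ (fun v => fderiv ℝ (baseBump d) v
          (EuclideanSpace.single i (1 : ℝ))) (β • p.2.2) :=
        ContDiff.differentiable_infty
          ((hc.fderiv_right (by simp)).clm_apply contDiff_const) _
      rw [fderiv_const_mul hd]
      simp only [_root_.smul_apply, smul_eq_mul]
      ring
    rw [e1, abs_mul, abs_mul, abs_of_nonneg (h0 _), abs_of_nonneg (sq_nonneg β)]
    calc _ ≤ β ^ 2 * |_| := mul_le_of_le_one_left (by positivity) (h1 _)
      _ ≤ β * D := mul_le_mul (by nlinarith) (hD2 _) (abs_nonneg _) hβ.le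
      _ ≤ 2 * D * β := by nlinarith [mul_nonneg hD0 hβ.le]

theorem tendsto_cutoff (p : ℝ × Phase d) :
    Tendsto (fun n : ℕ => cutoff Ω d (1 / ((n : ℝ) + 1)) p) atTop (𝓝 1) := by
  have h1 : Tendsto (fun n : ℕ => 1 / ((n : ℝ) + 1)) atTop (𝓝 0) :=
    tendsto_one_div_add_atTop_nhds_zero_nat
  have h2 : Tendsto (fun n : ℕ => spaceScale Ω (1 / ((n : ℝ) + 1))) atTop (𝓝 0) :=
    squeeze_zero (fun n => spaceScale_nonneg) (fun n => spaceScale_le) (by simpa using h1.pow 2)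
  have hb : Tendsto (baseBump d) (𝓝 0) (𝓝 1) := by
    have : baseBump d 0 = 1 := (baseBump d).one_of_mem_closedBall (by simp [(baseBump d).rIn_pos.le])
    rw [← this]
    exact (baseBump d).continuous.tendsto 0
  have h3 : Tendsto (fun n : ℕ => spaceScale Ω (1 / ((n : ℝ) + 1)) • p.2.1) atTop (𝓝 0) := by
    simpa using h2.smul_const p.2.1
  have h4 : Tendsto (fun n : ℕ => (1 / ((n : ℝ) + 1)) • p.2.2) atTop (𝓝 0) := by
    simpa using h1.smul_const p.2.2
  simpa [cutoff, sepFun] using (hb.comp h3).mul (hb.comp h4)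

end CutoffSequence

/-! ### The entropy inequality relative to f + δ -/

section PartA

open Filter Topology

variable {d : ℕ} {Ω : SpatialDomain} {ε T : ℝ} {K : E d → E d} {u : ℝ → Phase d → ℝ}
  {f : ℝ → Phase d → ℝ} {gx gv : ℝ → Phase d → E d} {g : ℝ → Phase d → E d}

theorem IsStrongSolution.exists_bound_clampTime (hf : IsStrongSolution Ω ε T K f gx gv)
    (hT : 0 < T) :
    ∃ M : ℝ, 0 ≤ M ∧ (∀ t ∈ Icc 0 T, ∀ z, f t z ≤ M) ∧
      ∀ᵐ p ∂(timePhaseMeasure Ω d T), ‖gv p.1 p.2‖ ≤ M := by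
  obtain ⟨M, hM, h1, h2, h3⟩ := hf.exists_bound
  refine ⟨M, hM, fun t ht z => ?_, h2⟩
  have := hf.clampTime_le hT h3 (t, z)
  rwa [clampTime_of_mem ht] at this

theorem ae_timePhaseMeasure_mem_Ioo :
    ∀ᵐ p ∂(timePhaseMeasure Ω d T), p.1 ∈ Ioo 0 T ∧ p.2.1 ∈ cell Ω d := by
  have h : ∀ᵐ t ∂((volume : Measure ℝ).restrict (Icc 0 T)), t ∈ Ioo 0 T := by
    rw [← Measure.restrict_congr_set Ioo_ae_eq_Icc]
    exact ae_restrict_mem measurableSet_Ioo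
  filter_upwards [Measure.quasiMeasurePreserving_fst.ae h, ae_timePhaseMeasure_mem] with p h1 h2
    using ⟨h1, h2.2⟩

theorem IsStrongSolution.continuous_log_add (hf : IsStrongSolution Ω ε T K f gx gv)
    (hT : 0 ≤ T) {δ : ℝ} (hδ : 0 < δ) {s : ℝ} (hs : s ∈ Icc 0 T) :
    Continuous fun z => Real.log (f s z + δ) := by
  have h1 : Continuous fun z : Phase d => clampTime T f (s, z) :=
    (hf.continuous_clampTime hT).comp (by fun_prop)
  simp only [clampTime_of_mem hs] at h1
  exact (h1.add continuous_const).log fun z => (add_pos (hf.pos s hs z) hδ).ne'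

theorem IsWeakSolution.tendsto_logPairing (hu : IsWeakSolution Ω ε T K u)
    (hf : IsStrongSolution Ω ε T K f gx gv) (hT : 0 < T) {δ : ℝ} (hδ : 0 < δ) {s : ℝ}
    (hs : s ∈ Icc 0 T) {χ : ℕ → ℝ × Phase d → ℝ} {C : ℕ → ℝ} (hχ : ∀ n, IsCutoff Ω (C n) (χ n))
    (hlim : ∀ p, Tendsto (fun n => χ n p) atTop (𝓝 1)) :
    Tendsto (fun n => logPairing Ω T δ u f (χ n) s) atTop
      (𝓝 (∫ z, u s z * Real.log (f s z + δ) ∂(phaseMeasure Ω d))) := by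
  obtain ⟨M, hM, hfM, -⟩ := hf.exists_bound_clampTime hT
  have hcs := hf.continuous_log_add hT.le hδ hs
  have hui := (hu.probDensity s hs).integrable
  simp only [logPairing, clampTime_of_mem hs]
  refine tendsto_integral_of_dominated_convergence
    (fun z => |u s z| * (|Real.log δ| + |Real.log (M + δ)|)) (fun n => ?_)
    (hui.abs.mul_const _) (fun n => ?_) ?_
  · have hc : Continuous fun z : Phase d => χ n (s, z) * Real.log (f s z + δ) :=
      ((hχ n).smooth.continuous.comp (by fun_prop)).mul hcs
    exact hui.aestronglyMeasurable.mul hc.aestronglyMeasurable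
  · refine Eventually.of_forall fun z => ?_
    rw [Real.norm_eq_abs, abs_mul, abs_mul, abs_of_nonneg ((hχ n).nonneg _)]
    exact mul_le_mul_of_nonneg_left ((mul_le_of_le_one_left (abs_nonneg _)
      ((hχ n).le_one _)).trans (abs_log_le hδ (hf.pos s hs z).le (hfM s hs z))) (abs_nonneg _)
  · refine Eventually.of_forall fun z => ?_
    have := ((hlim (s, z)).mul_const (Real.log (f s z + δ))).const_mul (u s z)
    simpa only [one_mul] using this

/-- The entropy inequality relative to `f + δ`. -/
theorem IsWeakSolution.entropy_sub_le (hu : IsWeakSolution Ω ε T K u)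
    (hf : IsStrongSolution Ω ε T K f gx gv)
    (hK : MemLp K ∞ (volume : Measure (E d))) (hε : 0 ≤ ε) (hT : 0 < T)
    (hdis : EntropyDissipation Ω ε T u) {δ : ℝ} (hδ : 0 < δ) {t : ℝ} (ht : t ∈ Icc 0 T) :
    Integrable (fun p : ℝ × Phase d => u p.1 p.2 * ((f p.1 p.2 + δ)⁻¹ *
      inner ℝ (force Ω K (u p.1) p.2.1 - force Ω K (f p.1) p.2.1) (gv p.1 p.2)))
      (timePhaseMeasure Ω d T) ∧
    entropy Ω (u t) - ∫ z, u t z * Real.log (f t z + δ) ∂(phaseMeasure Ω d) ≤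
      entropy Ω (u 0) - ∫ z, u 0 z * Real.log (f 0 z + δ) ∂(phaseMeasure Ω d) -
        ∫ s in (0 : ℝ)..t, ∫ z, u s z * ((f s z + δ)⁻¹ *
          inner ℝ (force Ω K (u s) z.1 - force Ω K (f s) z.1) (gv s z)) ∂(phaseMeasure Ω d) := by
  obtain ⟨g, hg, hgw, hfin, hle⟩ := hdis.exists_gradient hε hT.le
  obtain ⟨M, hM, hfM, hgM⟩ := hf.exists_bound_clampTime hT
  obtain ⟨D, hD0, hcut⟩ := exists_isCutoff Ω d
  have hβ : ∀ n : ℕ, (0 : ℝ) < 1 / ((n : ℝ) + 1) := fun n => by positivity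
  have hβ1 : ∀ n : ℕ, 1 / ((n : ℝ) + 1) ≤ 1 := fun n => by
    rw [div_le_one (by positivity)]; linarith [(Nat.cast_nonneg n : (0 : ℝ) ≤ n)]
  have hβlim : Tendsto (fun n : ℕ => 1 / ((n : ℝ) + 1)) atTop (𝓝 0) :=
    tendsto_one_div_add_atTop_nhds_zero_nat
  set χ : ℕ → ℝ × Phase d → ℝ := fun n => cutoff Ω d (1 / ((n : ℝ) + 1)) with hχdef
  have hχ : ∀ n : ℕ, IsCutoff Ω (D * (1 / ((n : ℝ) + 1))) (χ n) := fun n => hcut _ (hβ n) (hβ1 n)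
  have h0T : (0 : ℝ) ∈ Icc 0 T := ⟨le_rfl, hT.le⟩
  have hκ : 0 ≤ supNorm K := supNorm_nonneg
  have hforce : ∀ s ∈ Icc 0 T, ∀ z : Phase d,
      ‖force Ω K (u s) z.1 - force Ω K (f s) z.1‖ ≤ 2 * supNorm K := fun s hs z => by
    have h1 := (hu.probDensity s hs).norm_force_le hK z.1
    have h2 := (hf.probDensity s hs).norm_force_le hK z.1
    have := norm_sub_le (force Ω K (u s) z.1) (force Ω K (f s) z.1)
    linarith
  set L : ℝ := |Real.log δ| + |Real.log (M + δ)| with hL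
  have hlog : ∀ s ∈ Icc 0 T, ∀ z, |Real.log (f s z + δ)| ≤ L := fun s hs z =>
    abs_log_le hδ (hf.pos s hs z).le (hfM s hs z)
  have hL0 : 0 ≤ L := by positivity
  -- Derivatives falling on the cut-off are of order 1/(n+1); since log(f + δ) is bounded for fixed
  -- δ, these terms vanish in the limit.
  have herr : ∀ n : ℕ, ∀ p : ℝ × Phase d, p.1 ∈ Icc 0 T →
      |fderiv ℝ (χ n) p (0, (p.2.2, force Ω K (u p.1) p.2.1)) +
        ε * ∑ i, dirD (vUnit i) (dirD (vUnit i) (χ n)) p| ≤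
      D * (1 / ((n : ℝ) + 1)) * (1 + supNorm K + ε) := by
    intro n p hp
    have hC : 0 ≤ D * (1 / ((n : ℝ) + 1)) := mul_nonneg hD0 (hβ n).le
    have h1 := (hχ n).bound_fderiv p (force Ω K (u p.1) p.2.1)
    have h2 := mul_le_mul_of_nonneg_left ((hu.probDensity p.1 hp).norm_force_le hK p.2.1) hC
    have h3 := mul_le_mul_of_nonneg_left ((hχ n).bound_laplacian p) hε
    refine (abs_add_le _ _).trans ?_
    rw [abs_mul, abs_of_nonneg hε]
    nlinarith
  set Q' : ℝ × Phase d → ℝ := fun p => (f p.1 p.2 + δ)⁻¹ *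
      inner ℝ (force Ω K (u p.1) p.2.1 - force Ω K (f p.1) p.2.1) (gv p.1 p.2) with hQ'
  have hQm : ∀ n, AEStronglyMeasurable (limitDrift Ω ε δ T K u f gx gv (χ n))
      (timePhaseMeasure Ω d T) := by
    intro n
    have hac := timePhaseMeasure_absolutelyContinuous (d := d) (Ω := Ω) (T := T)
    exact hu.aestronglyMeasurable_drift hK (hχ n)
      (hf.continuous_clampTime hT.le).aestronglyMeasurable
      ((aestronglyMeasurable_extend hf.measurable_gx).mono_ac hac)
      ((aestronglyMeasurable_extend hf.measurable_gv).mono_ac hac)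
      ((aestronglyMeasurable_extend (hf.aestronglyMeasurable_transport hK)).mono_ac hac)
  have hQA : ∀ n, ∀ᵐ p ∂(timePhaseMeasure Ω d T),
      |limitDrift Ω ε δ T K u f gx gv (χ n) p| ≤
        1 / δ * (2 * supNorm K * M) + L * (D * 1 * (1 + supNorm K + ε)) := by
    intro n
    filter_upwards [ae_timePhaseMeasure_mem_Ioo, hgM] with p hp hgp
    have hp' := Ioo_subset_Icc_self hp.1
    have hfp := hf.pos _ hp' p.2
    rw [limitDrift_eq hp.1 hp.2]
    refine (abs_add_le _ _).trans (add_le_add ?_ ?_)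
    · rw [abs_mul]
      refine mul_le_mul ?_ ?_ (abs_nonneg _) (by positivity)
      · rw [abs_of_nonneg (div_nonneg ((hχ n).nonneg _) (by linarith))]
        exact div_le_div₀ zero_le_one ((hχ n).le_one _) hδ (by linarith)
      · exact (abs_real_inner_le_norm _ _).trans
          (mul_le_mul (hforce _ hp' _) hgp (norm_nonneg _) (by linarith))
    · rw [abs_mul]
      refine mul_le_mul (hlog _ hp' _) ((herr n p hp').trans ?_) (abs_nonneg _) hL0
      exact mul_le_mul_of_nonneg_right (mul_le_mul_of_nonneg_left (hβ1 n) hD0) (by linarith)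
  have hlim : ∀ᵐ p ∂(timePhaseMeasure Ω d T), Tendsto
      (fun n => limitDrift Ω ε δ T K u f gx gv (χ n) p) atTop (𝓝 (Q' p)) := by
    filter_upwards [ae_timePhaseMeasure_mem_Ioo] with p hp
    have hp' := Ioo_subset_Icc_self hp.1
    simp only [limitDrift_eq hp.1 hp.2]
    have h1 : Tendsto (fun n => χ n p / (f p.1 p.2 + δ) *
        inner ℝ (force Ω K (u p.1) p.2.1 - force Ω K (f p.1) p.2.1) (gv p.1 p.2)) atTop
        (𝓝 (1 / (f p.1 p.2 + δ) *
        inner ℝ (force Ω K (u p.1) p.2.1 - force Ω K (f p.1) p.2.1) (gv p.1 p.2))) :=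
      ((tendsto_cutoff p).div_const _).mul_const _
    have h2 : Tendsto (fun n => fderiv ℝ (χ n) p (0, (p.2.2, force Ω K (u p.1) p.2.1)) +
        ε * ∑ i, dirD (vUnit i) (dirD (vUnit i) (χ n)) p) atTop (𝓝 0) := by
      refine squeeze_zero_norm (fun n => herr n p hp') ?_
      simpa using (hβlim.const_mul D).mul_const (1 + supNorm K + ε)
    have h3 := h1.add (h2.const_mul (Real.log (f p.1 p.2 + δ)))
    simpa only [mul_zero, add_zero, one_div] using h3
  obtain ⟨hi, hconv⟩ := hu.tendsto_intervalIntegral hQm hQA hlim le_rfl ht.1 ht.2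
  refine ⟨hi, ?_⟩
  have hpair : ∀ s ∈ Icc 0 T, Tendsto (fun n => logPairing Ω T δ u f (χ n) s) atTop
      (𝓝 (∫ z, u s z * Real.log (f s z + δ) ∂(phaseMeasure Ω d))) := fun s hs =>
    hu.tendsto_logPairing hf hT hδ hs hχ tendsto_cutoff
  have key := le_of_tendsto_of_tendsto' (hconv.sub_const (ε * (fisherInfo Ω u g t).toReal))
    ((hpair t ht).sub (hpair 0 h0T)) fun n =>
      hu.integral_limitDrift_le_zero hf hK hε hT hg hgw hfin hδ (hχ n) ht.1 ht.2
  -- The Fisher information lost in `key` carries the factor ε, exactly as the dissipation gained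
  -- here; adding the two inequalities cancels it.
  have h1 := hle t ht
  simp only [hQ'] at key
  linarith

end PartA


/-! ### The velocity average of the velocity gradient -/

section VelocityAverage

open Filter Topology

variable {d : ℕ} {Ω : SpatialDomain}

/-- The interior of the fundamental domain. -/
def openCell (Ω : SpatialDomain) (d : ℕ) : Set (E d) :=
  match Ω with
  | .wholeSpace => univ
  | .torus => ⋂ i, {x | x i ∈ Ioo (0 : ℝ) 1}

theorem isOpen_openCell : IsOpen (openCell Ω d) := by
  cases Ω with
  | wholeSpace => exact isOpen_univ
  | torus =>
    exact isOpen_iInter_of_finite fun i => isOpen_Ioo.preimage (by fun_prop)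

theorem openCell_subset_cell : openCell Ω d ⊆ cell Ω d := by
  cases Ω with
  | wholeSpace => exact subset_rfl
  | torus => exact fun x hx i => Ioo_subset_Ico_self (mem_iInter.1 hx i)

theorem volume_coordinate_eq_zero (i : Fin d) : volume {x : E d | x i = 0} = 0 := by
  have h := Measure.addHaar_submodule (volume : Measure (E d))
    (LinearMap.ker (EuclideanSpace.proj (𝕜 := ℝ) i : E d →L[ℝ] ℝ).toLinearMap) (by
      intro htop
      have : (EuclideanSpace.single i (1 : ℝ) : E d) ∈
          LinearMap.ker (EuclideanSpace.proj (𝕜 := ℝ) i : E d →L[ℝ] ℝ).toLinearMap := by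
        rw [htop]; trivial
      simp at this)
  convert h using 2
  ext x
  simp

theorem ae_mem_openCell :
    ∀ᵐ x ∂((volume : Measure (E d)).restrict (cell Ω d)), x ∈ openCell Ω d := by
  rw [ae_restrict_iff' measurableSet_cell]
  cases Ω with
  | wholeSpace => exact Eventually.of_forall fun x _ => mem_univ x
  | torus =>
    have h : ∀ᵐ x : E d, ∀ i, x i ≠ 0 := by
      refine ae_all_iff.2 fun i => ?_
      rw [ae_iff]
      simpa using volume_coordinate_eq_zero i
    filter_upwards [h] with x hx hxc
    exact mem_iInter.2 fun i => ⟨lt_of_le_of_ne (hxc i).1 (hx i).symm, (hxc i).2⟩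

theorem add_lattice_notMem_cell {x : E d} (hx : x ∈ cell .torus d) {n : Fin d → ℤ} (hn : n ≠ 0) :
    x + lattice n ∉ cell .torus d := by
  intro h
  refine hn (funext fun i => ?_)
  have h1 := hx i
  have h2 := h i
  simp only [PiLp.add_apply, lattice_apply, mem_Ico] at h1 h2
  have h3 : (-1 : ℝ) < n i := by linarith [h1.2, h2.1]
  have h4 : (n i : ℝ) < 1 := by linarith [h1.1, h2.2]
  have h5 : -1 < n i := by exact_mod_cast h3
  have h6 : n i < 1 := by exact_mod_cast h4
  simp only [Pi.zero_apply]
  omega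

/-- A function that vanishes outside the cell has non-overlapping translates, so on the cell only
the term n = 0 survives. -/
theorem periodize_sepFun {β : ℝ} {ψ₁ ψ₂ : E d → ℝ} (h : ∀ x, x ∉ cell Ω d → ψ₁ x = 0)
    (t : ℝ) {z : Phase d} (hz : z.1 ∈ cell Ω d) :
    periodize Ω (sepFun 1 β ψ₁ ψ₂) (t, z) = ψ₁ z.1 * ψ₂ (β • z.2) := by
  cases Ω with
  | wholeSpace => simp [periodize, sepFun]
  | torus =>
    change ∑' n : Fin d → ℤ, sepFun 1 β ψ₁ ψ₂ ((t, z) + (0, (lattice n, 0))) = _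
    rw [tsum_eq_single 0]
    · have : lattice (0 : Fin d → ℤ) = 0 := by ext i; simp
      simp [sepFun, this]
    · intro n hn
      simp only [sepFun, Prod.snd_add, Prod.fst_add, one_smul, h _ (add_lattice_notMem_cell hz hn),
        zero_mul]

theorem periodize_time_indep {α β : ℝ} {ψ₁ ψ₂ : E d → ℝ} (p : ℝ × Phase d) :
    periodize Ω (sepFun α β ψ₁ ψ₂) p = periodize Ω (sepFun α β ψ₁ ψ₂) (0, p.2) := by
  cases Ω with
  | wholeSpace => rfl
  | torus => rfl

theorem isBumpLike_sepFun {ψ : E d → ℝ} (hψ : ContDiff ℝ ∞ ψ) (hψc : HasCompactSupport ψ) {β : ℝ}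
    (hβ : 0 < β) : ∃ R, IsBumpLike R (sepFun 1 β ψ (baseBump d)) := by
  obtain ⟨R, hR⟩ := hψc.isCompact.isBounded.subset_closedBall (0 : E d)
  refine ⟨max R (2 / β), contDiff_sepFun _ _ hψ (baseBump d).contDiff, fun t x v h => ?_⟩
  rcases h with h | h
  · have : ψ x = 0 := by
      by_contra hne
      have := hR (subset_tsupport _ hne)
      rw [mem_closedBall_zero_iff] at this
      exact absurd ((le_max_left _ _).trans_lt h) (not_lt.2 this)
    simp only [sepFun, one_smul, this, zero_mul]
  · have h2 : 2 < ‖β • v‖ := by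
      rw [norm_smul, Real.norm_of_nonneg hβ.le]
      have := (le_max_right _ _).trans_lt h
      rw [div_lt_iff₀ hβ] at this
      linarith
    simp only [sepFun, baseBump_eq_zero h2, mul_zero]

variable {w : Phase d → ℝ} {gx gv : Phase d → E d}

theorem IsWeakGradient.integral_sepFun (h : IsWeakGradient Ω w gx gv) {ψ : E d → ℝ}
    (hψ : ContDiff ℝ ∞ ψ) (hψc : HasCompactSupport ψ) (hψ0 : ∀ x, x ∉ cell Ω d → ψ x = 0) {β : ℝ}
    (hβ : 0 < β) (k : E d) :
    ∫ z, w z * (ψ z.1 * (β * fderiv ℝ (baseBump d) (β • z.2) k)) ∂(phaseMeasure Ω d) =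
      -∫ z, ψ z.1 * baseBump d (β • z.2) * inner ℝ (gv z) k ∂(phaseMeasure Ω d) := by
  obtain ⟨R, hB⟩ := isBumpLike_sepFun hψ hψc hβ
  have htest := hB.isTest_periodize (Ω := Ω)
  have h1 := h (fun z => periodize Ω (sepFun 1 β ψ (baseBump d)) (0, z)) (by
    simpa only [← periodize_time_indep] using htest.isTestFunction) 0 k
  have e1 : ∫ z, w z * fderiv ℝ (fun z => periodize Ω (sepFun 1 β ψ (baseBump d)) (0, z)) z (0, k)
      ∂(phaseMeasure Ω d) =
      ∫ z, w z * (ψ z.1 * (β * fderiv ℝ (baseBump d) (β • z.2) k)) ∂(phaseMeasure Ω d) := by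
    refine integral_congr_ae ?_
    filter_upwards [ae_mem_cell] with z hz
    rw [fderiv_phase_slice htest.smooth.differentiable_infty]
    have := congrFun (hB.dirD_periodize (Ω := Ω) (0, (0, k))) (0, z)
    rw [dirD, dirD_velocity_sepFun 1 β hψ (baseBump d).contDiff, periodize_sepFun hψ0 0 hz] at this
    rw [this]
  have e2 : ∫ z, periodize Ω (sepFun 1 β ψ (baseBump d)) (0, z) *
      (inner ℝ (gx z) 0 + inner ℝ (gv z) k) ∂(phaseMeasure Ω d) =
      ∫ z, ψ z.1 * baseBump d (β • z.2) * inner ℝ (gv z) k ∂(phaseMeasure Ω d) := by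
    refine integral_congr_ae ?_
    filter_upwards [ae_mem_cell] with z hz
    rw [periodize_sepFun hψ0 0 hz, inner_zero_right, zero_add]
  rw [← e1, ← e2]
  exact h1

/-- Test the gradient with ψ(x) times a cut-off in v at scale 1/β and let β → 0: the derivative of
the cut-off is of order β and w is integrable, so only the gradient side remains. -/
theorem IsWeakGradient.integral_mul_inner_eq_zero (h : IsWeakGradient Ω w gx gv)
    (hw : Integrable w (phaseMeasure Ω d)) (hgv : Integrable gv (phaseMeasure Ω d)) {ψ : E d → ℝ}
    (hψ : ContDiff ℝ ∞ ψ) (hψc : HasCompactSupport ψ) (hψ0 : ∀ x, x ∉ cell Ω d → ψ x = 0)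
    (k : E d) : ∫ z, ψ z.1 * inner ℝ (gv z) k ∂(phaseMeasure Ω d) = 0 := by
  obtain ⟨C, hC⟩ := hψc.exists_bound_of_continuous hψ.continuous
  have hC0 : 0 ≤ C := (norm_nonneg _).trans (hC 0)
  obtain ⟨D, hD0, hD, -⟩ := exists_bound_baseBump d
  set β : ℕ → ℝ := fun n => 1 / ((n : ℝ) + 1) with hβdef
  have hβ : ∀ n, 0 < β n := fun n => by positivity
  have hβlim : Tendsto β atTop (𝓝 0) := tendsto_one_div_add_atTop_nhds_zero_nat
  have key := fun n => h.integral_sepFun hψ hψc hψ0 (hβ n) k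
  have hb : Tendsto (baseBump d) (𝓝 0) (𝓝 1) := by
    have : baseBump d 0 = 1 := (baseBump d).one_of_mem_closedBall (by simp [(baseBump d).rIn_pos.le])
    rw [← this]
    exact (baseBump d).continuous.tendsto 0
  have hψm : Continuous fun z : Phase d => ψ z.1 := hψ.continuous.comp continuous_fst
  have l1 : Tendsto (fun n => ∫ z, ψ z.1 * baseBump d (β n • z.2) * inner ℝ (gv z) k
      ∂(phaseMeasure Ω d)) atTop (𝓝 (∫ z, ψ z.1 * inner ℝ (gv z) k ∂(phaseMeasure Ω d))) := by
    refine tendsto_integral_of_dominated_convergence (fun z => C * (‖gv z‖ * ‖k‖)) (fun n => ?_)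
      ((hgv.norm.mul_const _).const_mul C) (fun n => ?_) ?_
    · have hc : Continuous fun z : Phase d => ψ z.1 * baseBump d (β n • z.2) :=
        hψm.mul ((baseBump d).continuous.comp (by fun_prop))
      exact hc.aestronglyMeasurable.mul (hgv.aestronglyMeasurable.inner aestronglyMeasurable_const)
    · refine Eventually.of_forall fun z => ?_
      rw [norm_mul, norm_mul]
      refine mul_le_mul ?_ (norm_inner_le_norm _ _) (norm_nonneg _) hC0
      refine (mul_le_of_le_one_right (norm_nonneg _) ?_).trans (hC _)
      rw [Real.norm_of_nonneg (baseBump d).nonneg]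
      exact (baseBump d).le_one
    · refine Eventually.of_forall fun z => ?_
      have h1 : Tendsto (fun n => β n • z.2) atTop (𝓝 0) := by
        simpa using hβlim.smul_const z.2
      have h2 := ((hb.comp h1).const_mul (ψ z.1)).mul_const (inner ℝ (gv z) k)
      simpa only [mul_one, Function.comp_apply] using h2
  have l2 : Tendsto (fun n => ∫ z, w z * (ψ z.1 * (β n * fderiv ℝ (baseBump d) (β n • z.2) k))
      ∂(phaseMeasure Ω d)) atTop (𝓝 0) := by
    refine squeeze_zero_norm (a := fun n => ∫ z, |w z| * (C * (β n * (D * ‖k‖)))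
      ∂(phaseMeasure Ω d)) (fun n => ?_) ?_
    · refine norm_integral_le_of_norm_le (hw.abs.mul_const _) (Eventually.of_forall fun z => ?_)
      rw [norm_mul, norm_mul, norm_mul, Real.norm_of_nonneg (hβ n).le]
      refine mul_le_mul_of_nonneg_left ?_ (abs_nonneg _)
      exact mul_le_mul (hC _) (mul_le_mul_of_nonneg_left (hD _ _) (hβ n).le)
        (mul_nonneg (hβ n).le (norm_nonneg _)) hC0
    · simp only [integral_mul_const]
      have := ((hβlim.mul_const (D * ‖k‖)).const_mul C).const_mul (∫ z, |w z| ∂(phaseMeasure Ω d))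
      simpa only [zero_mul, mul_zero] using this
  simp only [key] at l2
  have := tendsto_nhds_unique l1.neg l2
  linarith

/-- The velocity average of the velocity gradient vanishes. -/
theorem IsWeakGradient.ae_integral_velocity_eq_zero (h : IsWeakGradient Ω w gx gv)
    (hw : Integrable w (phaseMeasure Ω d)) (hgv : Integrable gv (phaseMeasure Ω d)) :
    ∀ᵐ x ∂((volume : Measure (E d)).restrict (cell Ω d)), ∫ v, gv (x, v) = 0 := by
  have hgv' := hgv
  rw [phaseMeasure] at hgv'
  have hm : Integrable (fun x => ∫ v, gv (x, v)) ((volume : Measure (E d)).restrict (cell Ω d)) :=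
    hgv'.integral_prod_left
  -- The fundamental lemma in x is applied on the open cell, where compactly supported ψ can be
  -- periodized without overlap; the removed faces are null.
  have hU := (isOpen_openCell (Ω := Ω) (d := d)).ae_eq_zero_of_integral_contDiff_smul_eq_zero
    (μ := (volume : Measure (E d))) (f := fun x => ∫ v, gv (x, v))
    (IntegrableOn.locallyIntegrableOn
      (IntegrableOn.mono_set (μ := volume) hm openCell_subset_cell)) ?_
  · filter_upwards [ae_mem_openCell, ae_restrict_of_ae hU] with x hx hxU using hxU hx
  · intro ψ hψ hψc hψs
    have hψ0 : ∀ x, x ∉ cell Ω d → ψ x = 0 := fun x hx => by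
      by_contra hne
      exact hx (openCell_subset_cell (hψs (subset_tsupport _ hne)))
    obtain ⟨C, hC⟩ := hψc.exists_bound_of_continuous hψ.continuous
    have hψm : Continuous fun z : Phase d => ψ z.1 := hψ.continuous.comp continuous_fst
    have hi : Integrable (fun z : Phase d => ψ z.1 • gv z) (phaseMeasure Ω d) :=
      hgv.bdd_smul C hψm.aestronglyMeasurable (Eventually.of_forall fun z => hC _)
    have e1 : ∫ x, ψ x • ∫ v, gv (x, v) = ∫ z, ψ z.1 • gv z ∂(phaseMeasure Ω d) := by
      have hi' := hi
      rw [phaseMeasure] at hi' ⊢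
      rw [integral_prod _ hi', ← setIntegral_eq_integral_of_forall_compl_eq_zero (s := cell Ω d)
        fun x hx => by rw [hψ0 x hx, zero_smul]]
      refine integral_congr_ae (Eventually.of_forall fun x => ?_)
      simp only [integral_smul]
    rw [e1]
    refine ext_inner_right ℝ fun k => ?_
    rw [inner_zero_left, real_inner_comm, ← integral_inner hi,
      ← h.integral_mul_inner_eq_zero hw hgv hψ hψc hψ0 k]
    refine integral_congr_ae (Eventually.of_forall fun z => ?_)
    simp only [inner_smul_right, real_inner_comm]

/-- Fubini: b does not depend on v and comes out of the vanishing velocity average. This permits the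
replacement of u by u − f in the drift. -/
theorem IsWeakGradient.integral_inner_eq_zero (h : IsWeakGradient Ω w gx gv)
    (hw : Integrable w (phaseMeasure Ω d)) (hgv : Integrable gv (phaseMeasure Ω d))
    {b : E d → E d} (hb : Integrable (fun z => inner ℝ (b z.1) (gv z)) (phaseMeasure Ω d)) :
    ∫ z, inner ℝ (b z.1) (gv z) ∂(phaseMeasure Ω d) = 0 := by
  have h0 := h.ae_integral_velocity_eq_zero hw hgv
  rw [phaseMeasure] at hb hgv ⊢
  rw [integral_prod _ hb]
  refine integral_eq_zero_of_ae ?_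
  filter_upwards [h0, hgv.prod_right_ae] with x hx hi
  rw [integral_inner hi, hx, inner_zero_right]
  rfl

end VelocityAverage


/-! ### Entropy relative to a shifted density -/

section Shifted

open Filter Topology

variable {d : ℕ} {Ω : SpatialDomain} {u f : Phase d → ℝ} {M : ℝ}

theorem mul_log_div_eq {u w : ℝ} (hu : 0 ≤ u) (hw : 0 < w) :
    u * Real.log (u / w) = u * Real.log u - u * Real.log w := by
  rcases hu.eq_or_lt with rfl | hu
  · simp
  · rw [Real.log_div hu.ne' hw.ne', mul_sub]

/-- The entropy of `u` relative to `f + δ`. -/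
noncomputable def shiftedEntropy (Ω : SpatialDomain) (δ : ℝ) (u f : Phase d → ℝ) : ℝ :=
  ∫ z, u z * Real.log (u z / (f z + δ)) ∂(phaseMeasure Ω d)

theorem IsProbDensity.integrable_mul_log_add (hu : IsProbDensity Ω u) (hfc : Continuous f)
    (hf0 : ∀ z, 0 < f z) (hfM : ∀ z, f z ≤ M) {δ : ℝ} (hδ : 0 < δ) :
    Integrable (fun z => u z * Real.log (f z + δ)) (phaseMeasure Ω d) := by
  refine hu.integrable.mul_bdd (c := |Real.log δ| + |Real.log (M + δ)|) ?_ ?_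
  · exact ((hfc.add continuous_const).log fun z =>
      (add_pos (hf0 z) hδ).ne').aestronglyMeasurable
  · exact Eventually.of_forall fun z => abs_log_le hδ (hf0 z).le (hfM z)

theorem IsProbDensity.shiftedEntropy_eq (hu : IsProbDensity Ω u)
    (he : Integrable (fun z => u z * Real.log (u z)) (phaseMeasure Ω d)) (hfc : Continuous f)
    (hf0 : ∀ z, 0 < f z) (hfM : ∀ z, f z ≤ M) {δ : ℝ} (hδ : 0 < δ) :
    Integrable (fun z => u z * Real.log (u z / (f z + δ))) (phaseMeasure Ω d) ∧
    shiftedEntropy Ω δ u f =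
      entropy Ω u - ∫ z, u z * Real.log (f z + δ) ∂(phaseMeasure Ω d) := by
  have h1 := hu.integrable_mul_log_add hfc hf0 hfM hδ
  have e : (fun z => u z * Real.log (u z / (f z + δ))) =ᵐ[phaseMeasure Ω d]
      fun z => u z * Real.log (u z) - u z * Real.log (f z + δ) := by
    filter_upwards [hu.nonneg] with z hz using mul_log_div_eq hz (add_pos (hf0 z) hδ)
  refine ⟨(he.sub h1).congr e.symm, ?_⟩
  rw [shiftedEntropy, integral_congr_ae e, integral_sub he h1, entropy]

theorem IsProbDensity.integrable_mul_log (hu : IsProbDensity Ω u)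
    (he : Integrable (fun z => u z * Real.log (u z)) (phaseMeasure Ω d))
    (hf0 : ∀ z, 0 < f z)
    (hH : Integrable (fun z => u z * Real.log (u z / f z)) (phaseMeasure Ω d)) :
    Integrable (fun z => u z * Real.log (f z)) (phaseMeasure Ω d) := by
  refine (he.sub hH).congr ?_
  filter_upwards [hu.nonneg] with z hz
  simp only [Pi.sub_apply, mul_log_div_eq hz (hf0 z)]
  ring

theorem IsProbDensity.shiftedEntropy_le (hu : IsProbDensity Ω u)
    (he : Integrable (fun z => u z * Real.log (u z)) (phaseMeasure Ω d)) (hfc : Continuous f)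
    (hf0 : ∀ z, 0 < f z) (hfM : ∀ z, f z ≤ M)
    (hH : Integrable (fun z => u z * Real.log (u z / f z)) (phaseMeasure Ω d))
    {δ : ℝ} (hδ : 0 < δ) :
    shiftedEntropy Ω δ u f ≤ ∫ z, u z * Real.log (u z / f z) ∂(phaseMeasure Ω d) := by
  refine integral_mono_ae (hu.shiftedEntropy_eq he hfc hf0 hfM hδ).1 hH ?_
  filter_upwards [hu.nonneg] with z hz
  simp only [mul_log_div_eq hz (hf0 z), mul_log_div_eq hz (add_pos (hf0 z) hδ)]
  have := mul_le_mul_of_nonneg_left (Real.log_le_log (hf0 z) (le_add_of_nonneg_right hδ.le)) hz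
  linarith

theorem tendsto_log_add (hf0 : ∀ z, 0 < f z) (z : Phase d) :
    Tendsto (fun n : ℕ => Real.log (f z + 1 / ((n : ℝ) + 1))) atTop (𝓝 (Real.log (f z))) := by
  have h := (tendsto_one_div_add_atTop_nhds_zero_nat (𝕜 := ℝ)).const_add (f z)
  rw [add_zero] at h
  exact (Real.continuousAt_log (hf0 z).ne').tendsto.comp h

theorem one_div_succ_pos (n : ℕ) : (0 : ℝ) < 1 / ((n : ℝ) + 1) := by positivity

theorem one_div_succ_le_one (n : ℕ) : 1 / ((n : ℝ) + 1) ≤ 1 := by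
  rw [div_le_one (by positivity)]; linarith [(Nat.cast_nonneg n : (0 : ℝ) ≤ n)]

theorem log_add_le {f δ M : ℝ} (hf : 0 < f) (hfM : f ≤ M) (hδ : 0 < δ) (hδ1 : δ ≤ 1) :
    Real.log (f + δ) ≤ Real.log (1 + M) :=
  Real.log_le_log (by linarith) (by linarith)

/-- Since log f ≤ log(f + δ) ≤ log(1 + M) for δ ≤ 1, dominated convergence applies as soon as u log
f is integrable, which finite entropy and finite relative entropy provide. -/
theorem IsProbDensity.tendsto_shiftedEntropy (hu : IsProbDensity Ω u)
    (he : Integrable (fun z => u z * Real.log (u z)) (phaseMeasure Ω d)) (hfc : Continuous f)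
    (hf0 : ∀ z, 0 < f z) (hfM : ∀ z, f z ≤ M)
    (hH : Integrable (fun z => u z * Real.log (u z / f z)) (phaseMeasure Ω d)) :
    Tendsto (fun n : ℕ => shiftedEntropy Ω (1 / ((n : ℝ) + 1)) u f) atTop
      (𝓝 (∫ z, u z * Real.log (u z / f z) ∂(phaseMeasure Ω d))) := by
  have hl := hu.integrable_mul_log he hf0 hH
  have e : ∫ z, u z * Real.log (u z / f z) ∂(phaseMeasure Ω d) =
      entropy Ω u - ∫ z, u z * Real.log (f z) ∂(phaseMeasure Ω d) := by
    rw [entropy, ← integral_sub he hl]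
    refine integral_congr_ae ?_
    filter_upwards [hu.nonneg] with z hz using mul_log_div_eq hz (hf0 z)
  rw [e]
  simp only [fun n : ℕ => (hu.shiftedEntropy_eq he hfc hf0 hfM (one_div_succ_pos n)).2]
  refine Tendsto.const_sub _ ?_
  refine tendsto_integral_of_dominated_convergence
    (fun z => |u z * Real.log (f z)| + |u z| * |Real.log (1 + M)|)
    (fun n => (hu.integrable_mul_log_add hfc hf0 hfM (one_div_succ_pos n)).aestronglyMeasurable)
    (hl.abs.add (hu.integrable.abs.mul_const _)) (fun n => Eventually.of_forall fun z => ?_)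
    (Eventually.of_forall fun z => (tendsto_log_add hf0 z).const_mul _)
  rw [Real.norm_eq_abs, abs_mul, abs_mul, ← mul_add]
  refine mul_le_mul_of_nonneg_left ?_ (abs_nonneg _)
  have h1 := Real.log_le_log (hf0 z) (le_add_of_nonneg_right (one_div_succ_pos n).le)
  have h2 := log_add_le (hf0 z) (hfM z) (one_div_succ_pos n) (one_div_succ_le_one n)
  rw [abs_le]
  constructor
  · linarith [neg_abs_le (Real.log (f z)), abs_nonneg (Real.log (1 + M))]
  · linarith [le_abs_self (Real.log (1 + M)), abs_nonneg (Real.log (f z))]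

/-- The functions u (log(1 + M) − log(f + δ)) are nonnegative and their integrals are controlled by
the shifted entropies, so Fatou's lemma makes u log f integrable. -/
theorem IsProbDensity.integrable_mul_log_div (hu : IsProbDensity Ω u)
    (he : Integrable (fun z => u z * Real.log (u z)) (phaseMeasure Ω d)) (hfc : Continuous f)
    (hf0 : ∀ z, 0 < f z) (hfM : ∀ z, f z ≤ M) {A : ℝ}
    (hA : ∀ n : ℕ, shiftedEntropy Ω (1 / ((n : ℝ) + 1)) u f ≤ A) :
    Integrable (fun z => u z * Real.log (u z / f z)) (phaseMeasure Ω d) := by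
  set G : ℕ → Phase d → ℝ := fun n z =>
    u z * Real.log (1 + M) - u z * Real.log (f z + 1 / ((n : ℝ) + 1)) with hG
  have hGi : ∀ n, Integrable (G n) (phaseMeasure Ω d) := fun n =>
    (hu.integrable.mul_const _).sub (hu.integrable_mul_log_add hfc hf0 hfM (one_div_succ_pos n))
  have hG0 : ∀ n, ∀ᵐ z ∂(phaseMeasure Ω d), 0 ≤ G n z := fun n => by
    filter_upwards [hu.nonneg] with z hz
    have := mul_le_mul_of_nonneg_left
      (log_add_le (hf0 z) (hfM z) (one_div_succ_pos n) (one_div_succ_le_one n)) hz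
    simp only [hG]
    linarith
  have hGle : ∀ n, ∫⁻ z, ENNReal.ofReal (G n z) ∂(phaseMeasure Ω d) ≤
      ENNReal.ofReal (Real.log (1 + M) + A - entropy Ω u) := fun n => by
    rw [← ofReal_integral_eq_lintegral_ofReal (hGi n) (hG0 n)]
    refine ENNReal.ofReal_le_ofReal ?_
    have h1 := hA n
    rw [(hu.shiftedEntropy_eq he hfc hf0 hfM (one_div_succ_pos n)).2] at h1
    rw [integral_sub (hu.integrable.mul_const _)
      (hu.integrable_mul_log_add hfc hf0 hfM (one_div_succ_pos n)), integral_mul_const, hu.mass]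
    linarith
  have hlim : ∀ z, Tendsto (fun n => G n z) atTop
      (𝓝 (u z * Real.log (1 + M) - u z * Real.log (f z))) := fun z =>
    ((tendsto_log_add hf0 z).const_mul _).const_sub _
  have hfat : ∫⁻ z, ENNReal.ofReal (u z * Real.log (1 + M) - u z * Real.log (f z))
      ∂(phaseMeasure Ω d) ≤ ENNReal.ofReal (Real.log (1 + M) + A - entropy Ω u) := by
    calc _ = ∫⁻ z, liminf (fun n => ENNReal.ofReal (G n z)) atTop ∂(phaseMeasure Ω d) := by
          refine lintegral_congr fun z => ?_
          exact ((ENNReal.tendsto_ofReal (hlim z)).liminf_eq).symm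
      _ ≤ liminf (fun n => ∫⁻ z, ENNReal.ofReal (G n z) ∂(phaseMeasure Ω d)) atTop :=
          lintegral_liminf_le' fun n => (hGi n).aestronglyMeasurable.aemeasurable.ennreal_ofReal
      _ ≤ _ := (liminf_le_liminf (Eventually.of_forall hGle)).trans (liminf_const _).le
  have hlm : AEStronglyMeasurable (fun z => u z * Real.log (f z)) (phaseMeasure Ω d) :=
    hu.integrable.aestronglyMeasurable.mul
      (hfc.log fun z => (hf0 z).ne').aestronglyMeasurable
  have h1 : Integrable (fun z => u z * Real.log (1 + M) - u z * Real.log (f z))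
      (phaseMeasure Ω d) := by
    refine integrable_of_lintegral_ofReal_le
      ((hu.integrable.mul_const _).aestronglyMeasurable.sub hlm) ?_ ENNReal.ofReal_ne_top hfat
    filter_upwards [hu.nonneg] with z hz
    have := mul_le_mul_of_nonneg_left
      (Real.log_le_log (hf0 z) (show f z ≤ 1 + M by linarith [hfM z])) hz
    linarith
  refine ((he.add h1).sub (hu.integrable.mul_const (Real.log (1 + M)))).congr ?_
  filter_upwards [hu.nonneg] with z hz
  simp only [Pi.sub_apply, Pi.add_apply, mul_log_div_eq hz (hf0 z)]
  ring

/-- The velocity gradient of `log (f + δ)` is controlled by the shifted entropy. -/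
theorem IsProbDensity.integral_mul_norm_div_le (hu : IsProbDensity Ω u)
    (he : Integrable (fun z => u z * Real.log (u z)) (phaseMeasure Ω d)) (hfc : Continuous f)
    (hf0 : ∀ z, 0 < f z) (hfM : ∀ z, f z ≤ M) {g : Phase d → E d}
    (hg : AEStronglyMeasurable g (phaseMeasure Ω d)) {N : ℝ}
    (hgN : ∀ᵐ z ∂(phaseMeasure Ω d), ‖g z‖ ≤ N) {lam θ : ℝ} (hlam : 0 < lam) (hθ : 0 ≤ θ)
    (hexp : ∫⁻ z, ENNReal.ofReal (Real.exp (lam * ‖(f z)⁻¹ • g z‖) * f z) ∂(phaseMeasure Ω d) ≤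
      ENNReal.ofReal θ) {δ : ℝ} (hδ : 0 < δ) (hδ1 : δ ≤ 1) :
    Integrable (fun z => u z * (‖g z‖ / (f z + δ))) (phaseMeasure Ω d) ∧
    lam * ∫ z, u z * (‖g z‖ / (f z + δ)) ∂(phaseMeasure Ω d) ≤ shiftedEntropy Ω δ u f +
      (∫ z, |u z * Real.log (u z)| ∂(phaseMeasure Ω d) + Real.log (1 + M) + 2 * θ) := by
  have hm : AEStronglyMeasurable (fun z => Real.exp (lam * ‖(f z)⁻¹ • g z‖) * f z)
      (phaseMeasure Ω d) := by
    have h1 : AEStronglyMeasurable (fun z => (f z)⁻¹ • g z) (phaseMeasure Ω d) :=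
      (hfc.inv₀ fun z => (hf0 z).ne').aestronglyMeasurable.smul hg
    exact (Real.continuous_exp.comp_aestronglyMeasurable (h1.norm.const_mul lam)).mul
      hfc.aestronglyMeasurable
  have h0 : ∀ᵐ z ∂(phaseMeasure Ω d), 0 ≤ Real.exp (lam * ‖(f z)⁻¹ • g z‖) * f z :=
    Eventually.of_forall fun z => mul_nonneg (Real.exp_pos _).le (hf0 z).le
  have hei := integrable_of_lintegral_ofReal_le hm h0 ENNReal.ofReal_ne_top hexp
  have hele := integral_le_of_lintegral_ofReal_le hm h0 hθ hexp
  obtain ⟨hs, -⟩ := hu.shiftedEntropy_eq he hfc hf0 hfM hδ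
  -- For fixed δ the quotient is bounded by N/δ. This is used for integrability only; the
  -- quantitative bound contains neither N nor 1/δ.
  have hi : Integrable (fun z => u z * (‖g z‖ / (f z + δ))) (phaseMeasure Ω d) := by
    refine hu.integrable.mul_bdd (c := N / δ) ?_ ?_
    · exact (hg.norm.aemeasurable.div
        (hfc.add continuous_const).measurable.aemeasurable).aestronglyMeasurable
    · filter_upwards [hgN] with z hz
      have := hf0 z
      rw [norm_div, norm_norm, Real.norm_of_nonneg (by linarith)]
      exact div_le_div₀ ((norm_nonneg _).trans hz) hz hδ (by linarith)
  have hr : Integrable (fun z => |u z * Real.log (u z)| + u z * Real.log (1 + M) +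
      2 * (Real.exp (lam * ‖(f z)⁻¹ • g z‖) * f z)) (phaseMeasure Ω d) :=
    (he.abs.add (hu.integrable.mul_const _)).add (hei.const_mul 2)
  have e : ∫ z, (|u z * Real.log (u z)| + u z * Real.log (1 + M) +
      2 * (Real.exp (lam * ‖(f z)⁻¹ • g z‖) * f z)) ∂(phaseMeasure Ω d) =
      ∫ z, |u z * Real.log (u z)| ∂(phaseMeasure Ω d) + Real.log (1 + M) +
        2 * ∫ z, Real.exp (lam * ‖(f z)⁻¹ • g z‖) * f z ∂(phaseMeasure Ω d) := by
    have ha : Integrable (fun z => |u z * Real.log (u z)| + u z * Real.log (1 + M))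
      (phaseMeasure Ω d) := he.abs.add (hu.integrable.mul_const _)
    rw [integral_add ha (hei.const_mul 2), integral_add he.abs (hu.integrable.mul_const _),
      integral_const_mul, integral_mul_const, hu.mass, one_mul]
  refine ⟨hi, ?_⟩
  calc _ = ∫ z, lam * (u z * (‖g z‖ / (f z + δ))) ∂(phaseMeasure Ω d) :=
        (integral_const_mul _ _).symm
    _ ≤ ∫ z, (u z * Real.log (u z / (f z + δ)) + (|u z * Real.log (u z)| +
        u z * Real.log (1 + M) + 2 * (Real.exp (lam * ‖(f z)⁻¹ • g z‖) * f z)))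
          ∂(phaseMeasure Ω d) := by
        refine integral_mono_ae (hi.const_mul lam) (hs.add hr) ?_
        filter_upwards [hu.nonneg] with z hz
        have := mul_div_add_le hz (hf0 z) (hfM z) hδ hδ1 hlam (norm_nonneg (g z))
        rwa [norm_smul, norm_inv, Real.norm_of_nonneg (hf0 z).le, ← div_eq_inv_mul]
    _ ≤ _ := by
        rw [integral_add hs hr, e, shiftedEntropy]
        linarith

end Shifted


/-! ### Stability of the relative entropy -/

section DriftBound

open Filter Topology

variable {d : ℕ} {Ω : SpatialDomain} {K : E d → E d} {u f : Phase d → ℝ} {gx gv : Phase d → E d}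
  {lam θ : ℝ}

/-- The constant in the stability estimate. -/
noncomputable def stabilityConst (lam : ℝ) : ℝ := 4 * (1 + 2 * Real.exp 1) ^ 2 / lam

theorem stabilityConst_pos (hlam : 0 < lam) : 0 < stabilityConst lam := by
  unfold stabilityConst
  have := Real.exp_pos 1
  positivity

theorem integral_abs_sub_le (hu : IsProbDensity Ω u) (hf : IsProbDensity Ω f)
    (hf0 : ∀ z, 0 < f z)
    (hH : Integrable (fun z => u z * Real.log (u z / f z)) (phaseMeasure Ω d)) :
    ∫ z, |u z - f z| ∂(phaseMeasure Ω d) ≤ 2 * ((1 + 2 * Real.exp 1) *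
      max (Real.sqrt (∫ z, u z * Real.log (u z / f z) ∂(phaseMeasure Ω d)))
        (∫ z, u z * Real.log (u z / f z) ∂(phaseMeasure Ω d))) := by
  -- The constant weight 1/2 makes the exponential moment of 2b exactly e, which gives the
  -- unweighted Pinsker inequality.
  have h := (integral_abs_sub_mul_le (b := fun _ => (1 / 2 : ℝ)) hu.integrable hf.integrable
    hu.nonneg hf0 (by rw [hu.mass, hf.mass]) hH aestronglyMeasurable_const
    (fun _ => by norm_num) ?_).2
  · rw [integral_mul_const] at h
    linarith
  · have e : ∀ z, Real.exp (2 * (1 / 2)) * f z = Real.exp 1 * f z := fun z => by norm_num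
    simp only [e]
    rw [← ofReal_integral_eq_lintegral_ofReal (hf.integrable.const_mul _)
      (Eventually.of_forall fun z => mul_nonneg (Real.exp_pos 1).le (hf0 z).le),
      integral_const_mul, hf.mass, mul_one]

/-- The weighted Pinsker inequality with b = λ|∇_v log f| / (2(1 + log θ)), the scale at which 2b
has exponential moment at most e; undoing the scale gives the factor 2(1 + log θ)/λ. -/
theorem integral_abs_sub_mul_norm_le (hu : IsProbDensity Ω u) (hf : IsProbDensity Ω f)
    (hf0 : ∀ z, 0 < f z)
    (hH : Integrable (fun z => u z * Real.log (u z / f z)) (phaseMeasure Ω d))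
    (hlam : 0 < lam) (hθ : 1 ≤ θ) (hgv : AEStronglyMeasurable gv (phaseMeasure Ω d))
    (hexp : ∫⁻ z, ENNReal.ofReal (Real.exp (lam * ‖(f z)⁻¹ • gv z‖) * f z) ∂(phaseMeasure Ω d) ≤
      ENNReal.ofReal θ) :
    Integrable (fun z => |u z - f z| * ‖(f z)⁻¹ • gv z‖) (phaseMeasure Ω d) ∧
    ∫ z, |u z - f z| * ‖(f z)⁻¹ • gv z‖ ∂(phaseMeasure Ω d) ≤
      2 * (1 + Real.log θ) / lam * ((1 + 2 * Real.exp 1) *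
      max (Real.sqrt (∫ z, u z * Real.log (u z / f z) ∂(phaseMeasure Ω d)))
        (∫ z, u z * Real.log (u z / f z) ∂(phaseMeasure Ω d))) := by
  have hL : 0 < 1 + Real.log θ := by have := Real.log_nonneg hθ; linarith
  set L := 1 + Real.log θ with hLdef
  have ha : AEStronglyMeasurable (fun z => ‖(f z)⁻¹ • gv z‖) (phaseMeasure Ω d) :=
    (hf.integrable.aestronglyMeasurable.aemeasurable.inv.aestronglyMeasurable.smul hgv).norm
  have hexp' := lintegral_exp_div_le hθ hf0 ha.aemeasurable hf.integrable hf.mass hexp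
  obtain ⟨h1, h2⟩ := integral_abs_sub_mul_le
    (b := fun z => lam / (2 * L) * ‖(f z)⁻¹ • gv z‖) hu.integrable hf.integrable
    hu.nonneg hf0 (by rw [hu.mass, hf.mass]) hH (ha.const_mul _) (fun z => by positivity) (by
      refine le_of_eq_of_le (lintegral_congr fun z => ?_) hexp'
      congr 3
      rw [← hLdef]
      field_simp)
  have e : ∀ z, |u z - f z| * ‖(f z)⁻¹ • gv z‖ =
      2 * L / lam * (|u z - f z| * (lam / (2 * L) * ‖(f z)⁻¹ • gv z‖)) := fun z => by
    field_simp
  simp only [e]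
  refine ⟨h1.const_mul _, ?_⟩
  rw [integral_const_mul]
  exact mul_le_mul_of_nonneg_left h2 (by positivity)

/-- For H ≤ 1 both factors are of order √H. For H ≥ 1 the trivial bound x ≤ 2 prevents H², and c ≥ 1
brings both cases to the same constant. -/
theorem mul_le_of_pinsker {H x y c k : ℝ} (hH : 0 ≤ H) (hx0 : 0 ≤ x) (hx2 : x ≤ 2) (hc : 1 ≤ c)
    (hk : 0 ≤ k) (hx : x ≤ 2 * (c * max (Real.sqrt H) H))
    (hy : y ≤ k * (c * max (Real.sqrt H) H)) : x * y ≤ 2 * c ^ 2 * k * H := by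
  rcases le_total H 1 with h | h
  · have h1 : H ≤ Real.sqrt H := by
      rw [Real.le_sqrt hH hH]; nlinarith
    rw [max_eq_left h1] at hx hy
    have hs := Real.sqrt_nonneg H
    calc x * y ≤ x * (k * (c * Real.sqrt H)) := mul_le_mul_of_nonneg_left hy hx0
      _ ≤ 2 * (c * Real.sqrt H) * (k * (c * Real.sqrt H)) :=
        mul_le_mul_of_nonneg_right hx (by positivity)
      _ = 2 * c ^ 2 * k * (Real.sqrt H * Real.sqrt H) := by ring
      _ = _ := by rw [Real.mul_self_sqrt hH]
  · have h1 : Real.sqrt H ≤ H := by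
      rw [Real.sqrt_le_left hH]; nlinarith
    rw [max_eq_right h1] at hx hy
    calc x * y ≤ x * (k * (c * H)) := mul_le_mul_of_nonneg_left hy hx0
      _ ≤ 2 * (k * (c * H)) := mul_le_mul_of_nonneg_right hx2 (by positivity)
      _ = 2 * c * k * H * 1 := by ring
      _ ≤ 2 * c * k * H * c := mul_le_mul_of_nonneg_left hc (by positivity)
      _ = _ := by ring

theorem norm_inv_smul_eq {f : ℝ} (hf : 0 < f) (g : E d) : ‖f⁻¹ • g‖ = ‖g‖ / f := by
  rw [norm_smul, norm_inv, Real.norm_of_nonneg hf.le, ← div_eq_inv_mul]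

/-- Use u ≤ |u − f| + f: the first part is covered by the weighted Pinsker inequality, the second is
|∇_v f|. -/
theorem integrable_mul_norm (hu : IsProbDensity Ω u) (hf : IsProbDensity Ω f)
    (hf0 : ∀ z, 0 < f z)
    (hH : Integrable (fun z => u z * Real.log (u z / f z)) (phaseMeasure Ω d))
    (hlam : 0 < lam) (hθ : 1 ≤ θ) (hgv : Integrable gv (phaseMeasure Ω d))
    (hexp : ∫⁻ z, ENNReal.ofReal (Real.exp (lam * ‖(f z)⁻¹ • gv z‖) * f z) ∂(phaseMeasure Ω d) ≤
      ENNReal.ofReal θ) :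
    Integrable (fun z => u z * ‖(f z)⁻¹ • gv z‖) (phaseMeasure Ω d) := by
  have h1 := (integral_abs_sub_mul_norm_le hu hf hf0 hH hlam hθ hgv.aestronglyMeasurable hexp).1
  have ha : AEStronglyMeasurable (fun z => ‖(f z)⁻¹ • gv z‖) (phaseMeasure Ω d) :=
    (hf.integrable.aestronglyMeasurable.aemeasurable.inv.aestronglyMeasurable.smul
      hgv.aestronglyMeasurable).norm
  refine (h1.add hgv.norm).mono' (hu.integrable.aestronglyMeasurable.mul ha) ?_
  filter_upwards [hu.nonneg] with z hz
  have h2 : f z * ‖(f z)⁻¹ • gv z‖ = ‖gv z‖ := by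
    rw [norm_inv_smul_eq (hf0 z), mul_div_cancel₀ _ (hf0 z).ne']
  rw [Real.norm_of_nonneg (mul_nonneg hz (norm_nonneg _)), Pi.add_apply, ← h2, ← add_mul]
  refine mul_le_mul_of_nonneg_right ?_ (norm_nonneg _)
  linarith [le_abs_self (u z - f z)]

/-- The drift term in the evolution of the relative entropy. -/
theorem abs_integral_drift_le (hK : MemLp K ∞ (volume : Measure (E d)))
    (hu : IsProbDensity Ω u) (hf : IsProbDensity Ω f)
    (hf0 : ∀ z, 0 < f z)
    (hH : Integrable (fun z => u z * Real.log (u z / f z)) (phaseMeasure Ω d))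
    (hlam : 0 < lam) (hθ : 1 ≤ θ) (hw : IsWeakGradient Ω f gx gv)
    (hgv : Integrable gv (phaseMeasure Ω d))
    (hexp : ∫⁻ z, ENNReal.ofReal (Real.exp (lam * ‖(f z)⁻¹ • gv z‖) * f z) ∂(phaseMeasure Ω d) ≤
      ENNReal.ofReal θ)
    (hF : AEStronglyMeasurable (fun z : Phase d => force Ω K u z.1 - force Ω K f z.1)
      (phaseMeasure Ω d)) :
    |∫ z, u z * ((f z)⁻¹ * inner ℝ (force Ω K u z.1 - force Ω K f z.1) (gv z))
      ∂(phaseMeasure Ω d)| ≤ stabilityConst lam * supNorm K * (1 + Real.log θ) *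
        ∫ z, u z * Real.log (u z / f z) ∂(phaseMeasure Ω d) := by
  have hH0 := integral_mul_log_div_nonneg hu.integrable hf.integrable hu.nonneg hf0
    (by rw [hu.mass, hf.mass]) hH
  have hp1 := integral_abs_sub_le hu hf hf0 hH
  obtain ⟨hi, hp2⟩ :=
    integral_abs_sub_mul_norm_le hu hf hf0 hH hlam hθ hgv.aestronglyMeasurable hexp
  set H := ∫ z, u z * Real.log (u z / f z) ∂(phaseMeasure Ω d) with hHdef
  set N := ∫ z, |u z - f z| ∂(phaseMeasure Ω d) with hN
  have hN0 : 0 ≤ N := integral_nonneg fun z => abs_nonneg _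
  have hN2 : N ≤ 2 := by
    have : N ≤ ∫ z, (|u z| + |f z|) ∂(phaseMeasure Ω d) :=
      integral_mono (hu.integrable.sub hf.integrable).abs (hu.integrable.abs.add hf.integrable.abs)
        fun z => abs_sub _ _
    rw [integral_add hu.integrable.abs hf.integrable.abs, hu.integral_abs, hf.integral_abs] at this
    linarith
  have hκ : 0 ≤ supNorm K := supNorm_nonneg
  have hΔ : ∀ x, ‖force Ω K u x - force Ω K f x‖ ≤ supNorm K * N := fun x =>
    norm_force_sub_le hK hu.integrable hf.integrable x
  set b : E d → E d := fun x => force Ω K u x - force Ω K f x with hb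
  have hIi : Integrable (fun z => inner ℝ (b z.1) (gv z)) (phaseMeasure Ω d) := by
    refine (hgv.norm.const_mul (supNorm K * N)).mono'
      (AEStronglyMeasurable.inner hF hgv.aestronglyMeasurable) (Eventually.of_forall fun z => ?_)
    exact (norm_inner_le_norm _ _).trans (mul_le_mul_of_nonneg_right (hΔ _) (norm_nonneg _))
  have hz := hw.integral_inner_eq_zero hf.integrable hgv hIi
  have hbd : ∀ z, ‖(u z - f z) * ((f z)⁻¹ * inner ℝ (b z.1) (gv z))‖ ≤
      supNorm K * N * (|u z - f z| * ‖(f z)⁻¹ • gv z‖) := by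
    intro z
    have h1 : (f z)⁻¹ * inner ℝ (b z.1) (gv z) = inner ℝ (b z.1) ((f z)⁻¹ • gv z) := by
      rw [inner_smul_right]
    rw [h1, norm_mul, Real.norm_eq_abs]
    have h2 := (norm_inner_le_norm (𝕜 := ℝ) (b z.1) ((f z)⁻¹ • gv z)).trans
      (mul_le_mul_of_nonneg_right (hΔ z.1) (norm_nonneg _))
    have h3 := mul_le_mul_of_nonneg_left h2 (abs_nonneg (u z - f z))
    linarith
  have hJi : Integrable (fun z => (u z - f z) * ((f z)⁻¹ * inner ℝ (b z.1) (gv z)))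
      (phaseMeasure Ω d) := by
    refine (hi.const_mul (supNorm K * N)).mono' ?_ (Eventually.of_forall hbd)
    exact (hu.integrable.sub hf.integrable).aestronglyMeasurable.mul
      (hf.integrable.aestronglyMeasurable.aemeasurable.inv.aestronglyMeasurable.mul
        hIi.aestronglyMeasurable)
  -- The difference of the two sides is the integral of b·∇_v f, which is zero by `hz`.
  have e : ∫ z, u z * ((f z)⁻¹ * inner ℝ (b z.1) (gv z)) ∂(phaseMeasure Ω d) =
      ∫ z, (u z - f z) * ((f z)⁻¹ * inner ℝ (b z.1) (gv z)) ∂(phaseMeasure Ω d) := by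
    rw [← add_zero (∫ z, (u z - f z) * _ ∂_), ← hz, ← integral_add hJi hIi]
    refine integral_congr_ae (Eventually.of_forall fun z => ?_)
    have := (hf0 z).ne'
    field_simp
    ring
  change |∫ z, u z * ((f z)⁻¹ * inner ℝ (b z.1) (gv z)) ∂(phaseMeasure Ω d)| ≤ _
  rw [e]
  have h1 := norm_integral_le_of_norm_le (hi.const_mul (supNorm K * N)) (Eventually.of_forall hbd)
  rw [integral_const_mul, Real.norm_eq_abs] at h1
  have hlog := Real.log_nonneg hθ
  -- Both Pinsker bounds carry c = 1 + 2e, and k = 2(1 + log θ)/λ; thus 2c²k = (4c²/λ)(1 + log θ),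
  -- which explains the value of `stabilityConst`.
  have h2 := mul_le_of_pinsker (c := 1 + 2 * Real.exp 1) hH0 hN0 hN2
    (by linarith [Real.exp_pos 1]) (k := 2 * (1 + Real.log θ) / lam) (by positivity) hp1 hp2
  calc _ ≤ supNorm K * (N * ∫ z, |u z - f z| * ‖(f z)⁻¹ • gv z‖ ∂(phaseMeasure Ω d)) := by
        rw [← mul_assoc]; exact h1
    _ ≤ supNorm K * _ := mul_le_mul_of_nonneg_left h2 hκ
    _ = _ := by
        rw [stabilityConst]
        field_simp
        ring

end DriftBound


/-! ### Uniform bounds in the shift, its removal, and the stability estimate -/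

section Stability

open Filter Topology

variable {d : ℕ} {Ω : SpatialDomain} {ε T : ℝ} {K : E d → E d} {u : ℝ → Phase d → ℝ}
  {f : ℝ → Phase d → ℝ} {gx gv : ℝ → Phase d → E d} {lam θ : ℝ}

theorem IsStrongSolution.continuous_slice (hf : IsStrongSolution Ω ε T K f gx gv)
    {t : ℝ} (ht : t ∈ Icc 0 T) : Continuous (f t) :=
  hf.continuousOn.comp_continuous (f := fun z => (t, z)) (by fun_prop) fun _ => ⟨ht, mem_univ _⟩

theorem IsStrongSolution.ae_integrable_gv (hf : IsStrongSolution Ω ε T K f gx gv) :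
    ∀ᵐ s ∂((volume : Measure ℝ).restrict (Icc 0 T)), Integrable (gv s) (phaseMeasure Ω d) := by
  obtain ⟨M, hM⟩ := hf.sobolev 1 le_rfl
  filter_upwards [hM, hf.measurable_gv.prodMk_left] with s hs hm
  exact memLp_one_iff_integrable.1 ⟨hm, hs.2.2.trans_lt ENNReal.ofReal_lt_top⟩

theorem ae_expMoment_le (hfin : expMoment Ω lam T f gv < ⊤) :
    ∀ᵐ s ∂((volume : Measure ℝ).restrict (Icc 0 T)),
      ∫⁻ z, ENNReal.ofReal (Real.exp (lam * ‖(f s z)⁻¹ • gv s z‖) * f s z) ∂(phaseMeasure Ω d) ≤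
        ENNReal.ofReal (expMoment Ω lam T f gv).toReal := by
  rw [ENNReal.ofReal_toReal hfin.ne]
  exact ENNReal.ae_le_essSup _

/-- The exponential is at least 1 and f(s) has mass one; since T > 0, some time s realizes the
essential bound. Hence log θ ≥ 0. -/
theorem IsStrongSolution.one_le_expMoment (hf : IsStrongSolution Ω ε T K f gx gv) (hT : 0 < T)
    (hlam : 0 < lam) (hfin : expMoment Ω lam T f gv < ⊤) :
    1 ≤ (expMoment Ω lam T f gv).toReal := by
  have hne : (ae ((volume : Measure ℝ).restrict (Icc 0 T))).NeBot := by
    rw [ae_neBot, Ne, Measure.restrict_eq_zero, Real.volume_Icc]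
    simpa using hT
  obtain ⟨s, hs, hsT⟩ := ((ae_expMoment_le hfin).and (ae_restrict_mem measurableSet_Icc)).exists
  have hd := hf.probDensity s hsT
  have h1 : ENNReal.ofReal 1 ≤ ENNReal.ofReal (expMoment Ω lam T f gv).toReal := by
    refine le_trans ?_ hs
    rw [← hd.mass, ofReal_integral_eq_lintegral_ofReal hd.integrable hd.nonneg]
    refine lintegral_mono fun z => ENNReal.ofReal_le_ofReal ?_
    refine le_mul_of_one_le_left (hf.pos s hsT z).le (Real.one_le_exp (by positivity))
  by_contra! h
  exact absurd h1 (not_le.2 ((ENNReal.ofReal_lt_ofReal_iff one_pos).2 h))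

theorem HasBoundedEntropy.integrableOn_entropy (he : HasBoundedEntropy Ω T u)
    (hu : IsWeakSolution Ω ε T K u) : IntegrableOn (fun s => entropy Ω (u s)) (Icc 0 T) := by
  obtain ⟨M, hM⟩ := he
  have hm : AEStronglyMeasurable (fun p : ℝ × Phase d => u p.1 p.2 * Real.log (u p.1 p.2))
      (timePhaseMeasure Ω d T) :=
    (hu.measurable.aemeasurable.mul
      (Real.measurable_log.comp_aemeasurable hu.measurable.aemeasurable)).aestronglyMeasurable
  refine (integrable_const M).mono' hm.integral_prod_right' ?_
  filter_upwards [ae_restrict_mem measurableSet_Icc] with s hs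
  exact (norm_integral_le_integral_norm _).trans (hM s hs).2

theorem IsWeakSolution.integrableOn_shiftedEntropy (hu : IsWeakSolution Ω ε T K u)
    (hf : IsStrongSolution Ω ε T K f gx gv) (hT : 0 < T) (he : HasBoundedEntropy Ω T u)
    {δ : ℝ} (hδ : 0 < δ) :
    IntegrableOn (fun s => shiftedEntropy Ω δ (u s) (f s)) (Icc 0 T) := by
  obtain ⟨M, hM, hfM, -⟩ := hf.exists_bound_clampTime hT
  have h1 : Integrable (fun p : ℝ × Phase d => u p.1 p.2 * Real.log (f p.1 p.2 + δ))
      (timePhaseMeasure Ω d T) :=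
    hu.integrable_mul (Real.measurable_log.comp_aemeasurable
      (hf.aestronglyMeasurable.aemeasurable.add_const δ)).aestronglyMeasurable
      fun t ht z _ => abs_log_le hδ (hf.pos t ht z).le (hfM t ht z)
  have h2 : IntegrableOn (fun s => ∫ z, u s z * Real.log (f s z + δ) ∂(phaseMeasure Ω d))
    (Icc 0 T) := h1.integral_prod_left
  refine ((he.integrableOn_entropy hu).sub h2).congr ?_
  obtain ⟨M', hM'⟩ := he
  filter_upwards [ae_restrict_mem measurableSet_Icc] with s hs
  exact ((hu.probDensity s hs).shiftedEntropy_eq (hM' s hs).1 (hf.continuous_slice hs)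
    (hf.pos s hs) (hfM s hs) hδ).2.symm

/-- The drift at a fixed time. -/
noncomputable def driftAt (Ω : SpatialDomain) (δ : ℝ) (K : E d → E d) (u f : ℝ → Phase d → ℝ)
    (gv : ℝ → Phase d → E d) (s : ℝ) : ℝ :=
  ∫ z, u s z * ((f s z + δ)⁻¹ *
    inner ℝ (force Ω K (u s) z.1 - force Ω K (f s) z.1) (gv s z)) ∂(phaseMeasure Ω d)

theorem abs_integral_shifted_drift_le {u f : Phase d → ℝ} {b : Phase d → E d} {g : Phase d → E d}
    {δ κ : ℝ} (hδ : 0 < δ) (hf0 : ∀ z, 0 < f z)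
    (hu : ∀ᵐ z ∂(phaseMeasure Ω d), 0 ≤ u z) (hb : ∀ z, ‖b z‖ ≤ κ)
    (hi : Integrable (fun z => u z * (‖g z‖ / (f z + δ))) (phaseMeasure Ω d)) :
    |∫ z, u z * ((f z + δ)⁻¹ * inner ℝ (b z) (g z)) ∂(phaseMeasure Ω d)| ≤
      κ * ∫ z, u z * (‖g z‖ / (f z + δ)) ∂(phaseMeasure Ω d) := by
  rw [← integral_const_mul, ← Real.norm_eq_abs]
  refine norm_integral_le_of_norm_le (hi.const_mul κ) ?_
  filter_upwards [hu] with z hz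
  have h0 : 0 < f z + δ := add_pos (hf0 z) hδ
  rw [norm_mul, norm_mul, norm_inv, Real.norm_of_nonneg hz, Real.norm_of_nonneg h0.le]
  have h1 := (norm_inner_le_norm (𝕜 := ℝ) (b z) (g z)).trans
    (mul_le_mul_of_nonneg_right (hb z) (norm_nonneg _))
  have h2 := mul_le_mul_of_nonneg_left h1 (mul_nonneg hz (inv_nonneg.2 h0.le))
  rw [div_eq_mul_inv]
  linarith

/-- The shifted entropies are bounded uniformly in the shift. -/
theorem IsWeakSolution.exists_bound_shiftedEntropy (hu : IsWeakSolution Ω ε T K u)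
    (hf : IsStrongSolution Ω ε T K f gx gv) (hK : MemLp K ∞ (volume : Measure (E d)))
    (hε : 0 ≤ ε) (hT : 0 < T) (he : HasBoundedEntropy Ω T u) (hdis : EntropyDissipation Ω ε T u)
    (hlam : 0 < lam) (hfin : expMoment Ω lam T f gv < ⊤)
    (hH : Integrable (fun z => u 0 z * Real.log (u 0 z / f 0 z)) (phaseMeasure Ω d)) :
    ∃ A B : ℝ, ∀ δ : ℝ, 0 < δ → δ ≤ 1 →
      (∀ t ∈ Icc 0 T, shiftedEntropy Ω δ (u t) (f t) ≤ A) ∧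
      ∀ᵐ s ∂((volume : Measure ℝ).restrict (Icc 0 T)), |driftAt Ω δ K u f gv s| ≤ B := by
  obtain ⟨M, hM, hfM, hgM⟩ := hf.exists_bound_clampTime hT
  obtain ⟨m, hm⟩ := id he
  set Θ := (expMoment Ω lam T f gv).toReal with hΘ
  have hΘ0 : 0 ≤ Θ := ENNReal.toReal_nonneg
  have h0T : (0 : ℝ) ∈ Icc 0 T := ⟨le_rfl, hT.le⟩
  have hm0 : 0 ≤ m := (integral_nonneg fun z => abs_nonneg _).trans (hm 0 h0T).2
  have hlM : 0 ≤ Real.log (1 + M) := Real.log_nonneg (by linarith)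
  set C₁ := m + Real.log (1 + M) + 2 * Θ with hC₁
  have hC₁0 : 0 ≤ C₁ := by positivity
  have hκ : 0 ≤ supNorm K := supNorm_nonneg
  set H₀ := ∫ z, u 0 z * Real.log (u 0 z / f 0 z) ∂(phaseMeasure Ω d) with hH₀
  have hH₀0 : 0 ≤ H₀ := integral_mul_log_div_nonneg (hu.probDensity 0 h0T).integrable
    (hf.probDensity 0 h0T).integrable (hu.probDensity 0 h0T).nonneg (hf.pos 0 h0T)
    (by rw [(hu.probDensity 0 h0T).mass, (hf.probDensity 0 h0T).mass]) hH
  -- The two forces differ by at most 2‖K‖, and λ ∫ u|∇_v f|/(f+δ) is at most the shifted entropy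
  -- plus `C₁`. So the drift is at most b times that sum, with b and `C₁` independent of δ.
  set b := 2 * supNorm K / lam with hb
  have hb0 : 0 ≤ b := by positivity
  have hdrift : ∀ δ : ℝ, 0 < δ → δ ≤ 1 → ∀ᵐ s ∂((volume : Measure ℝ).restrict (Icc 0 T)),
      |driftAt Ω δ K u f gv s| ≤ b * (shiftedEntropy Ω δ (u s) (f s) + C₁) := by
    intro δ hδ hδ1
    filter_upwards [ae_restrict_mem measurableSet_Icc, ae_expMoment_le hfin,
      hf.measurable_gv.prodMk_left, Measure.ae_ae_of_ae_prod hgM] with s hs hexp hgm hgs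
    have hud := hu.probDensity s hs
    have hfd := hf.probDensity s hs
    obtain ⟨h1, h2⟩ := hud.integral_mul_norm_div_le (hm s hs).1 (hf.continuous_slice hs)
      (hf.pos s hs) (hfM s hs) hgm hgs hlam hΘ0 hexp hδ hδ1
    have h3 := abs_integral_shifted_drift_le (κ := 2 * supNorm K)
      (b := fun z : Phase d => force Ω K (u s) z.1 - force Ω K (f s) z.1) hδ (hf.pos s hs)
      hud.nonneg (fun z => by
        have h1 := hud.norm_force_le hK z.1
        have h2 := hfd.norm_force_le hK z.1
        have := norm_sub_le (force Ω K (u s) z.1) (force Ω K (f s) z.1)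
        linarith) h1
    refine h3.trans ?_
    have h4 := (hm s hs).2
    have h5 : lam * ∫ z, u s z * (‖gv s z‖ / (f s z + δ)) ∂(phaseMeasure Ω d) ≤
        shiftedEntropy Ω δ (u s) (f s) + C₁ := by linarith
    have h6 := mul_le_mul_of_nonneg_left h5 hb0
    calc _ = b * (lam * ∫ z, u s z * (‖gv s z‖ / (f s z + δ)) ∂(phaseMeasure Ω d)) := by
          rw [hb]; field_simp
      _ ≤ _ := h6
  have hbound : ∀ δ : ℝ, 0 < δ → δ ≤ 1 → ∀ t ∈ Icc 0 T,
      shiftedEntropy Ω δ (u t) (f t) + C₁ ≤ (H₀ + C₁) * Real.exp (b * t) := by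
    intro δ hδ hδ1
    have hint := hu.integrableOn_shiftedEntropy hf hT he hδ
    have hint' : IntegrableOn (fun s => shiftedEntropy Ω δ (u s) (f s) + C₁) (Icc 0 T) :=
      hint.add (integrableOn_const (by simp))
    -- The initial shifted entropy is at most H₀ because log(f + δ) ≥ log f, so the Grönwall bound
    -- does not depend on δ.
    refine le_mul_exp_of_le_add_mul_integral hb0 hint' fun t ht => ?_
    obtain ⟨-, h1⟩ := hu.entropy_sub_le hf hK hε hT hdis hδ ht
    rw [← ((hu.probDensity t ht).shiftedEntropy_eq (hm t ht).1 (hf.continuous_slice ht)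
      (hf.pos t ht) (hfM t ht) hδ).2, ← ((hu.probDensity 0 h0T).shiftedEntropy_eq (hm 0 h0T).1
      (hf.continuous_slice h0T) (hf.pos 0 h0T) (hfM 0 h0T) hδ).2] at h1
    change _ ≤ _ - ∫ s in (0 : ℝ)..t, driftAt Ω δ K u f gv s at h1
    have h2 := (hu.probDensity 0 h0T).shiftedEntropy_le (hm 0 h0T).1 (hf.continuous_slice h0T)
      (hf.pos 0 h0T) (hfM 0 h0T) hH hδ
    have hii : IntervalIntegrable (fun s => b * (shiftedEntropy Ω δ (u s) (f s) + C₁))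
        volume 0 t := by
      rw [intervalIntegrable_iff, uIoc_of_le ht.1]
      exact (hint'.mono_set (Ioc_subset_Icc_self.trans (Icc_subset_Icc_right ht.2))).const_mul b
    have h3 := intervalIntegral.norm_integral_le_of_norm_le
        (f := driftAt Ω δ K u f gv) ht.1 (by
      have := (ae_restrict_iff' measurableSet_Icc).1 (hdrift δ hδ hδ1)
      filter_upwards [this] with s hs hst
      exact hs ⟨hst.1.le, hst.2.trans ht.2⟩) hii
    rw [intervalIntegral.integral_const_mul, Real.norm_eq_abs] at h3
    have h4 := neg_abs_le (∫ s in (0 : ℝ)..t, driftAt Ω δ K u f gv s)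
    linarith
  refine ⟨(H₀ + C₁) * Real.exp (b * T), b * ((H₀ + C₁) * Real.exp (b * T)),
    fun δ hδ hδ1 => ?_⟩
  have hb' : ∀ t ∈ Icc 0 T, shiftedEntropy Ω δ (u t) (f t) + C₁ ≤
      (H₀ + C₁) * Real.exp (b * T) := fun t ht => by
    refine (hbound δ hδ hδ1 t ht).trans (mul_le_mul_of_nonneg_left ?_ (by positivity))
    exact Real.exp_le_exp.2 (mul_le_mul_of_nonneg_left ht.2 hb0)
  refine ⟨fun t ht => by linarith [hb' t ht], ?_⟩
  filter_upwards [hdrift δ hδ hδ1, ae_restrict_mem measurableSet_Icc] with s hs hsT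
  exact hs.trans (mul_le_mul_of_nonneg_left (hb' s hsT) hb0)

/-- The integrands are dominated by κ u |g|/f, since 1/(f + δ) ≤ 1/f. -/
theorem tendsto_integral_shifted_drift {u f : Phase d → ℝ} {b : Phase d → E d}
    {g : Phase d → E d} {κ : ℝ} (hu : IsProbDensity Ω u) (hf : Continuous f)
    (hf0 : ∀ z, 0 < f z) (hb : ∀ z, ‖b z‖ ≤ κ) (hbm : AEStronglyMeasurable b (phaseMeasure Ω d))
    (hg : AEStronglyMeasurable g (phaseMeasure Ω d))
    (hi : Integrable (fun z => u z * ‖(f z)⁻¹ • g z‖) (phaseMeasure Ω d)) :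
    Tendsto (fun n : ℕ => ∫ z, u z * ((f z + 1 / ((n : ℝ) + 1))⁻¹ * inner ℝ (b z) (g z))
      ∂(phaseMeasure Ω d)) atTop
      (𝓝 (∫ z, u z * ((f z)⁻¹ * inner ℝ (b z) (g z)) ∂(phaseMeasure Ω d))) := by
  refine tendsto_integral_of_dominated_convergence (fun z => κ * (u z * ‖(f z)⁻¹ • g z‖))
    (fun n => ?_) (hi.const_mul κ) (fun n => ?_) (Eventually.of_forall fun z => ?_)
  · refine hu.integrable.aestronglyMeasurable.mul (AEStronglyMeasurable.mul ?_ (hbm.inner hg))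
    exact ((hf.add continuous_const).inv₀ fun z =>
      (add_pos (hf0 z) (one_div_succ_pos n)).ne').aestronglyMeasurable
  · filter_upwards [hu.nonneg] with z hz
    have h0 := add_pos (hf0 z) (one_div_succ_pos n)
    rw [norm_mul, norm_mul, norm_inv, Real.norm_of_nonneg hz, Real.norm_of_nonneg h0.le,
      norm_inv_smul_eq (hf0 z), div_eq_inv_mul ‖g z‖]
    have h1 := (norm_inner_le_norm (𝕜 := ℝ) (b z) (g z)).trans
      (mul_le_mul_of_nonneg_right (hb z) (norm_nonneg _))
    have h2 : (f z + 1 / ((n : ℝ) + 1))⁻¹ ≤ (f z)⁻¹ :=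
      inv_anti₀ (hf0 z) (le_add_of_nonneg_right (one_div_succ_pos n).le)
    have h3 := mul_le_mul h2 h1 (norm_nonneg _) (inv_nonneg.2 (hf0 z).le)
    have h4 := mul_le_mul_of_nonneg_left h3 hz
    linarith
  · have h := (tendsto_one_div_add_atTop_nhds_zero_nat (𝕜 := ℝ)).const_add (f z)
    rw [add_zero] at h
    exact ((h.inv₀ (hf0 z).ne').mul_const _).const_mul _

/-- The stability estimate for the relative entropy. -/
theorem IsWeakSolution.relEntropy_stability (hu : IsWeakSolution Ω ε T K u)
    (hf : IsStrongSolution Ω ε T K f gx gv) (hK : MemLp K ∞ (volume : Measure (E d)))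
    (hε : 0 ≤ ε) (hT : 0 < T) (he : HasBoundedEntropy Ω T u) (hdis : EntropyDissipation Ω ε T u)
    (hlam : 0 < lam) (hfin : expMoment Ω lam T f gv < ⊤)
    (hH : Integrable (fun z => u 0 z * Real.log (u 0 z / f 0 z)) (phaseMeasure Ω d)) :
    ∀ t ∈ Icc 0 T,
      Integrable (fun z => u t z * Real.log (u t z / f t z)) (phaseMeasure Ω d) ∧
      ∫ z, u t z * Real.log (u t z / f t z) ∂(phaseMeasure Ω d) ≤
        (∫ z, u 0 z * Real.log (u 0 z / f 0 z) ∂(phaseMeasure Ω d)) *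
          Real.exp (stabilityConst lam * supNorm K *
            (1 + Real.log (expMoment Ω lam T f gv).toReal) * t) := by
  obtain ⟨A, B, hAB⟩ := hu.exists_bound_shiftedEntropy hf hK hε hT he hdis hlam hfin hH
  have hA : ∀ n : ℕ, ∀ t ∈ Icc 0 T, shiftedEntropy Ω (1 / ((n : ℝ) + 1)) (u t) (f t) ≤ A :=
    fun n => (hAB _ (one_div_succ_pos n) (one_div_succ_le_one n)).1
  have hB : ∀ n : ℕ, ∀ᵐ s ∂((volume : Measure ℝ).restrict (Icc 0 T)),
      |driftAt Ω (1 / ((n : ℝ) + 1)) K u f gv s| ≤ B :=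
    fun n => (hAB _ (one_div_succ_pos n) (one_div_succ_le_one n)).2
  obtain ⟨M, hM, hfM, -⟩ := hf.exists_bound_clampTime hT
  obtain ⟨m, hm⟩ := id he
  have h0T : (0 : ℝ) ∈ Icc 0 T := ⟨le_rfl, hT.le⟩
  have hΘ1 := hf.one_le_expMoment hT hlam hfin
  set Θ := (expMoment Ω lam T f gv).toReal with hΘ
  have hlog := Real.log_nonneg hΘ1
  have hκ : 0 ≤ supNorm K := supNorm_nonneg
  -- Finiteness of H at time t comes from the uniform bound A on the shifted entropies, through
  -- Fatou's lemma.
  have hi : ∀ t ∈ Icc 0 T,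
      Integrable (fun z => u t z * Real.log (u t z / f t z)) (phaseMeasure Ω d) := fun t ht =>
    (hu.probDensity t ht).integrable_mul_log_div (hm t ht).1 (hf.continuous_slice ht)
      (hf.pos t ht) (hfM t ht) fun n => hA n t ht
  set H : ℝ → ℝ := fun t => ∫ z, u t z * Real.log (u t z / f t z) ∂(phaseMeasure Ω d) with hHdef
  have hlim : ∀ t ∈ Icc 0 T, Tendsto
      (fun n : ℕ => shiftedEntropy Ω (1 / ((n : ℝ) + 1)) (u t) (f t)) atTop (𝓝 (H t)) :=
    fun t ht => (hu.probDensity t ht).tendsto_shiftedEntropy (hm t ht).1 (hf.continuous_slice ht)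
      (hf.pos t ht) (hfM t ht) (hi t ht)
  have hH0 : ∀ t ∈ Icc 0 T, 0 ≤ H t := fun t ht => integral_mul_log_div_nonneg
    (hu.probDensity t ht).integrable (hf.probDensity t ht).integrable (hu.probDensity t ht).nonneg
    (hf.pos t ht) (by rw [(hu.probDensity t ht).mass, (hf.probDensity t ht).mass]) (hi t ht)
  have hHA : ∀ t ∈ Icc 0 T, H t ≤ A := fun t ht =>
    le_of_tendsto (hlim t ht) (Eventually.of_forall fun n => hA n t ht)
  have hHint : IntegrableOn H (Icc 0 T) := by
    refine (integrable_const A).mono' ?_ ?_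
    · refine aestronglyMeasurable_of_tendsto_ae atTop (fun n : ℕ =>
        (hu.integrableOn_shiftedEntropy hf hT he (one_div_succ_pos n)).aestronglyMeasurable) ?_
      filter_upwards [ae_restrict_mem measurableSet_Icc] with t ht using hlim t ht
    · filter_upwards [ae_restrict_mem measurableSet_Icc] with t ht
      rw [Real.norm_of_nonneg (hH0 t ht)]
      exact hHA t ht
  set c := stabilityConst lam * supNorm K * (1 + Real.log Θ) with hc
  have hc0 : 0 ≤ c := by have := stabilityConst_pos hlam; positivity
  have hforce : ∀ s ∈ Icc 0 T, ∀ z : Phase d,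
      ‖force Ω K (u s) z.1 - force Ω K (f s) z.1‖ ≤ 2 * supNorm K := fun s hs z => by
    have h1 := (hu.probDensity s hs).norm_force_le hK z.1
    have h2 := (hf.probDensity s hs).norm_force_le hK z.1
    have := norm_sub_le (force Ω K (u s) z.1) (force Ω K (f s) z.1)
    linarith
  have hfm : AEStronglyMeasurable (fun p : ℝ × Phase d =>
      force Ω K (u p.1) p.2.1 - force Ω K (f p.1) p.2.1) (timePhaseMeasure Ω d T) :=
    (hu.aestronglyMeasurable_force hK).sub (Vlasov.aestronglyMeasurable_force hK hf.aestronglyMeasurable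
      fun t ht => (hf.probDensity t ht).integrable)
  set D : ℝ → ℝ := fun s => ∫ z, u s z * ((f s z)⁻¹ *
    inner ℝ (force Ω K (u s) z.1 - force Ω K (f s) z.1) (gv s z)) ∂(phaseMeasure Ω d) with hD
  have hDlim : ∀ᵐ s ∂((volume : Measure ℝ).restrict (Icc 0 T)),
      Tendsto (fun n : ℕ => driftAt Ω (1 / ((n : ℝ) + 1)) K u f gv s) atTop (𝓝 (D s)) ∧
      |D s| ≤ c * H s := by
    filter_upwards [ae_restrict_mem measurableSet_Icc, ae_expMoment_le hfin, hf.ae_integrable_gv,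
      hf.weakGradient, hfm.prodMk_left] with s hs hexp hgs hw hbm
    have hud := hu.probDensity s hs
    have hfd := hf.probDensity s hs
    have h1 := integrable_mul_norm hud hfd (hf.pos s hs) (hi s hs) hlam hΘ1 hgs hexp
    exact ⟨tendsto_integral_shifted_drift hud (hf.continuous_slice hs) (hf.pos s hs)
      (hforce s hs) hbm hgs.aestronglyMeasurable h1,
      abs_integral_drift_le hK hud hfd (hf.pos s hs) (hi s hs) hlam hΘ1 hw hgs hexp hbm⟩
  -- Let δ → 0 in the entropy inequality relative to f + δ; the drifts converge at almost every time
  -- and are bounded by the constant B. The limit drift is at most cH, which closes the second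
  -- Grönwall argument.
  have hle : ∀ t ∈ Icc 0 T, H t ≤ H 0 + c * ∫ s in (0 : ℝ)..t, H s := by
    intro t ht
    have hsub : Ioc 0 t ⊆ Icc 0 T := Ioc_subset_Icc_self.trans (Icc_subset_Icc_right ht.2)
    have hDint : Tendsto (fun n : ℕ => ∫ s in (0 : ℝ)..t, driftAt Ω (1 / ((n : ℝ) + 1)) K u f gv s)
        atTop (𝓝 (∫ s in (0 : ℝ)..t, D s)) := by
      simp only [intervalIntegral.integral_of_le ht.1]
      refine tendsto_integral_of_dominated_convergence (fun _ => B) (fun n => ?_)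
        (integrable_const B) (fun n => ae_restrict_of_ae_restrict_of_subset hsub (hB n))
        (ae_restrict_of_ae_restrict_of_subset hsub (hDlim.mono fun s hs => hs.1))
      have h1 := (hu.entropy_sub_le hf hK hε hT hdis (one_div_succ_pos n) ht).1.integral_prod_left
      exact h1.aestronglyMeasurable.mono_measure (Measure.restrict_mono hsub le_rfl)
    have h1 : H t ≤ H 0 - ∫ s in (0 : ℝ)..t, D s := by
      refine le_of_tendsto_of_tendsto' (hlim t ht) ((hlim 0 h0T).sub hDint) fun n => ?_
      have h1 := (hu.entropy_sub_le hf hK hε hT hdis (one_div_succ_pos n) ht).2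
      rwa [← ((hu.probDensity t ht).shiftedEntropy_eq (hm t ht).1 (hf.continuous_slice ht)
        (hf.pos t ht) (hfM t ht) (one_div_succ_pos n)).2,
        ← ((hu.probDensity 0 h0T).shiftedEntropy_eq (hm 0 h0T).1 (hf.continuous_slice h0T)
        (hf.pos 0 h0T) (hfM 0 h0T) (one_div_succ_pos n)).2] at h1
    have hii : IntervalIntegrable (fun s => c * H s) volume 0 t := by
      rw [intervalIntegrable_iff, uIoc_of_le ht.1]
      exact (hHint.mono_set hsub).const_mul c
    have h3 := intervalIntegral.norm_integral_le_of_norm_le (f := D) ht.1 (by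
      have := (ae_restrict_iff' measurableSet_Icc).1 hDlim
      filter_upwards [this] with s hs hst
      exact (hs (hsub hst)).2) hii
    rw [intervalIntegral.integral_const_mul, Real.norm_eq_abs] at h3
    linarith [neg_abs_le (∫ s in (0 : ℝ)..t, D s)]
  exact fun t ht => ⟨hi t ht, le_mul_exp_of_le_add_mul_integral hc0 hHint hle t ht⟩

/-- Densities with vanishing relative entropy coincide. -/
theorem IsProbDensity.ae_eq_of_entropy_nonpos {u f : Phase d → ℝ} (hu : IsProbDensity Ω u)
    (hf : IsProbDensity Ω f) (hf0 : ∀ z, 0 < f z)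
    (hH : Integrable (fun z => u z * Real.log (u z / f z)) (phaseMeasure Ω d))
    (hle : ∫ z, u z * Real.log (u z / f z) ∂(phaseMeasure Ω d) ≤ 0) :
    u =ᵐ[phaseMeasure Ω d] f := by
  have h0 : ∫ z, u z * Real.log (u z / f z) ∂(phaseMeasure Ω d) = 0 :=
    le_antisymm hle (integral_mul_log_div_nonneg hu.integrable hf.integrable hu.nonneg hf0
      (by rw [hu.mass, hf.mass]) hH)
  have h1 := integral_abs_sub_le hu hf hf0 hH
  rw [h0] at h1
  simp only [Real.sqrt_zero, max_self, mul_zero] at h1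
  have h2 : ∫ z, |u z - f z| ∂(phaseMeasure Ω d) = 0 :=
    le_antisymm h1 (integral_nonneg fun z => abs_nonneg _)
  have hi : Integrable (fun z => |u z - f z|) (phaseMeasure Ω d) :=
    (hu.integrable.sub hf.integrable).abs
  filter_upwards [(integral_eq_zero_iff_of_nonneg (fun z => abs_nonneg _) hi).1 h2] with z hz
  exact sub_eq_zero.1 (abs_eq_zero.1 hz)

end Stability

end Vlasov

/-! ### The main theorem -/

theorem mainTheorem3 (lam : ℝ) (hlam : 0 < lam) :
    ∃ C : ℝ, 0 < C ∧
      ∀ (d : ℕ) (Ω : Vlasov.SpatialDomain) (ε T : ℝ) (K : Vlasov.E d → Vlasov.E d)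
        (f : ℝ → Vlasov.Phase d → ℝ) (gx gv : ℝ → Vlasov.Phase d → Vlasov.E d)
        (ftil : ℝ → Vlasov.Phase d → ℝ),
        0 ≤ ε → 0 < T →
        MemLp K ∞ (volume : Measure (Vlasov.E d)) → Vlasov.IsPeriodic Ω K →
        Vlasov.IsStrongSolution Ω ε T K f gx gv →
        Vlasov.expMoment Ω lam T f gv < ⊤ →
        Vlasov.IsWeakSolution Ω ε T K ftil →
        Vlasov.HasBoundedEntropy Ω T ftil →
        Vlasov.EntropyDissipation Ω ε T ftil →
        (∀ t ∈ Icc 0 T,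
          (∀ s ∈ Icc 0 t, Vlasov.relEntropy Ω (ftil s) (f s) ≤ 1) →
          Vlasov.relEntropy Ω (ftil t) (f t) ≤
            ENNReal.ofReal (Real.exp (C * t * Vlasov.supNorm K *
              (1 + Real.log (Vlasov.expMoment Ω lam T f gv).toReal))) *
              Vlasov.relEntropy Ω (ftil 0) (f 0)) ∧
        (ftil 0 =ᵐ[Vlasov.phaseMeasure Ω d] f 0 →
          ∀ t ∈ Icc 0 T, ftil t =ᵐ[Vlasov.phaseMeasure Ω d] f t) := by
  refine ⟨Vlasov.stabilityConst lam, Vlasov.stabilityConst_pos hlam, ?_⟩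
  intro d Ω ε T K f gx gv ftil hε hT hK _ hf hfin hu he hdis
  have h0T : (0 : ℝ) ∈ Icc 0 T := ⟨le_rfl, hT.le⟩
  refine ⟨fun t ht _ => ?_, fun h0 t ht => ?_⟩
  · by_cases hH : Integrable (fun z => ftil 0 z * Real.log (ftil 0 z / f 0 z))
      (Vlasov.phaseMeasure Ω d)
    · obtain ⟨h1, h2⟩ := hu.relEntropy_stability hf hK hε hT he hdis hlam hfin hH t ht
      rw [Vlasov.relEntropy, Vlasov.relEntropy, if_pos h1, if_pos hH,
        ← ENNReal.ofReal_mul (Real.exp_pos _).le]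
      refine ENNReal.ofReal_le_ofReal (h2.trans (le_of_eq ?_))
      rw [mul_comm]
      congr 2
      ring
    -- If H(0) = ∞ the right side is ∞, the exponential factor being nonzero.
    · rw [Vlasov.relEntropy, Vlasov.relEntropy, if_neg hH, ENNReal.mul_top]
      · exact le_top
      · simpa using Real.exp_pos _
  -- Equal initial data give H(0) = 0; the stability estimate then makes H(t) nonpositive, and
  -- Pinsker's inequality identifies the densities.
  · have hz : (fun z => ftil 0 z * Real.log (ftil 0 z / f 0 z)) =ᵐ[Vlasov.phaseMeasure Ω d]
        fun _ => 0 := by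
      filter_upwards [h0] with z hz
      rw [hz, div_self (hf.pos 0 h0T z).ne', Real.log_one, mul_zero]
    have hH : Integrable (fun z => ftil 0 z * Real.log (ftil 0 z / f 0 z))
        (Vlasov.phaseMeasure Ω d) := (integrable_zero _ _ _).congr hz.symm
    obtain ⟨h1, h2⟩ := hu.relEntropy_stability hf hK hε hT he hdis hlam hfin hH t ht
    rw [integral_congr_ae hz, integral_zero, zero_mul] at h2
    exact (hu.probDensity t ht).ae_eq_of_entropy_nonpos (hf.probDensity t ht) (hf.pos t ht) h1 h2
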